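/- **Setting.** Let $N,p,l,m\ge 1$ be integers, let $A_1,\dots,A_p$ be arbitrary complex $N\times N$ matrices, and let $U$ be a Haar-distributed random matrix in the unitary group $\mathbb U(N)$. Let $\boldsymbol P=(P_1,\dots,P_l)$ be monomials of the form $$P_i=M_{i,1}u^{\epsilon_{i,1}}M_{i,2}u^{\epsilon_{i,2}}\cdots M_{i,d_i}u^{\epsilon_{i,d_i}},\qquad d_i\ge 1,\ \epsilon_{i,j}\in\{\pm1\},$$ where each $M_{i,j}$ is a (possibly empty) word in the formal letters $a_1,a_1^*,\dots,a_p,a_p^*$. Polynomials are evaluated at $u=U$, $u^{-1}=U^*$, $a_k=A_k$, $a_k^*=A_k^*$. Assume that $\sum_i d_i=2m$ and that $m\le N$. Number the positions $(i,j)$ consecutively by $[2m]=\{1,\dots,2m\}$; write $\boldsymbol M_{\boldsymbol P}=(M_k)_{k\in[2m]}$ and $\boldsymbol\epsilon_{\boldsymbol P}=(\epsilon(k))_{k\in[2m]}$ for the words and signs so numbered, and let $$\gamma_{\boldsymbol P}=(1,\dots,d_1)(d_1+1,\dots,d_1+d_2)\cdots(d_1+\dots+d_{l-1}+1,\dots,2m).$$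 For a permutation $\varphi$ of $[2m]$ let $c(\varphi)$ be its number of cycles (fixed points included) and $\mathrm{tr}_\varphi(\boldsymbol M)=\prod_{(k_1,\dots,k_s)}\frac1N\mathrm{Tr}(M_{k_1}\cdots M_{k_s})$, the product being over the cycles of $\varphi$. The joint cumulants of random variables are defined recursively by $c_k(X_1,\dots,X_k)=\mathbb E[X_1\cdots X_k]-\sum_{\pi}\prod_{B\in\pi}c_{|B|}(X_i:i\in B)$, the sum being over the partitions $\pi$ of $\{1,\dots,k\}$ with at least two blocks. Put $\mathcal W^N_{0,l}(\boldsymbol P)=c_l(\mathrm{Tr}\,P_1,\dots,\mathrm{Tr}\,P_l)$. **Maps.** A map is a graph (loops and multiple edges allowed) embedded in a compact oriented surface with simply connected faces, up to orientation-preserving isomorphism; equivalently it is given by a finite set of half-edges with the permutation $\sigma$ sending each half-edge to the next one counterclockwise around its vertex, and the fixed-point-free involution $\alpha$ exchanging the two halves of each edge. The faces are then the cycles of $\sigma^{-1}\alpha^{-1}$, which sends a half-edge $h$ to the next half-edge, counterclockwise around the face on the left of $h$, having that face on its left. An oriented map of unitary type with set of labels $[2m]$ and $r\ge0$ black vertices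 is an oriented map with vertices colored white or black such that: (1) there are $r$ black vertices, numbered $1,\dots,r$, each of degree $4$ and with alternately ingoing and outgoing half-edges around it; (2) there are $2m$ half-edges attached to white vertices (white half-edges), labelled bijectively by $[2m]$; (3) an edge oriented from the black vertex number $k$ to the black vertex number $k'$ satisfies $k<k'$. Isomorphisms preserve all this structure. A half-edge $h$ at a black vertex receives the label of the first white half-edge met when turning clockwise, from $h$, around the face on the left of $h$ (only half-edges having that face on their left being considered). The value of a black vertex is the largest label of its outgoing half-edges, and the map is nondecreasing if the values of the black vertices $1,\dots,r$ form a weakly increasing sequence. For such a map $\mathcal C$, $\epsilon_{\mathcal C}(k)=+1$ if the white half-edge labelled $k$ is outgoing and $-1$ otherwise; $\rho_{\mathcal C}$ sends $k$ to the label of the next half-edge counterclockwise around the white vertex of the half-edge labelled $k$; $\phi_{\mathcal C}$ sends $k$ to the label of the next white half-edge having on its left the face on the left of the white half-edge labelled $k$, going counterclockwise around this face. Let $\mathfrak C_g(\boldsymbol P)$ be the set of connected nondecreasing maps of unitary type of genus $g$ with set of labels $[2m]$, with any number of black vertices, such that $\epsilon_{\mathcal C}=\boldsymbol\epsilon_{\boldsymbol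 P}$ and $\rho_{\mathcal C}=\gamma_{\boldsymbol P}^{-1}$. **Proposition.** Each set $\mathfrak C_g(\boldsymbol P)$ is finite, and $$\mathcal W^N_{0,l}(P_1,\dots,P_l)=N^{2-l}(-1)^{m+l}\sum_{g\ge0}\frac1{N^{2g}}\sum_{\mathcal C\in\mathfrak C_g(\boldsymbol P)}(-1)^{c(\phi_{\mathcal C})}\,\mathrm{tr}_{\phi_{\mathcal C}}(\boldsymbol M_{\boldsymbol P}).$$ Moreover the series is absolutely convergent: $\sum_{g\ge0}N^{-2g}\sum_{\mathcal C\in\mathfrak C_g(\boldsymbol P)}|\mathrm{tr}_{\phi_{\mathcal C}}(\boldsymbol M_{\boldsymbol P})|<\infty$. -/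

import Mathlib

open MeasureTheory

namespace UnitaryMaps

noncomputable section

/-! ### Permutations: number of cycles, traces along cycles -/

/-- The set of cycles of a permutation (fixed points are cycles of length one). -/
abbrev Cyc {α : Type*} (f : Equiv.Perm α) : Type _ := Quotient (Equiv.Perm.SameCycle.setoid f)

/-- The number `c(f)` of cycles of a permutation, fixed points included. -/
def numCycles {α : Type*} (f : Equiv.Perm α) : ℕ := Nat.card (Cyc f)

/-- The ordered product `M x * M (f x) * M (f (f x)) * ⋯` along the cycle of `f` through `x`. -/
def cycleProd {α R : Type*} [Monoid R] (f : Equiv.Perm α) (M : α → R) (x : α) : R :=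
  ((List.range (Function.minimalPeriod f x)).map fun n => M (f^[n] x)).prod

/-- The normalized trace `tr = N⁻¹ Tr`. -/
def ntr {N : ℕ} (X : Matrix (Fin N) (Fin N) ℂ) : ℂ := (N : ℂ)⁻¹ * X.trace

/-- `tr_f(M)`: the product over the cycles of `f` of the normalized trace of the ordered product
of the `M i` along the cycle. By traciality, the starting point on each cycle is irrelevant. -/
def trPerm {α : Type*} [Finite α] {N : ℕ} (f : Equiv.Perm α)
    (M : α → Matrix (Fin N) (Fin N) ℂ) : ℂ :=
  ∏ᶠ c : Cyc f, ntr (cycleProd f M c.out)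

/-! ### Noncommutative polynomials and monomials -/

/-- The formal letters `u, u⁻¹, a_i, a_i^*`, `i ∈ Fin p`; there is no relation between them. -/
inductive Letter (p : ℕ) : Type
  | u : Letter p
  | uInv : Letter p
  | a (i : Fin p) : Letter p
  | aStar (i : Fin p) : Letter p

/-- The letters `a_i, a_i^*` only. -/
inductive ALetter (p : ℕ) : Type
  | a (i : Fin p) : ALetter p
  | aStar (i : Fin p) : ALetter p

/-- Inclusion of the letters `a_i, a_i^*` into all letters. -/
def ALetter.toLetter {p : ℕ} : ALetter p → Letter p
  | .a i => .a i
  | .aStar i => .aStar i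

/-- The algebra `ℂ⟨u, u⁻¹, a_i, a_i^*⟩` of noncommutative polynomials. -/
abbrev NCPoly (p : ℕ) : Type := FreeAlgebra ℂ (Letter p)

/-- Value of a letter at a unitary matrix `U` and matrices `A i`. -/
def Letter.eval {p N : ℕ} (A : Fin p → Matrix (Fin N) (Fin N) ℂ)
    (U : Matrix.unitaryGroup (Fin N) ℂ) : Letter p → Matrix (Fin N) (Fin N) ℂ
  | .u => (U : Matrix (Fin N) (Fin N) ℂ)
  | .uInv => (U : Matrix (Fin N) (Fin N) ℂ).conjTranspose
  | .a i => A i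
  | .aStar i => (A i).conjTranspose

/-- Evaluation of noncommutative polynomials at `U, U^*, A_i, A_i^*`. -/
def evalPoly {p N : ℕ} (A : Fin p → Matrix (Fin N) (Fin N) ℂ)
    (U : Matrix.unitaryGroup (Fin N) ℂ) : NCPoly p →ₐ[ℂ] Matrix (Fin N) (Fin N) ℂ :=
  FreeAlgebra.lift ℂ (Letter.eval A U)

/-- The letter `u^ε` for a sign `ε = ±1`. -/
def uPow {p : ℕ} (ε : ℤˣ) : Letter p := if ε = 1 then Letter.u else Letter.uInv

/-- A monomial `M_1 u^{ε_1} M_2 u^{ε_2} ⋯ M_d u^{ε_d}`, with `d ≥ 1`, `ε_j = ±1`, and `M_j` a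
possibly empty word in the letters `a_i, a_i^*`. -/
structure Monomial (p : ℕ) : Type where
  deg : ℕ
  deg_pos : 1 ≤ deg
  word : Fin deg → List (ALetter p)
  sign : Fin deg → ℤˣ

/-- The monomial as a word in the letters. -/
def Monomial.toWord {p : ℕ} (P : Monomial p) : List (Letter p) :=
  (List.ofFn fun j => (P.word j).map ALetter.toLetter ++ [uPow (P.sign j)]).flatten

/-- The monomial as a noncommutative polynomial. -/
def Monomial.toPoly {p : ℕ} (P : Monomial p) : NCPoly p :=
  (P.toWord.map (FreeAlgebra.ι ℂ)).prod

/-- Value of a word in the letters `a_i, a_i^*` at the matrices `A i`. -/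
def evalWord {p N : ℕ} (A : Fin p → Matrix (Fin N) (Fin N) ℂ) (w : List (ALetter p)) :
    Matrix (Fin N) (Fin N) ℂ :=
  (w.map fun x => match x with
    | .a i => A i
    | .aStar i => (A i).conjTranspose).prod

/-- `deg P = ∑ deg P_i`, for a tuple of monomials. -/
abbrev degTuple {p l : ℕ} (P : Fin l → Monomial p) : ℕ := ∑ i, (P i).deg

/-- The tuple `(M_{1,1}, …, M_{1,d_1}, …, M_{l,1}, …, M_{l,d_l})`, evaluated at the `A i`. The
positions `(i, j)` are numbered consecutively. -/
def matTuple {p l N : ℕ} (A : Fin p → Matrix (Fin N) (Fin N) ℂ) (P : Fin l → Monomial p) :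
    Fin (degTuple P) → Matrix (Fin N) (Fin N) ℂ :=
  fun k => evalWord A ((P (finSigmaFinEquiv.symm k).1).word (finSigmaFinEquiv.symm k).2)

/-- The tuple of signs `(ε_{1,1}, …, ε_{1,d_1}, …, ε_{l,1}, …, ε_{l,d_l})`. -/
def signTuple {p l : ℕ} (P : Fin l → Monomial p) : Fin (degTuple P) → ℤˣ :=
  fun k => (P (finSigmaFinEquiv.symm k).1).sign (finSigmaFinEquiv.symm k).2

/-- The permutation `γ_P = (1, …, d_1)(d_1 + 1, …, d_1 + d_2) ⋯`, whose cycles are the blocks of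
consecutive positions in each monomial. -/
def gammaPerm {p l : ℕ} (P : Fin l → Monomial p) : Equiv.Perm (Fin (degTuple P)) :=
  finSigmaFinEquiv.permCongr (Equiv.sigmaCongrRight fun i => finRotate (P i).deg)

/-! ### Haar measure on the unitary group and cumulants -/

instance unitaryGroupCompact (N : ℕ) : CompactSpace (Matrix.unitaryGroup (Fin N) ℂ) := by
  refine isCompact_iff_compactSpace.1 (?_ : IsCompact
    ((Matrix.unitaryGroup (Fin N) ℂ : Submonoid (Matrix (Fin N) (Fin N) ℂ)) :
      Set (Matrix (Fin N) (Fin N) ℂ)))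
  have hK : IsCompact (Set.pi Set.univ fun _ : Fin N => Set.pi Set.univ fun _ : Fin N =>
      Metric.closedBall (0 : ℂ) 1) :=
    isCompact_univ_pi fun _ => isCompact_univ_pi fun _ => isCompact_closedBall _ _
  refine IsCompact.of_isClosed_subset (s := Set.pi Set.univ fun _ : Fin N =>
    Set.pi Set.univ fun _ : Fin N => Metric.closedBall (0 : ℂ) 1) hK ?_ ?_
  · have : ((Matrix.unitaryGroup (Fin N) ℂ : Submonoid (Matrix (Fin N) (Fin N) ℂ)) :
        Set (Matrix (Fin N) (Fin N) ℂ)) = {U | U * star U = 1} := by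
      ext U
      exact Matrix.mem_unitaryGroup_iff
    rw [this]
    exact isClosed_eq (by fun_prop) continuous_const
  · intro U hU i _ j _
    simpa using entry_norm_bound_of_unitary hU i j

instance unitaryGroupMeasurableSpace (N : ℕ) :
    MeasurableSpace (Matrix.unitaryGroup (Fin N) ℂ) := borel _

instance unitaryGroupBorelSpace (N : ℕ) : BorelSpace (Matrix.unitaryGroup (Fin N) ℂ) := ⟨rfl⟩

/-- The Haar probability measure on the unitary group `U(N)`. -/
def haarU (N : ℕ) : Measure (Matrix.unitaryGroup (Fin N) ℂ) := Measure.haarMeasure ⊤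

/-- The joint moment `E[∏_{i ∈ s} X_i]`. -/
def jointMoment {Ω ι : Type*} [MeasurableSpace Ω] (μ : Measure Ω) (X : ι → Ω → ℂ)
    (s : Finset ι) : ℂ := ∫ ω, ∏ i ∈ s, X i ω ∂μ

/-- The joint cumulant of the family `(X_i)_{i ∈ s}`, defined recursively by
`c(s) = m(s) - ∑_π ∏_{B ∈ π} c(B)`, the sum being over the partitions `π` of `s` with at least
two blocks. -/
def jointCumulant {Ω ι : Type*} [MeasurableSpace Ω] [Fintype ι] [DecidableEq ι] (μ : Measure Ω)
    (X : ι → Ω → ℂ) (s : Finset ι) : ℂ :=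
  jointMoment μ X s -
    ∑ π : {π : Finpartition s // 2 ≤ π.parts.card},
      ∏ B : {B : Finset ι // B ∈ π.1.parts}, jointCumulant μ X B.1
termination_by s.card
decreasing_by
  apply Finset.card_lt_card
  refine lt_of_le_of_ne (π.1.le B.2) ?_
  intro h
  obtain ⟨C, hC, hne⟩ := Finset.exists_mem_ne (s := π.1.parts) (by have := π.2; omega) B.1
  have hd := π.1.disjoint hC B.2 hne
  have hCs : C ≤ B.1 := (π.1.le hC).trans h.ge
  exact π.1.ne_bot hC (le_bot_iff.1 (hd le_rfl hCs))

/-- The joint cumulant of `Tr P_1, …, Tr P_l` under the Haar measure of `U(N)`. -/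
def haarCumulant {p N l : ℕ} (A : Fin p → Matrix (Fin N) (Fin N) ℂ) (P : Fin l → NCPoly p) : ℂ :=
  jointCumulant (haarU N) (fun i U => (evalPoly A U (P i)).trace) Finset.univ

/-! ### Oriented maps -/

/-- An oriented map with set of half-edges `H`: `σ h` is the half-edge following `h`
counterclockwise around the vertex of `h`, `α h` is the other half of the edge of `h`, and
`orient h` is `1` if `h` is outgoing and `-1` if `h` is ingoing. The vertices are the cycles of
`σ` and the edges are the cycles of `α`. -/
structure OrientedMap (H : Type*) where
  σ : Equiv.Perm H
  α : Equiv.Perm H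
  orient : H → ℤˣ
  α_α : ∀ h, α (α h) = h
  orient_α : ∀ h, orient (α h) = -orient h

namespace OrientedMap

variable {H : Type*} (C : OrientedMap H)

/-- `φ h` is the next half-edge having on its left the face on the left of `h`, when going
counterclockwise around that face; so `φ α σ = 1`. The faces are the cycles of `φ`. -/
def φ : Equiv.Perm H := C.σ⁻¹ * C.α⁻¹

/-- Any two half-edges are related by a product of the permutations `σ^{±1}, α^{±1}`. -/
def Connected : Prop :=
  ∀ h h' : H, ∃ f ∈ Subgroup.closure ({C.σ, C.α} : Set (Equiv.Perm H)), f h = h'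

/-- The Euler characteristic: vertices minus edges plus faces. -/
def eulerChar : ℤ := (numCycles C.σ : ℤ) - numCycles C.α + numCycles C.φ

end OrientedMap

/-! ### Maps of unitary type -/

/-- A map of unitary type with set of half-edges `H`, labels in `I` and `r` black vertices.
`vertex h` is `none` if `h` is attached to a white vertex, and `some k` if `h` is attached to the
black vertex numbered `k`. -/
structure UnitaryMap (I : Type*) (r : ℕ) (H : Type*) extends OrientedMap H where
  vertex : H → Option (Fin r)
  vertex_σ : ∀ h, vertex (σ h) = vertex h
  /-- the half-edges numbered `k` form a single vertex -/
  black_cycle : ∀ h h', vertex h ≠ none → vertex h = vertex h' → σ.SameCycle h h'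
  /-- black vertices have degree four -/
  black_degree : ∀ k, Nat.card {h : H // vertex h = some k} = 4
  /-- black vertices are alternated -/
  black_alternated : ∀ h, vertex h ≠ none → orient (σ h) = -orient h
  /-- the white half-edges are labelled by `I` -/
  label : I ≃ {h : H // vertex h = none}
  /-- edges between black vertices go from smaller to larger numbers -/
  black_increasing : ∀ h k k', orient h = 1 → vertex h = some k → vertex (α h) = some k' → k < k'

namespace UnitaryMap

variable {I : Type*} {r : ℕ} {H : Type*} (C : UnitaryMap I r H)

/-- Being a white half-edge. -/
def White (h : H) : Prop := C.vertex h = none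

/-- The sign `ε(i)` of the white half-edge labelled `i`. -/
def eps (i : I) : ℤˣ := C.orient (C.label i)

/-- The permutation of the labels describing how the half-edges are arranged counterclockwise
around the white vertices. -/
def rho : Equiv.Perm I :=
  C.label.symm.permCongr (C.σ.subtypePerm fun h => by rw [C.vertex_σ h])

theorem label_rho (i : I) : (C.label (C.rho i) : H) = C.σ (C.label i) := by
  simp [rho, Equiv.permCongr_apply]

theorem exists_white_out (n : ℕ) : ∀ h : H, C.orient h = 1 →
    (∀ k, C.vertex h = some k → (k : ℕ) < n) → ∃ j : ℕ, C.White ((C.φ⁻¹ : Equiv.Perm H)^[j] h) := by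
  induction n with
  | zero =>
    intro h _ hn
    refine ⟨0, ?_⟩
    cases hv : C.vertex h with
    | none => exact hv
    | some k => exact absurd (hn k hv) (Nat.not_lt_zero _)
  | succ n ih =>
    intro h ho hn
    cases hv : C.vertex h with
    | none => exact ⟨0, hv⟩
    | some k =>
      have hb : C.vertex h ≠ none := by simp [hv]
      have hφ : (C.φ⁻¹ : Equiv.Perm H) h = C.α (C.σ h) := by simp [OrientedMap.φ]
      have ho' : C.orient ((C.φ⁻¹ : Equiv.Perm H) h) = 1 := by
        rw [hφ, C.orient_α, C.black_alternated h hb, ho, neg_neg]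
      obtain ⟨j, hj⟩ := ih _ ho' (by
        intro k' hk'
        have hlt := C.black_increasing _ k' k ho' hk' (by
          rw [hφ, C.α_α, C.vertex_σ, hv])
        have := hn k hv
        have : (k' : ℕ) < k := hlt
        omega)
      exact ⟨j + 1, by rwa [Function.iterate_succ_apply]⟩

theorem exists_white_in (n : ℕ) : ∀ h : H, C.orient h = -1 →
    (∀ k, C.vertex h = some k → r - (k : ℕ) ≤ n) →
    ∃ j : ℕ, C.White ((C.φ⁻¹ : Equiv.Perm H)^[j] h) := by
  induction n with
  | zero =>
    intro h _ hn
    refine ⟨0, ?_⟩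
    cases hv : C.vertex h with
    | none => exact hv
    | some k =>
      have := hn k hv
      have := k.2
      omega
  | succ n ih =>
    intro h ho hn
    cases hv : C.vertex h with
    | none => exact ⟨0, hv⟩
    | some k =>
      have hb : C.vertex h ≠ none := by simp [hv]
      have hφ : (C.φ⁻¹ : Equiv.Perm H) h = C.α (C.σ h) := by simp [OrientedMap.φ]
      have hσ : C.orient (C.σ h) = 1 := by rw [C.black_alternated h hb, ho, neg_neg]
      have ho' : C.orient ((C.φ⁻¹ : Equiv.Perm H) h) = -1 := by rw [hφ, C.orient_α, hσ]
      obtain ⟨j, hj⟩ := ih _ ho' (by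
        intro k' hk'
        have hlt := C.black_increasing (C.σ h) k k' hσ (by rw [C.vertex_σ, hv]) (by
          rw [← hφ, hk'])
        have := hn k hv
        have : (k : ℕ) < k' := hlt
        omega)
      exact ⟨j + 1, by rwa [Function.iterate_succ_apply]⟩

/-- Turning clockwise around the face on the left of `h`, one meets a white half-edge. -/
theorem exists_white (h : H) : ∃ j : ℕ, C.White ((C.φ⁻¹ : Equiv.Perm H)^[j] h) := by
  rcases Int.units_eq_one_or (C.orient h) with ho | ho
  · exact C.exists_white_out r h ho fun k _ => k.2
  · exact C.exists_white_in r h ho fun k _ => Nat.sub_le _ _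

open Classical in
/-- The label of an arbitrary half-edge `h`: the label of the first white half-edge met when
turning clockwise, starting from `h`, around the face on the left of `h`. -/
def labelOf (h : H) : I :=
  C.label.symm ⟨(C.φ⁻¹ : Equiv.Perm H)^[Nat.find (C.exists_white h)] h,
    Nat.find_spec (C.exists_white h)⟩

/-- The set of outgoing half-edges at the black vertex numbered `k`. -/
def blackOut (k : Fin r) : Set H := {h | C.vertex h = some k ∧ C.orient h = 1}

theorem blackOut_nonempty (k : Fin r) : (C.blackOut k).Nonempty := by
  have hc := C.black_degree k
  have hne : Nonempty {h : H // C.vertex h = some k} := by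
    by_contra hcon
    rw [not_nonempty_iff] at hcon
    simp at hc
  obtain ⟨h, hk⟩ := hne
  rcases Int.units_eq_one_or (C.orient h) with ho | ho
  · exact ⟨h, hk, ho⟩
  · refine ⟨C.σ h, by rw [C.vertex_σ, hk], ?_⟩
    rw [C.black_alternated h (by simp [hk]), ho, neg_neg]

theorem blackOut_finite (k : Fin r) : (C.blackOut k).Finite := by
  have hf : Finite {h : H // C.vertex h = some k} :=
    Nat.finite_of_card_ne_zero (by rw [C.black_degree k]; norm_num)
  exact Set.Finite.subset (s := {h : H | C.vertex h = some k}) (Set.finite_coe_iff.1 hf)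
    fun h hh => hh.1

/-- The value of the black vertex numbered `k`: the largest label of an outgoing half-edge. -/
def val [LinearOrder I] (k : Fin r) : I :=
  (C.blackOut_finite k).toFinset.sup' (by simpa using C.blackOut_nonempty k) C.labelOf

/-- The values of the black vertices are weakly increasing. -/
def Nondecreasing [LinearOrder I] : Prop := ∀ k k' : Fin r, k ≤ k' → C.val k ≤ C.val k'

section Phi

variable [Finite H]

theorem exists_return (i : I) : ∃ j : ℕ, C.White (C.φ^[j + 1] (C.label i)) := by
  refine ⟨orderOf C.φ - 1, ?_⟩
  have hpos : 0 < orderOf C.φ := orderOf_pos C.φ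
  rw [Nat.sub_add_cancel hpos, Equiv.Perm.iterate_eq_pow, pow_orderOf_eq_one]
  exact (C.label i).2

open Classical in
/-- `nextWhite i` is the label of the first white half-edge met after the white half-edge
labelled `i`, when going counterclockwise around the face on its left. -/
def nextWhite (i : I) : I :=
  C.label.symm ⟨C.φ^[Nat.find (C.exists_return i) + 1] (C.label i),
    Nat.find_spec (C.exists_return i)⟩

theorem label_nextWhite [DecidablePred C.White] (i : I) : (C.label (C.nextWhite i) : H) =
    C.φ^[Nat.find (C.exists_return i) + 1] (C.label i) := by
  simp only [nextWhite, Equiv.apply_symm_apply]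
  congr!

open Classical in
theorem nextWhite_injective : Function.Injective C.nextWhite := by
  have key : ∀ i i' : I, C.nextWhite i = C.nextWhite i' →
      Nat.find (C.exists_return i) ≤ Nat.find (C.exists_return i') → i = i' := by
    intro i i' hii hle
    have h1 := C.label_nextWhite i
    have h2 := C.label_nextWhite i'
    rw [hii, h2] at h1
    obtain ⟨d, hd⟩ := Nat.exists_eq_add_of_le hle
    have h3 : C.φ^[d] (C.label i') = C.label i := by
      have : Nat.find (C.exists_return i') + 1 = (Nat.find (C.exists_return i) + 1) + d := by omega
      rw [this, Function.iterate_add_apply] at h1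
      exact (C.φ.injective.iterate _) h1
    rcases Nat.eq_zero_or_pos d with rfl | hdpos
    · exact (C.label.injective (Subtype.ext h3)).symm
    · exfalso
      refine Nat.find_min (C.exists_return i') (m := d - 1) (by omega) ?_
      rw [Nat.sub_add_cancel hdpos, h3]
      exact (C.label i).2
  intro i i' hii
  rcases le_total (Nat.find (C.exists_return i)) (Nat.find (C.exists_return i')) with hle | hle
  · exact key i i' hii hle
  · exact (key i' i hii.symm hle).symm

/-- The permutation `φ_C` of the labels describing the order of the white half-edges around the
faces. -/
def phi : Equiv.Perm I :=
  haveI : Finite I := Finite.of_equiv _ C.label.symm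
  Equiv.ofBijective C.nextWhite (Finite.injective_iff_bijective.1 C.nextWhite_injective)

end Phi

end UnitaryMap

/-! ### Isomorphism classes -/

/-- A map of unitary type on some finite set of half-edges. -/
structure MapRep (I : Type*) (r : ℕ) where
  H : Type
  finite : Finite H
  map : UnitaryMap I r H

/-- Isomorphisms of maps of unitary type preserve the whole structure, including orientation,
colors, numbers of the black vertices and labels. -/
def MapRep.Iso {I : Type*} {r : ℕ} (C D : MapRep I r) : Prop :=
  ∃ e : C.H ≃ D.H, (∀ h, e (C.map.σ h) = D.map.σ (e h)) ∧ (∀ h, e (C.map.α h) = D.map.α (e h)) ∧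
    (∀ h, D.map.orient (e h) = C.map.orient h) ∧ (∀ h, D.map.vertex (e h) = C.map.vertex h) ∧
    ∀ i, e (C.map.label i) = D.map.label i

instance mapSetoid (I : Type*) (r : ℕ) : Setoid (MapRep I r) where
  r := MapRep.Iso
  iseqv := by
    refine ⟨fun C => ⟨Equiv.refl _, by simp⟩, ?_, ?_⟩
    · rintro C D ⟨e, h1, h2, h3, h4, h5⟩
      refine ⟨e.symm, fun h => ?_, fun h => ?_, fun h => ?_, fun h => ?_, fun i => ?_⟩
      · rw [Equiv.symm_apply_eq, h1, Equiv.apply_symm_apply]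
      · rw [Equiv.symm_apply_eq, h2, Equiv.apply_symm_apply]
      · rw [← h3, Equiv.apply_symm_apply]
      · rw [← h4, Equiv.apply_symm_apply]
      · rw [Equiv.symm_apply_eq, h5]
    · rintro C D E ⟨e, h1, h2, h3, h4, h5⟩ ⟨f, k1, k2, k3, k4, k5⟩
      exact ⟨e.trans f, by simp [h1, k1], by simp [h2, k2], by simp [h3, k3], by simp [h4, k4],
        by simp [h5, k5]⟩

/-- The maps of unitary type with labels in `I` (up to isomorphism), with any number of black
vertices. -/
abbrev UMap (I : Type*) : Type _ := Σ r : ℕ, Quotient (mapSetoid I r)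

theorem numCycles_congr {α β : Type*} (e : α ≃ β) (f : Equiv.Perm α) (g : Equiv.Perm β)
    (hfg : ∀ x, e (f x) = g (e x)) : numCycles f = numCycles g := by
  have hg : g = e.permCongr f := by
    ext x
    simp [Equiv.permCongr_apply, hfg]
  subst hg
  refine Nat.card_congr (Quotient.congr e fun x y => ?_)
  change f.SameCycle x y ↔ (e.permCongr f).SameCycle (e x) (e y)
  have hz : ∀ n : ℤ, ((e.permCongr f) ^ n) (e x) = e ((f ^ n) x) := by
    intro n
    have := map_zpow e.permCongrHom f n
    have h2 : (e.permCongr f) ^ n = e.permCongr (f ^ n) := this.symm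
    rw [h2]
    simp [Equiv.permCongr_apply]
  simp only [Equiv.Perm.SameCycle, hz, e.apply_eq_iff_eq]

section Invariance

variable {I : Type*} {r : ℕ} {H H' : Type*} {C : UnitaryMap I r H} {D : UnitaryMap I r H'}
  (e : H ≃ H')

theorem φ_iso (h1 : ∀ h, e (C.σ h) = D.σ (e h)) (h2 : ∀ h, e (C.α h) = D.α (e h)) (h : H) :
    e (C.φ h) = D.φ (e h) := by
  have h1' : ∀ h, e (C.σ⁻¹ h) = D.σ⁻¹ (e h) := fun h => by
    rw [Equiv.Perm.eq_inv_iff_eq, ← h1]; simp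
  have h2' : ∀ h, e (C.α⁻¹ h) = D.α⁻¹ (e h) := fun h => by
    rw [Equiv.Perm.eq_inv_iff_eq, ← h2]; simp
  simp only [OrientedMap.φ, Equiv.Perm.mul_apply, h1', h2']

theorem φ_iso_inv (h1 : ∀ h, e (C.σ h) = D.σ (e h)) (h2 : ∀ h, e (C.α h) = D.α (e h)) (h : H) :
    e ((C.φ⁻¹ : Equiv.Perm H) h) = (D.φ⁻¹ : Equiv.Perm H') (e h) := by
  rw [Equiv.Perm.eq_inv_iff_eq, ← φ_iso e h1 h2]; simp

theorem eulerChar_iso (h1 : ∀ h, e (C.σ h) = D.σ (e h)) (h2 : ∀ h, e (C.α h) = D.α (e h)) :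
    C.eulerChar = D.eulerChar := by
  simp only [OrientedMap.eulerChar, numCycles_congr e _ _ h1, numCycles_congr e _ _ h2,
    numCycles_congr e _ _ (φ_iso e h1 h2)]

theorem connected_of_iso (h1 : ∀ h, e (C.σ h) = D.σ (e h)) (h2 : ∀ h, e (C.α h) = D.α (e h))
    (hC : C.Connected) : D.Connected := by
  intro x y
  obtain ⟨f, hf, hxy⟩ := hC (e.symm x) (e.symm y)
  have key : ∀ f ∈ Subgroup.closure ({C.σ, C.α} : Set (Equiv.Perm H)),
      e.permCongr f ∈ Subgroup.closure ({D.σ, D.α} : Set (Equiv.Perm H')) := by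
    intro f hf
    have hm : e.permCongrHom f ∈
        (Subgroup.closure ({C.σ, C.α} : Set (Equiv.Perm H))).map e.permCongrHom.toMonoidHom :=
      ⟨f, hf, rfl⟩
    rw [MonoidHom.map_closure, Set.image_pair] at hm
    have a1 : e.permCongrHom.toMonoidHom C.σ = D.σ := by
      ext x
      change e (C.σ (e.symm x)) = _
      rw [h1, Equiv.apply_symm_apply]
    have a2 : e.permCongrHom.toMonoidHom C.α = D.α := by
      ext x
      change e (C.α (e.symm x)) = _
      rw [h2, Equiv.apply_symm_apply]
    rw [a1, a2] at hm
    exact hm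
  exact ⟨_, key f hf, by simp [Equiv.permCongr_apply, hxy]⟩

theorem eps_iso (h3 : ∀ h, D.orient (e h) = C.orient h)
    (h5 : ∀ i, e (C.label i) = D.label i) : C.eps = D.eps := by
  funext i
  simp only [UnitaryMap.eps, ← h5, h3]

theorem rho_iso (h1 : ∀ h, e (C.σ h) = D.σ (e h)) (h5 : ∀ i, e (C.label i) = D.label i) :
    C.rho = D.rho := by
  ext i
  apply D.label.injective
  apply Subtype.ext
  rw [← h5, C.label_rho, D.label_rho, h1, h5]

theorem labelOf_iso (h1 : ∀ h, e (C.σ h) = D.σ (e h)) (h2 : ∀ h, e (C.α h) = D.α (e h))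
    (h4 : ∀ h, D.vertex (e h) = C.vertex h)
    (h5 : ∀ i, e (C.label i) = D.label i) (h : H) : C.labelOf h = D.labelOf (e h) := by
  classical
  have hit : ∀ n : ℕ, e ((C.φ⁻¹ : Equiv.Perm H)^[n] h) = (D.φ⁻¹ : Equiv.Perm H')^[n] (e h) :=
    fun n => (Function.Semiconj.iterate_right (f := e) (φ_iso_inv e h1 h2) n) h
  have hw : ∀ n : ℕ, C.White ((C.φ⁻¹ : Equiv.Perm H)^[n] h) ↔
      D.White ((D.φ⁻¹ : Equiv.Perm H')^[n] (e h)) := by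
    intro n
    rw [← hit, UnitaryMap.White, UnitaryMap.White, h4]
  apply D.label.injective
  apply Subtype.ext
  rw [← h5]
  simp only [UnitaryMap.labelOf, Equiv.apply_symm_apply]
  rw [hit]
  congr! 2
  exact funext fun n => propext (hw n)

theorem val_iso [LinearOrder I] (h1 : ∀ h, e (C.σ h) = D.σ (e h))
    (h2 : ∀ h, e (C.α h) = D.α (e h)) (h3 : ∀ h, D.orient (e h) = C.orient h)
    (h4 : ∀ h, D.vertex (e h) = C.vertex h)
    (h5 : ∀ i, e (C.label i) = D.label i) (k : Fin r) : C.val k = D.val k := by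
  apply le_antisymm
  · refine Finset.sup'_le _ _ fun h hh => ?_
    rw [labelOf_iso e h1 h2 h4 h5]
    refine Finset.le_sup' D.labelOf ?_
    simpa [UnitaryMap.blackOut, h3, h4] using hh
  · refine Finset.sup'_le _ _ fun h hh => ?_
    obtain ⟨h, rfl⟩ := e.surjective h
    rw [← labelOf_iso e h1 h2 h4 h5]
    refine Finset.le_sup' C.labelOf ?_
    simpa [UnitaryMap.blackOut, h3, h4] using hh

theorem phi_iso [Finite H] [Finite H'] (h1 : ∀ h, e (C.σ h) = D.σ (e h))
    (h2 : ∀ h, e (C.α h) = D.α (e h)) (h4 : ∀ h, D.vertex (e h) = C.vertex h)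
    (h5 : ∀ i, e (C.label i) = D.label i) : C.phi = D.phi := by
  classical
  ext i
  change C.nextWhite i = D.nextWhite i
  have hit : ∀ n : ℕ, e (C.φ^[n] (C.label i)) = D.φ^[n] (D.label i) := by
    intro n
    rw [← h5]
    exact (Function.Semiconj.iterate_right (f := e) (φ_iso e h1 h2) n) _
  have hw : ∀ n : ℕ, C.White (C.φ^[n] (C.label i)) ↔ D.White (D.φ^[n] (D.label i)) := by
    intro n
    rw [← hit, UnitaryMap.White, UnitaryMap.White, h4]
  apply D.label.injective
  apply Subtype.ext
  rw [← h5]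
  simp only [UnitaryMap.nextWhite, Equiv.apply_symm_apply]
  rw [hit]
  congr! 3
  exact funext fun n => propext (hw (n + 1))

end Invariance

namespace UMap

variable {I : Type*}

/-- The signs `ε_C` of the white half-edges. -/
def eps (C : UMap I) : I → ℤˣ :=
  Quotient.lift (fun D : MapRep I C.1 => D.map.eps)
    (by rintro D E ⟨e, _, _, h3, _, h5⟩; exact eps_iso e h3 h5) C.2

/-- The permutation `ρ_C`: cyclic order of the half-edges around the white vertices. -/
def rho (C : UMap I) : Equiv.Perm I :=
  Quotient.lift (fun D : MapRep I C.1 => D.map.rho)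
    (by rintro D E ⟨e, h1, _, _, _, h5⟩; exact rho_iso e h1 h5) C.2

/-- The permutation `φ_C`: cyclic order of the white half-edges around the faces. -/
def phi (C : UMap I) : Equiv.Perm I :=
  Quotient.lift (fun D : MapRep I C.1 => haveI := D.finite; D.map.phi)
    (by
      rintro D E ⟨e, h1, h2, _, h4, h5⟩
      have := D.finite
      have := E.finite
      exact phi_iso e h1 h2 h4 h5) C.2

/-- The Euler characteristic of the map. -/
def eulerChar (C : UMap I) : ℤ :=
  Quotient.lift (fun D : MapRep I C.1 => D.map.eulerChar)
    (by rintro D E ⟨e, h1, h2, _, _, _⟩; exact eulerChar_iso e h1 h2) C.2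

/-- The map is connected. -/
def Connected (C : UMap I) : Prop :=
  Quotient.lift (fun D : MapRep I C.1 => D.map.Connected)
    (by
      intro D E hDE
      refine propext ⟨fun h => ?_, fun h => ?_⟩
      · obtain ⟨e, h1, h2, _⟩ := hDE
        exact connected_of_iso e h1 h2 h
      · obtain ⟨e, h1, h2, _⟩ := (mapSetoid I C.1).symm hDE
        exact connected_of_iso e h1 h2 h) C.2

/-- The values of the black vertices are weakly increasing. -/
def Nondecreasing [LinearOrder I] (C : UMap I) : Prop :=
  Quotient.lift (fun D : MapRep I C.1 => D.map.Nondecreasing)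
    (by
      rintro D E ⟨e, h1, h2, h3, h4, h5⟩
      simp only [UnitaryMap.Nondecreasing, val_iso e h1 h2 h3 h4 h5]) C.2

end UMap

/-- The connected nondecreasing maps of unitary type `C` of genus `g` with set of labels `I`,
such that `ε_C = ε` and `ρ_C = ρ`. The genus of a connected map is given by Euler's formula
`V - E + F = 2 - 2 g`. -/
def connectedMaps {I : Type*} [LinearOrder I] (g : ℕ) (ε : I → ℤˣ) (ρ : Equiv.Perm I) :
    Set (UMap I) :=
  {C | C.Connected ∧ C.Nondecreasing ∧ C.eulerChar = 2 - 2 * (g : ℤ) ∧ C.eps = ε ∧ C.rho = ρ}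

end

end UnitaryMaps

open UnitaryMaps

set_option linter.unusedSectionVars false

/-! The Haar measure is invariant under `U ↦ exp(tA) U`. Differentiating at `t = 0` gives the
Schwinger–Dyson equations for the joint moments of the entries of `U` and `U^*`. Let `b` be the
largest position of sign `1` in a set `S` of positions with as many signs `1` as `-1`. A combination
of these equations reads `(N + J) E = G`: here `J` is the sum of the transpositions `(a b)`, `a < b`
of sign `1`, acting on the row indices, and `G` is a sum of moments on `S` deprived of `b` and of
one position of sign `-1`. Since `m ≤ N`, the operator `J` has fewer than `N` terms, so that `N + J`
is inverted by an absolutely convergent Neumann series indexed by words (`hasSum_neumann`).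
Iterating over `b` expresses a moment as a sum over walks, that is, over pairs formed of a
sign-reversing pairing `α` and a word of transpositions `(a b)`, `a < b`, with weakly increasing
`b`. With `τ` the product of the word and `r` its length, the weight is `N^{-m} (-1/N)^r`, and the
row and column indices are linked by `α τ` (`hasSum_walk`).

Inserted in products of traces, this yields the product of the traces along the cycles of `γ α τ`
(`hasSum_traceOn`). The contribution of a walk is multiplicative over juxtaposition, and every walk
splits uniquely into the component of a given monomial and the rest (`glue_bijective`,
`walkWeight_glue`). The sums over connected walks therefore satisfy the recursion which
characterizes cumulants (`walk_recursion`, `cumulant_unique`).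

It remains to see walks as maps. In a map of unitary type, the outgoing half-edges with a given
label form a chain which starts at an outgoing white half-edge, runs through black vertices with
increasing numbers, and stops at an edge arriving at an ingoing white half-edge. The two ends of the
chains define a pairing, and the two labels going out of each black vertex define a transposition;
nondecreasing maps give monotone words. Following a face turn by turn shows that `φ_C = ρ_C⁻¹ α τ`,
once the pairing of the ends is conjugated by `τ` (`UnitaryMap.phi_eq`). A map is determined by
these data (`UMap.walk_injective`), and every walk arises by inserting black vertices one at a time
(`UMap.exists_walk`). The two notions of connectedness agree.

Finally, Euler's formula becomes `c(φ_C) + l + 2g = m + r + 2`. This converts the weight `N^{-m}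
(-1/N)^r N^{c(φ_C)}` into the announced power of `N` and sign, and bounds `r` when `g` is fixed,
whence finiteness. For connected walks such a `g ≥ 0` exists because each multiplication by a
transposition changes the number of cycles by one (`exists_genus`). Absolute convergence is
inherited from the Neumann series. -/

namespace UnitaryMaps

section

open Equiv Equiv.Perm

/-! ### Number of cycles and multiplication by a transposition -/

/-- The equivalence relation obtained from `s` by identifying the classes of `x` and `y`. -/
def joinPair {α : Type*} (s : Setoid α) (x y : α) : Setoid α where
  r a b := s a b ∨ (s a x ∧ s b y) ∨ (s a y ∧ s b x)
  iseqv := by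
    have h1 := s.refl'
    have h2 := @s.symm'
    have h3 := @s.trans'
    refine ⟨fun a => Or.inl (h1 a), ?_, ?_⟩
    · rintro a b (h | h | h)
      · exact Or.inl (h2 h)
      · exact Or.inr (Or.inr ⟨h.2, h.1⟩)
      · exact Or.inr (Or.inl ⟨h.2, h.1⟩)
    · rintro a b c (h | h | h) (k | k | k)
      · exact Or.inl (h3 h k)
      · exact Or.inr (Or.inl ⟨h3 h k.1, k.2⟩)
      · exact Or.inr (Or.inr ⟨h3 h k.1, k.2⟩)
      · exact Or.inr (Or.inl ⟨h.1, h3 (h2 k) h.2⟩)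
      · exact Or.inl (h3 (h3 h.1 (h3 (h2 k.1) h.2)) (h2 k.2))
      · exact Or.inl (h3 h.1 (h2 k.2))
      · exact Or.inr (Or.inr ⟨h.1, h3 (h2 k) h.2⟩)
      · exact Or.inl (h3 h.1 (h2 k.2))
      · exact Or.inl (h3 (h3 h.1 (h3 (h2 k.1) h.2)) (h2 k.2))

/-- The class of `y` can be deleted, since the class of `x` now stands for both. The remaining
classes are in bijection with the joined ones. -/
theorem card_quotient_joinPair {α : Type*} [Finite α] (s : Setoid α) {x y : α} (h : ¬ s x y) :
    Nat.card (Quotient (joinPair s x y)) + 1 = Nat.card (Quotient s) := by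
  classical
  have h2 := @s.symm'
  have h3 := @s.trans'
  have e : {q : Quotient s // q ≠ ⟦y⟧} ≃ Quotient (joinPair s x y) := by
    refine Equiv.ofBijective (fun q => Quotient.map' (s₁ := s) (s₂ := joinPair s x y) id
      (fun a b hab => Or.inl hab) q.1) ⟨?_, ?_⟩
    · rintro ⟨⟨a⟩, ha⟩ ⟨⟨b⟩, hb⟩ hab
      have ha' : ¬ s a y := fun h => ha (Quotient.sound h)
      have hb' : ¬ s b y := fun h => hb (Quotient.sound h)
      have : joinPair s x y a b := Quotient.exact hab
      rcases this with k | k | k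
      · exact Subtype.ext (Quotient.sound k)
      · exact absurd k.2 hb'
      · exact absurd k.1 ha'
    · rintro ⟨a⟩
      by_cases ha : s a y
      · refine ⟨⟨⟦x⟧, fun hh => h (Quotient.exact hh)⟩, ?_⟩
        exact Quotient.sound (Or.inr (Or.inl ⟨s.refl' x, ha⟩))
      · exact ⟨⟨⟦a⟧, fun hh => ha (Quotient.exact hh)⟩, rfl⟩
  rw [← Nat.card_congr e]
  have := Nat.card_congr (Equiv.sumCompl (fun q : Quotient s => q = ⟦y⟧))
  rw [Nat.card_sum] at this
  simp only [Nat.card_unique] at this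
  rw [← this, add_comm]

section Swap

variable {α : Type*} [Finite α] [DecidableEq α] (f : Perm α) {x y : α}

/-- The new permutation sends `y` to `f x`, then follows the `f`-orbit of `x`. It meets neither `x`
nor `y` before one full period, at which it arrives at `x`. -/
theorem sameCycle_mul_swap (h : ¬ f.SameCycle x y) : (f * swap x y).SameCycle x y := by
  have hpos : 0 < Function.minimalPeriod f x :=
    Function.minimalPeriod_pos_of_mem_periodicPts
      ((Function.Injective.mem_periodicPts f.injective) x)
  have key : ∀ n, n + 1 ≤ Function.minimalPeriod f x →
      ((f * swap x y) ^ (n + 1)) y = (f ^ (n + 1)) x := by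
    intro n
    induction n with
    | zero => simp
    | succ n ih =>
      intro hn
      rw [pow_succ', Perm.mul_apply, ih (by omega), pow_succ' f (n + 1), Perm.mul_apply,
        Perm.mul_apply, swap_apply_of_ne_of_ne]
      · intro hx
        have : Function.IsPeriodicPt f (n + 1) x := by
          rw [Function.IsPeriodicPt, Function.IsFixedPt, Perm.iterate_eq_pow]; exact hx
        have := this.minimalPeriod_le (Nat.succ_pos n)
        omega
      · intro hy
        exact h ⟨n + 1, by exact_mod_cast hy⟩
  refine SameCycle.symm ⟨(Function.minimalPeriod f x : ℕ), ?_⟩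
  have := key (Function.minimalPeriod f x - 1) (by omega)
  rw [Nat.sub_add_cancel hpos] at this
  rw [zpow_natCast, this, ← Perm.iterate_eq_pow, Function.iterate_minimalPeriod]

/-- With `n` minimal such that `f^n x = y`, the new permutation sends `y` back to `f x`. The orbit
of `y` is thus trapped in `f x, …, f^n x`, a list which omits `x`. -/
theorem not_sameCycle_mul_swap (hxy : x ≠ y) (h : f.SameCycle x y) :
    ¬ (f * swap x y).SameCycle x y := by
  classical
  intro h'
  obtain ⟨n0, hn0⟩ := h.exists_nat_pow_eq
  have hex : ∃ n : ℕ, (f ^ n) x = y := ⟨n0, hn0⟩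
  set n := Nat.find hex with hn
  have hny : (f ^ n) x = y := Nat.find_spec hex
  have hmin : ∀ i, i < n → (f ^ i) x ≠ y := fun i hi => Nat.find_min hex hi
  have hnx : ∀ i, 0 < i → i ≤ n → (f ^ i) x ≠ x := by
    intro i hi hin hx
    apply hmin (n - i) (by omega)
    have : (f ^ n) x = (f ^ (n - i)) ((f ^ i) x) := by
      rw [← Perm.mul_apply, ← pow_add, Nat.sub_add_cancel hin]
    rw [← hny, this, hx]
  have hn1 : 0 < n := by
    rcases Nat.eq_zero_or_pos n with h0 | h0
    · rw [h0] at hny; exact absurd hny hxy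
    · exact h0
  have inv : ∀ k : ℕ, ∃ i, 0 < i ∧ i ≤ n ∧ ((f * swap x y) ^ k) y = (f ^ i) x := by
    intro k
    induction k with
    | zero => exact ⟨n, hn1, le_rfl, by simpa using hny.symm⟩
    | succ k ih =>
      obtain ⟨i, hi, hin, hk⟩ := ih
      rw [pow_succ', Perm.mul_apply, hk, Perm.mul_apply]
      rcases eq_or_lt_of_le hin with rfl | hlt
      · refine ⟨1, one_pos, hn1, ?_⟩
        rw [hny]; simp
      · refine ⟨i + 1, by omega, hlt, ?_⟩
        rw [swap_apply_of_ne_of_ne (hnx i hi hin) (hmin i hlt), pow_succ', Perm.mul_apply]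
  obtain ⟨k, hk⟩ := h'.symm.exists_nat_pow_eq
  obtain ⟨i, hi, hin, hk'⟩ := inv k
  exact hnx i hi hin (hk'.symm.trans hk)

/-- Two cycles are merged and the others are untouched: the orbit relation of the product is the
orbit relation of `f` joined at `x` and `y`. -/
theorem numCycles_mul_swap_of_not (h : ¬ f.SameCycle x y) :
    numCycles (f * swap x y) + 1 = numCycles f := by
  have hs := sameCycle_mul_swap f h
  have heq : SameCycle.setoid (f * swap x y) = joinPair (SameCycle.setoid f) x y := by
    have hxy : (joinPair (SameCycle.setoid f) x y) x y :=
      Or.inr (Or.inl ⟨SameCycle.refl _ _, SameCycle.refl _ _⟩)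
    apply le_antisymm
    · have step : ∀ a, (joinPair (SameCycle.setoid f) x y) a ((f * swap x y) a) := by
        intro a
        have hf : ∀ b, (joinPair (SameCycle.setoid f) x y) b (f b) :=
          fun b => Or.inl ⟨1, by simp⟩
        rw [Perm.mul_apply]
        refine Setoid.trans' _ ?_ (hf _)
        rcases eq_or_ne a x with rfl | hax
        · rwa [swap_apply_left]
        · rcases eq_or_ne a y with rfl | hay
          · rw [swap_apply_right]; exact Setoid.symm' _ hxy
          · rw [swap_apply_of_ne_of_ne hax hay]
      intro a b hab
      obtain ⟨n, rfl⟩ := SameCycle.exists_nat_pow_eq hab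
      clear hab
      induction n with
      | zero => exact Setoid.refl' _ _
      | succ n ih =>
        rw [pow_succ', Perm.mul_apply]
        exact Setoid.trans' _ ih (step _)
    · have step : ∀ a, (f * swap x y).SameCycle a (f a) := by
        intro a
        have h1 : ∀ b, (f * swap x y).SameCycle b ((f * swap x y) b) := fun b => ⟨1, by simp⟩
        rcases eq_or_ne a x with rfl | hax
        · have := h1 y
          simp only [Perm.mul_apply, swap_apply_right] at this
          exact hs.trans this
        · rcases eq_or_ne a y with rfl | hay
          · have := h1 x
            simp only [Perm.mul_apply, swap_apply_left] at this
            exact hs.symm.trans this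
          · have := h1 a
            rwa [Perm.mul_apply, swap_apply_of_ne_of_ne hax hay] at this
      have hle : ∀ a b, f.SameCycle a b → (f * swap x y).SameCycle a b := by
        intro a b hab
        obtain ⟨n, rfl⟩ := hab.exists_nat_pow_eq
        clear hab
        induction n with
        | zero => exact SameCycle.refl _ _
        | succ n ih =>
          rw [pow_succ', Perm.mul_apply]
          exact ih.trans (step _)
      rintro a b (h | ⟨h, k⟩ | ⟨h, k⟩)
      · exact hle _ _ h
      · exact ((hle _ _ h).trans hs).trans (hle _ _ k).symm
      · exact ((hle _ _ h).trans hs.symm).trans (hle _ _ k).symm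
  have := card_quotient_joinPair (SameCycle.setoid f) (x := x) (y := y) h
  rw [← heq] at this
  exact this

theorem numCycles_mul_swap_of_sameCycle (hxy : x ≠ y) (h : f.SameCycle x y) :
    numCycles (f * swap x y) = numCycles f + 1 := by
  have := numCycles_mul_swap_of_not (f * swap x y) (not_sameCycle_mul_swap f hxy h)
  rw [mul_assoc, swap_mul_self, mul_one] at this
  omega

/-- The product of the transpositions of a list of pairs. -/
def swapProd {α : Type*} [DecidableEq α] (w : List (α × α)) : Perm α :=
  (w.map fun z => swap z.1 z.2).prod

theorem swapProd_append {α : Type*} [DecidableEq α] (w w' : List (α × α)) :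
    swapProd (w ++ w') = swapProd w * swapProd w' := by
  simp [swapProd]

/-- Each nontrivial transposition changes the number of cycles by exactly one, up or down. -/
theorem even_numCycles_mul_swapProd (w : List (α × α)) (hw : ∀ z ∈ w, z.1 ≠ z.2) :
    Even (numCycles (f * swapProd w) + numCycles f + w.length) := by
  induction w using List.reverseRecOn with
  | nil => simp [swapProd]
  | append_singleton w z ih =>
    have h1 := ih fun z hz => hw z (by simp [hz])
    have hz := hw z (by simp)
    rw [swapProd_append, ← mul_assoc, List.length_append]
    have e : swapProd [z] = swap z.1 z.2 := by simp [swapProd]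
    rw [e]
    simp only [List.length_singleton]
    by_cases hs : (f * swapProd w).SameCycle z.1 z.2
    · rw [numCycles_mul_swap_of_sameCycle _ hz hs]
      rw [Nat.even_iff] at *; omega
    · have := numCycles_mul_swap_of_not _ hs
      rw [Nat.even_iff] at *; omega

/-- This is the inequality behind the nonnegativity of the genus. The relation `s` is built along
the word. A transposition inside a class of `s` creates at most one cycle, paid for by the length. A
transposition between two classes merges two cycles as well as two classes, and the bound loses at
most what the left side loses. -/
theorem exists_setoid_numCycles_le (w : List (α × α)) :
    ∃ s : Setoid α, (∀ a, s a (f a)) ∧ (∀ z ∈ w, s z.1 z.2) ∧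
      numCycles (f * swapProd w) + numCycles f ≤ w.length + 2 * Nat.card (Quotient s) := by
  induction w using List.reverseRecOn with
  | nil =>
    refine ⟨SameCycle.setoid f, fun a => ⟨1, by simp⟩, by simp, ?_⟩
    simp only [swapProd, List.map_nil, List.prod_nil, mul_one, List.length_nil, numCycles]
    exact le_of_eq (by ring)
  | append_singleton w z ih =>
    obtain ⟨s, h1, h2, h3⟩ := ih
    rw [swapProd_append, ← mul_assoc, List.length_append]
    have e : swapProd [z] = swap z.1 z.2 := by simp [swapProd]
    rw [e, List.length_singleton]
    by_cases hs : s z.1 z.2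
    · refine ⟨s, h1, ?_, ?_⟩
      · intro t ht
        rcases List.mem_append.1 ht with ht | ht
        · exact h2 t ht
        · rw [List.mem_singleton.1 ht]; exact hs
      · rcases eq_or_ne z.1 z.2 with hz | hz
        · rw [hz, swap_self]
          change numCycles (f * swapProd w * 1) + _ ≤ _
          rw [mul_one]; omega
        · by_cases hc : (f * swapProd w).SameCycle z.1 z.2
          · rw [numCycles_mul_swap_of_sameCycle _ hz hc]; omega
          · have := numCycles_mul_swap_of_not _ hc; omega
    -- Both `f` and the earlier transpositions preserve the classes of `s`. The points of `z`, being
    -- in distinct classes, are then in distinct cycles.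
    · have hsw : ∀ w : List (α × α), (∀ z ∈ w, s z.1 z.2) → ∀ a, s a (swapProd w a) := by
        intro w
        induction w with
        | nil => intro _ a; exact s.refl' a
        | cons t w ih =>
          intro hw a
          have e : swapProd (t :: w) = swap t.1 t.2 * swapProd w := by simp [swapProd]
          rw [e, Perm.mul_apply]
          refine s.trans' (ih (fun z hz => hw z (by simp [hz])) a) ?_
          generalize swapProd w a = b
          have ht := hw t (by simp)
          rcases eq_or_ne b t.1 with rfl | hb
          · rwa [swap_apply_left]
          · rcases eq_or_ne b t.2 with rfl | hb'
            · rw [swap_apply_right]; exact s.symm' ht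
            · rw [swap_apply_of_ne_of_ne hb hb']
      have hc : ¬ (f * swapProd w).SameCycle z.1 z.2 := by
        intro hc
        apply hs
        obtain ⟨n, hn⟩ := hc.exists_nat_pow_eq
        rw [← hn]
        clear hn
        induction n with
        | zero => exact s.refl' _
        | succ n ih =>
          rw [pow_succ', Perm.mul_apply]
          refine s.trans' ih ?_
          rw [Perm.mul_apply]
          exact s.trans' (hsw w h2 _) (h1 _)
      have hn := numCycles_mul_swap_of_not _ hc
      have hq := card_quotient_joinPair s hs
      refine ⟨joinPair s z.1 z.2, fun a => Or.inl (h1 a), ?_, by omega⟩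
      intro t ht
      rcases List.mem_append.1 ht with ht | ht
      · exact Or.inl (h2 t ht)
      · rw [List.mem_singleton.1 ht]
        exact Or.inr (Or.inl ⟨s.refl' _, s.refl' _⟩)

end Swap

end

section

open Equiv Equiv.Perm Matrix

/-! ### Moments of the entries of a Haar unitary matrix -/

instance haarU_isProbabilityMeasure (N : ℕ) : IsProbabilityMeasure (haarU N) := by
  refine ⟨?_⟩
  have := Measure.haarMeasure_self
    (K₀ := (⊤ : TopologicalSpace.PositiveCompacts (Matrix.unitaryGroup (Fin N) ℂ)))
  simpa [haarU] using this

instance haarU_isMulLeftInvariant (N : ℕ) : (haarU N).IsMulLeftInvariant := by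
  unfold haarU; infer_instance

theorem integrable_haarU {N : ℕ} {f : Matrix.unitaryGroup (Fin N) ℂ → ℂ} (hf : Continuous f) :
    Integrable f (haarU N) :=
  hf.integrable_of_hasCompactSupport (HasCompactSupport.of_compactSpace f)

/-- The matrix `U^ε`. -/
noncomputable def signPow {N : ℕ} (e : ℤˣ) (U : Matrix (Fin N) (Fin N) ℂ) :
    Matrix (Fin N) (Fin N) ℂ := if e = 1 then U else Uᴴ

/-- The derivative of `U^ε` in the direction `A U`, where `A` is skew-Hermitian. -/
noncomputable def signDeriv {N : ℕ} (A : Matrix (Fin N) (Fin N) ℂ) (e : ℤˣ)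
    (U : Matrix (Fin N) (Fin N) ℂ) : Matrix (Fin N) (Fin N) ℂ :=
  if e = 1 then A * U else -(Uᴴ * A)

theorem continuous_signPow {N : ℕ} (e : ℤˣ) (p q : Fin N) :
    Continuous fun U : Matrix.unitaryGroup (Fin N) ℂ => signPow e (U : Matrix _ _ ℂ) p q := by
  unfold signPow
  split_ifs
  · exact (continuous_subtype_val.matrix_elem p q)
  · exact (continuous_subtype_val.matrix_conjTranspose.matrix_elem p q)

theorem continuous_signDeriv {N : ℕ} (A : Matrix (Fin N) (Fin N) ℂ) (e : ℤˣ) (p q : Fin N) :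
    Continuous fun U : Matrix.unitaryGroup (Fin N) ℂ =>
      signDeriv A e (U : Matrix _ _ ℂ) p q := by
  unfold signDeriv
  split_ifs
  · exact ((continuous_const.matrix_mul continuous_subtype_val).matrix_elem p q)
  · exact ((continuous_subtype_val.matrix_conjTranspose.matrix_mul
      continuous_const).neg.matrix_elem p q)

theorem norm_signPow_le {N : ℕ} (e : ℤˣ) (U : Matrix.unitaryGroup (Fin N) ℂ) (p q : Fin N) :
    ‖signPow e (U : Matrix _ _ ℂ) p q‖ ≤ 1 := by
  unfold signPow
  split_ifs
  · exact entry_norm_bound_of_unitary U.2 p q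
  · rw [conjTranspose_apply, norm_star]
    exact entry_norm_bound_of_unitary U.2 q p

/-- A bound uniform in `U`, which serves as the dominating constant when differentiating under the
integral. -/
theorem norm_signDeriv_le {N : ℕ} (A : Matrix (Fin N) (Fin N) ℂ) (e : ℤˣ)
    (U : Matrix.unitaryGroup (Fin N) ℂ) (p q : Fin N) :
    ‖signDeriv A e (U : Matrix _ _ ℂ) p q‖ ≤ ∑ x, ∑ y, ‖A x y‖ := by
  have hrow : ∀ x, ∑ y, ‖A x y‖ ≤ ∑ x, ∑ y, ‖A x y‖ := fun x =>
    Finset.single_le_sum (f := fun x => ∑ y, ‖A x y‖)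
      (fun _ _ => Finset.sum_nonneg fun _ _ => norm_nonneg _) (Finset.mem_univ x)
  unfold signDeriv
  split_ifs
  · rw [Matrix.mul_apply]
    refine (norm_sum_le _ _).trans (le_trans (Finset.sum_le_sum fun y _ => ?_) (hrow p))
    rw [norm_mul]
    exact mul_le_of_le_one_right (norm_nonneg _) (entry_norm_bound_of_unitary U.2 _ _)
  · rw [Matrix.neg_apply, norm_neg, Matrix.mul_apply]
    refine (norm_sum_le _ _).trans (Finset.sum_le_sum fun y _ => ?_)
    rw [norm_mul, conjTranspose_apply, norm_star]
    refine le_trans (mul_le_of_le_one_left (norm_nonneg _)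
      (entry_norm_bound_of_unitary U.2 _ _)) ?_
    exact Finset.single_le_sum (f := fun q => ‖A y q‖) (fun _ _ => norm_nonneg _)
      (Finset.mem_univ q)

/-! ### One-parameter groups of unitary matrices -/

section Exp

attribute [local instance] Matrix.linftyOpNormedRing Matrix.linftyOpNormedAlgebra

/-- The flow is `t ↦ exp(tA)`, which is unitary because `A` is skew-Hermitian. The operator norm is
only an auxiliary device: the derivative is read entry by entry. -/
theorem exists_unitary_flow {N : ℕ} (A : Matrix (Fin N) (Fin N) ℂ) (hA : Aᴴ = -A) :
    ∃ V : ℝ → Matrix.unitaryGroup (Fin N) ℂ, V 0 = 1 ∧ ∀ t p q,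
      HasDerivAt (fun s => (V s : Matrix (Fin N) (Fin N) ℂ) p q)
        ((A * (V t : Matrix (Fin N) (Fin N) ℂ)) p q) t := by
  have hu : ∀ t : ℝ, NormedSpace.exp (t • A) ∈ Matrix.unitaryGroup (Fin N) ℂ := by
    intro t
    rw [Matrix.mem_unitaryGroup_iff, star_eq_conjTranspose, ← Matrix.exp_conjTranspose,
      conjTranspose_smul, hA, star_trivial, smul_neg, ← Matrix.exp_add_of_commute]
    · simp
    · exact (Commute.refl _).neg_right
  refine ⟨fun t => ⟨_, hu t⟩, ?_, fun t p q => ?_⟩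
  · apply Subtype.ext
    simp
  · have h := hasDerivAt_exp_smul_const' (𝕂 := ℝ) A t
    have h1 := hasDerivAt_pi.1 h p
    exact hasDerivAt_pi.1 h1 q

end Exp

/-! ### Integration by parts and the Schwinger–Dyson equations -/

section Derivation

variable {I : Type*} {N : ℕ}

/-- By left invariance, the integral of the product of entries at `exp(tA) U` does not depend on
`t`. Its derivative at `t = 0`, computed by Leibniz' rule under the integral sign, vanishes. -/
theorem integral_derivation_skew [DecidableEq I] (ε : I → ℤˣ) (S : Finset I) (j i : I → Fin N)
    (A : Matrix (Fin N) (Fin N) ℂ) (hA : Aᴴ = -A) :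
    ∑ k ∈ S, ∫ U, (∏ k' ∈ S.erase k, signPow (ε k') (U : Matrix _ _ ℂ) (j k') (i k')) *
      signDeriv A (ε k) (U : Matrix _ _ ℂ) (j k) (i k) ∂(haarU N) = 0 := by
  obtain ⟨V, hV0, hV⟩ := exists_unitary_flow A hA
  set F : ℝ → Matrix.unitaryGroup (Fin N) ℂ → ℂ := fun t U =>
    ∏ k ∈ S, signPow (ε k) ((V t * U : Matrix.unitaryGroup (Fin N) ℂ) : Matrix _ _ ℂ) (j k) (i k)
    with hF
  set F' : ℝ → Matrix.unitaryGroup (Fin N) ℂ → ℂ := fun t U =>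
    ∑ k ∈ S, (∏ k' ∈ S.erase k,
      signPow (ε k') ((V t * U : Matrix.unitaryGroup (Fin N) ℂ) : Matrix _ _ ℂ) (j k') (i k')) *
      signDeriv A (ε k) ((V t * U : Matrix.unitaryGroup (Fin N) ℂ) : Matrix _ _ ℂ) (j k) (i k)
    with hF'
  have hc1 : Continuous fun U : Matrix.unitaryGroup (Fin N) ℂ =>
      ∏ k ∈ S, signPow (ε k) (U : Matrix _ _ ℂ) (j k) (i k) :=
    continuous_finsetProd _ fun k _ => continuous_signPow _ _ _
  have hc2 : ∀ k, Continuous fun U : Matrix.unitaryGroup (Fin N) ℂ =>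
      (∏ k' ∈ S.erase k, signPow (ε k') (U : Matrix _ _ ℂ) (j k') (i k')) *
      signDeriv A (ε k) (U : Matrix _ _ ℂ) (j k) (i k) := fun k =>
    (continuous_finsetProd _ fun k _ => continuous_signPow _ _ _).mul
      (continuous_signDeriv _ _ _ _)
  have hcF : ∀ t, Continuous (F t) := fun t => hc1.comp (continuous_const.mul continuous_id)
  have hcF' : ∀ t, Continuous (F' t) := fun t =>
    (continuous_finsetSum S fun k _ => hc2 k).comp (continuous_const.mul continuous_id)
  have hd : ∀ U : Matrix.unitaryGroup (Fin N) ℂ, ∀ t : ℝ,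
      HasDerivAt (fun s => F s U) (F' t U) t := by
    intro U t
    have hW : ∀ p q, HasDerivAt (fun s => ((V s * U : Matrix.unitaryGroup (Fin N) ℂ) :
        Matrix (Fin N) (Fin N) ℂ) p q)
        ((A * ((V t * U : Matrix.unitaryGroup (Fin N) ℂ) : Matrix (Fin N) (Fin N) ℂ)) p q) t := by
      intro p q
      have : (A * ((V t * U : Matrix.unitaryGroup (Fin N) ℂ) : Matrix (Fin N) (Fin N) ℂ)) p q =
          ∑ x, (A * (V t : Matrix (Fin N) (Fin N) ℂ)) p x * (U : Matrix _ _ ℂ) x q := by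
        rw [Submonoid.coe_mul, ← Matrix.mul_assoc, Matrix.mul_apply]
      rw [this]
      simp only [Submonoid.coe_mul, Matrix.mul_apply (M := (V _ : Matrix (Fin N) (Fin N) ℂ))]
      exact HasDerivAt.fun_sum fun x _ => (hV t p x).mul_const _
    have hk : ∀ k ∈ S, HasDerivAt (fun s => signPow (ε k)
        ((V s * U : Matrix.unitaryGroup (Fin N) ℂ) : Matrix _ _ ℂ) (j k) (i k))
        (signDeriv A (ε k) ((V t * U : Matrix.unitaryGroup (Fin N) ℂ) : Matrix _ _ ℂ)
          (j k) (i k)) t := by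
      intro k _
      unfold signPow signDeriv
      split_ifs
      · exact hW _ _
      -- For sign `-1` the entry is a conjugate entry of the flow. Skew-Hermitianity turns the
      -- conjugate derivative into `-(U^* A)`.
      · have h1 := (hW (i k) (j k)).star
        have h2 : ∀ W : Matrix (Fin N) (Fin N) ℂ, -(Wᴴ * A) = (A * W)ᴴ := by
          intro W
          rw [conjTranspose_mul, hA, Matrix.mul_neg]
        rw [h2]
        exact h1
    have := HasDerivAt.fun_finsetProd hk
    simpa only [smul_eq_mul, hF'] using this
  have hconst : ∀ t, ∫ U, F t U ∂(haarU N) =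
      ∫ U : Matrix.unitaryGroup (Fin N) ℂ,
        ∏ k ∈ S, signPow (ε k) (U : Matrix _ _ ℂ) (j k) (i k) ∂(haarU N) := fun t =>
    integral_mul_left_eq_self (μ := haarU N) (fun U : Matrix.unitaryGroup (Fin N) ℂ =>
      ∏ k ∈ S, signPow (ε k) (U : Matrix _ _ ℂ) (j k) (i k)) (V t)
  have hmain := (hasDerivAt_integral_of_dominated_loc_of_deriv_le (μ := haarU N) (𝕜 := ℝ)
    (F := F) (F' := F') (x₀ := 0) (s := Set.univ)
    (bound := fun _ => ∑ k ∈ S, ∑ x, ∑ y, ‖A x y‖) Filter.univ_mem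
    (Filter.Eventually.of_forall fun t => (hcF t).aestronglyMeasurable)
    (integrable_haarU (hcF 0)) (hcF' 0).aestronglyMeasurable
    (Filter.Eventually.of_forall fun U t _ => by
      refine (norm_sum_le _ _).trans (Finset.sum_le_sum fun k _ => ?_)
      rw [norm_mul, norm_prod]
      refine le_trans (mul_le_of_le_one_left (norm_nonneg _) ?_) (norm_signDeriv_le _ _ _ _ _)
      exact Finset.prod_le_one (fun _ _ => norm_nonneg _) fun _ _ => norm_signPow_le _ _ _ _)
    (integrable_const _)
    (Filter.Eventually.of_forall fun U t _ => hd U t)).2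
  simp only [hconst] at hmain
  have h0 := hmain.unique (hasDerivAt_const _ _)
  rw [← h0, ← integral_finsetSum S fun k _ => integrable_haarU (hc2 k)]
  simp only [hF', hV0, one_mul]

/-- Writing the second branch of `signDeriv` as `-(U^* A)`, and not as `(A U)^*`, makes it complex
linear in `A`; this permits the passage from skew-Hermitian to arbitrary matrices. -/
theorem signDeriv_add {N : ℕ} (A B : Matrix (Fin N) (Fin N) ℂ) (c : ℂ) (e : ℤˣ)
    (U : Matrix (Fin N) (Fin N) ℂ) :
    signDeriv (A + c • B) e U = signDeriv A e U + c • signDeriv B e U := by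
  unfold signDeriv
  split_ifs
  · simp [Matrix.add_mul]
  · simp [Matrix.mul_add, add_comm]

theorem integral_derivation [DecidableEq I] (ε : I → ℤˣ) (S : Finset I) (j i : I → Fin N)
    (A : Matrix (Fin N) (Fin N) ℂ) :
    ∑ k ∈ S, ∫ U, (∏ k' ∈ S.erase k, signPow (ε k') (U : Matrix _ _ ℂ) (j k') (i k')) *
      signDeriv A (ε k) (U : Matrix _ _ ℂ) (j k) (i k) ∂(haarU N) = 0 := by
  -- Any matrix is `B + i C` with `B` and `C` both skew-Hermitian.
  set B := (2 : ℂ)⁻¹ • (A - Aᴴ) with hB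
  set C := (-Complex.I * (2 : ℂ)⁻¹) • (A + Aᴴ) with hC
  have hA : A = B + Complex.I • C := by
    rw [hB, hC, smul_smul]
    have : Complex.I * (-Complex.I * (2 : ℂ)⁻¹) = (2 : ℂ)⁻¹ := by
      rw [← mul_assoc, mul_neg, Complex.I_mul_I]; simp
    rw [this, ← smul_add, sub_add_add_cancel, ← two_smul ℂ A, smul_smul]
    simp
  have h1 := integral_derivation_skew ε S j i B (by
    rw [hB, conjTranspose_smul, conjTranspose_sub, conjTranspose_conjTranspose, ← smul_neg,
      neg_sub]
    simp)
  have h2 := integral_derivation_skew ε S j i C (by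
    rw [hC, conjTranspose_smul, conjTranspose_add, conjTranspose_conjTranspose, ← neg_smul,
      add_comm]
    simp)
  have hc : ∀ (A : Matrix (Fin N) (Fin N) ℂ) (k : I),
      Integrable (fun U : Matrix.unitaryGroup (Fin N) ℂ =>
      (∏ k' ∈ S.erase k, signPow (ε k') (U : Matrix _ _ ℂ) (j k') (i k')) *
      signDeriv A (ε k) (U : Matrix _ _ ℂ) (j k) (i k)) (haarU N) := fun A k =>
    integrable_haarU ((continuous_finsetProd _ fun k _ => continuous_signPow _ _ _).mul
      (continuous_signDeriv _ _ _ _))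
  rw [hA]
  simp only [signDeriv_add, Matrix.add_apply, Matrix.smul_apply, mul_add, smul_eq_mul]
  have : ∀ k, ∫ U : Matrix.unitaryGroup (Fin N) ℂ,
      ((∏ k' ∈ S.erase k, signPow (ε k') (U : Matrix _ _ ℂ) (j k') (i k')) *
      signDeriv B (ε k) (U : Matrix _ _ ℂ) (j k) (i k) +
      (∏ k' ∈ S.erase k, signPow (ε k') (U : Matrix _ _ ℂ) (j k') (i k')) *
      (Complex.I * signDeriv C (ε k) (U : Matrix _ _ ℂ) (j k) (i k))) ∂(haarU N) =
      (∫ U : Matrix.unitaryGroup (Fin N) ℂ,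
      ((∏ k' ∈ S.erase k, signPow (ε k') (U : Matrix _ _ ℂ) (j k') (i k')) *
      signDeriv B (ε k) (U : Matrix _ _ ℂ) (j k) (i k)) ∂(haarU N)) +
      Complex.I * ∫ U : Matrix.unitaryGroup (Fin N) ℂ,
      ((∏ k' ∈ S.erase k, signPow (ε k') (U : Matrix _ _ ℂ) (j k') (i k')) *
      signDeriv C (ε k) (U : Matrix _ _ ℂ) (j k) (i k)) ∂(haarU N) := by
    intro k
    simp only [mul_left_comm _ Complex.I]
    rw [integral_add (hc B k) ((hc C k).const_mul _), integral_const_mul]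
  simp only [this]
  rw [Finset.sum_add_distrib, h1, ← Finset.mul_sum, h2]
  simp

/-- The expectation of a product of entries of `U` and `U^*`. -/
noncomputable def entryMoment (ε : I → ℤˣ) (S : Finset I) (j i : I → Fin N) : ℂ :=
  ∫ U, ∏ k ∈ S, signPow (ε k) (U : Matrix _ _ ℂ) (j k) (i k) ∂(haarU N)

theorem norm_entryMoment_le (ε : I → ℤˣ) (S : Finset I) (j i : I → Fin N) :
    ‖entryMoment ε S j i‖ ≤ 1 := by
  refine (norm_integral_le_of_norm_le_const (C := 1) (Filter.Eventually.of_forall fun U => ?_)).trans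
    (by simp)
  rw [norm_prod]
  exact Finset.prod_le_one (fun _ _ => norm_nonneg _) fun _ _ => norm_signPow_le _ _ _ _

theorem entryMoment_empty (ε : I → ℤˣ) (j i : I → Fin N) : entryMoment ε ∅ j i = 1 := by
  simp [entryMoment]

/-- The direction `A` is the elementary matrix `E_{pq}`. It replaces the row index `p` by `q` in an
entry of `U`, and the column index `q` by `p`, with a minus sign, in an entry of `U^*`. -/
theorem schwinger_dyson [DecidableEq I] (ε : I → ℤˣ) (S : Finset I) (j i : I → Fin N) (p q : Fin N) :
    ∑ k ∈ S with ε k = 1, (if j k = p then entryMoment ε S (Function.update j k q) i else 0) =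
    ∑ k ∈ S with ε k ≠ 1, (if i k = q then entryMoment ε S j (Function.update i k p) else 0) := by
  have h := integral_derivation ε S j i (Matrix.single p q 1)
  rw [← Finset.sum_filter_add_sum_filter_not S (fun k => ε k = 1)] at h
  have hO : ∀ k ∈ S.filter (fun k => ε k = 1), ∫ U : Matrix.unitaryGroup (Fin N) ℂ,
      (∏ k' ∈ S.erase k, signPow (ε k') (U : Matrix _ _ ℂ) (j k') (i k')) *
      signDeriv (Matrix.single p q 1) (ε k) (U : Matrix _ _ ℂ) (j k) (i k) ∂(haarU N) =
      if j k = p then entryMoment ε S (Function.update j k q) i else 0 := by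
    intro k hk
    rw [Finset.mem_filter] at hk
    split_ifs with hp
    · rw [entryMoment]
      congr 1
      ext U
      rw [← Finset.mul_prod_erase _ _ hk.1, mul_comm]
      congr 1
      · simp [signPow, signDeriv, hk.2, hp]
      · refine Finset.prod_congr rfl fun k' hk' => ?_
        rw [Function.update_of_ne (Finset.ne_of_mem_erase hk')]
    · rw [← integral_zero (Matrix.unitaryGroup (Fin N) ℂ) ℂ (μ := haarU N)]
      congr 1
      ext U
      simp [signDeriv, hk.2, Matrix.single_mul_apply_of_ne _ _ _ _ _ hp]
  have hI : ∀ k ∈ S.filter (fun k => ¬ ε k = 1), ∫ U : Matrix.unitaryGroup (Fin N) ℂ,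
      (∏ k' ∈ S.erase k, signPow (ε k') (U : Matrix _ _ ℂ) (j k') (i k')) *
      signDeriv (Matrix.single p q 1) (ε k) (U : Matrix _ _ ℂ) (j k) (i k) ∂(haarU N) =
      - if i k = q then entryMoment ε S j (Function.update i k p) else 0 := by
    intro k hk
    rw [Finset.mem_filter] at hk
    split_ifs with hp
    · rw [entryMoment, ← integral_neg]
      congr 1
      ext U
      rw [← Finset.mul_prod_erase _ _ hk.1, mul_comm, ← neg_mul]
      congr 1
      · simp [signPow, signDeriv, hk.2, hp]
      · refine Finset.prod_congr rfl fun k' hk' => ?_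
        rw [Function.update_of_ne (Finset.ne_of_mem_erase hk')]
    · rw [neg_zero, ← integral_zero (Matrix.unitaryGroup (Fin N) ℂ) ℂ (μ := haarU N)]
      congr 1
      ext U
      simp [signDeriv, hk.2, Matrix.mul_single_apply_of_ne _ _ _ _ _ hp]
  rw [Finset.sum_congr rfl hO, Finset.sum_congr rfl hI, Finset.sum_neg_distrib] at h
  exact eq_of_sub_eq_zero (by rw [sub_eq_add_neg]; exact h)

/-- The sum over `p = q` of the Schwinger–Dyson equations is the equation for `A = 1`. It says that
the moment multiplied by the difference of the two cardinalities is zero. -/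
theorem entryMoment_eq_zero [DecidableEq I] (ε : I → ℤˣ) (S : Finset I) (j i : I → Fin N)
    (h : (S.filter fun k => ε k = 1).card ≠ (S.filter fun k => ε k ≠ 1).card) :
    entryMoment ε S j i = 0 := by
  have hsum := Finset.sum_congr (rfl : (Finset.univ : Finset (Fin N)) = _)
    fun p _ => schwinger_dyson ε S j i p p
  rw [Finset.sum_comm, Finset.sum_comm (s := Finset.univ)] at hsum
  simp only [Finset.sum_ite_eq, Finset.mem_univ, if_true, Function.update_eq_self,
    Finset.sum_const, nsmul_eq_mul] at hsum
  have hne : (((S.filter fun k => ε k = 1).card : ℂ) - (S.filter fun k => ε k ≠ 1).card) ≠ 0 := by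
    rw [sub_ne_zero]; exact_mod_cast h
  exact (mul_eq_zero.1 (by rw [sub_mul, hsum, sub_self])).resolve_left hne

/-- Expansion of a moment along the entry `b`. -/
theorem entryMoment_recursion [DecidableEq I] (ε : I → ℤˣ) (S : Finset I) (j i : I → Fin N) {b : I} (hb : b ∈ S)
    (hεb : ε b = 1) :
    N * entryMoment ε S j i +
      ∑ a ∈ (S.filter fun k => ε k = 1).erase b, entryMoment ε S (j ∘ swap a b) i =
    ∑ k ∈ S with ε k ≠ 1, (if i k = j b ∧ j k = i b then
      entryMoment ε ((S.erase b).erase k) j i else 0) := by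
  -- The row index at `b` is replaced by a free index `p`, the direction is `(p, j b)`, and `p` is
  -- summed. The term `k = b` then produces the factor `N`, and each other position of sign `1`
  -- produces a transposition of row indices.
  have hsum := Finset.sum_congr (rfl : (Finset.univ : Finset (Fin N)) = _)
    fun p _ => schwinger_dyson ε S (Function.update j b p) i p (j b)
  rw [Finset.sum_comm, Finset.sum_comm (s := Finset.univ)] at hsum
  have hbm : b ∈ S.filter fun k => ε k = 1 := Finset.mem_filter.2 ⟨hb, hεb⟩
  rw [← Finset.add_sum_erase _ _ hbm] at hsum
  simp only [Function.update_self, if_true, Function.update_idem, Function.update_eq_self,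
    Finset.sum_const, Finset.card_univ, Fintype.card_fin, nsmul_eq_mul] at hsum
  convert hsum using 1
  · congr 1
    refine Finset.sum_congr rfl fun a ha => ?_
    have hab : a ≠ b := Finset.ne_of_mem_erase ha
    simp only [Function.update_of_ne hab, Finset.sum_ite_eq, Finset.mem_univ, if_true]
    congr 1
    funext x
    rcases eq_or_ne x a with rfl | hxa
    · simp
    · rcases eq_or_ne x b with rfl | hxb
      · simp [hxa]
      · simp [hxa, hxb, swap_apply_of_ne_of_ne hxa hxb]
  · refine Finset.sum_congr rfl fun k hk => ?_
    rw [Finset.mem_filter] at hk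
    have hkb : k ≠ b := by rintro rfl; exact hk.2 hεb
    have hkS : k ∈ S.erase b := Finset.mem_erase.2 ⟨hkb, hk.1⟩
    by_cases h1 : i k = j b
    · simp only [h1, true_and, if_true]
      -- The free index `p` is now shared by one entry of `U` and one entry of `U^*`. Summing over
      -- it contracts them by `U^* U = 1`, which removes the positions `b` and `k`.
      have key : ∀ U : Matrix.unitaryGroup (Fin N) ℂ,
          ∑ p, ∏ k' ∈ S, signPow (ε k') (U : Matrix _ _ ℂ) (Function.update j b p k')
            (Function.update i k p k') =
          (if j k = i b then 1 else 0) * ∏ k' ∈ (S.erase b).erase k,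
            signPow (ε k') (U : Matrix _ _ ℂ) (j k') (i k') := by
        intro U
        have hUU : (U : Matrix (Fin N) (Fin N) ℂ)ᴴ * (U : Matrix _ _ ℂ) = 1 :=
          Matrix.mem_unitaryGroup_iff'.1 U.2
        have hjk := congrFun (congrFun hUU (j k)) (i b)
        rw [Matrix.one_apply, Matrix.mul_apply] at hjk
        rw [← hjk, Finset.sum_mul]
        refine Finset.sum_congr rfl fun p _ => ?_
        rw [← Finset.mul_prod_erase _ _ hb, ← Finset.mul_prod_erase _ _ hkS, ← mul_assoc]
        congr 1
        · simp [signPow, hεb, hk.2, hkb, hkb.symm, mul_comm]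
        · refine Finset.prod_congr rfl fun k' hk' => ?_
          have h2 := Finset.ne_of_mem_erase hk'
          have h3 := Finset.ne_of_mem_erase (Finset.mem_of_mem_erase hk')
          rw [Function.update_of_ne h2, Function.update_of_ne h3]
      unfold entryMoment
      rw [← integral_finsetSum Finset.univ fun p _ => integrable_haarU
        (continuous_finsetProd _ fun k _ => continuous_signPow _ _ _)]
      simp only [key, integral_const_mul]
      split_ifs <;> simp
    · simp [h1]

end Derivation

/-! ### A Neumann series indexed by words -/

/-- There are `|A|^n` words of length `n`, so grouping by length gives a geometric series of ratio
`|A| x`. -/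
theorem summable_pow_length {A : Type*} [Fintype A] {x : ℝ} (hx : 0 ≤ x)
    (h : Fintype.card A * x < 1) : Summable fun w : List A => x ^ w.length := by
  rw [← (Equiv.sigmaFiberEquiv (List.length : List A → ℕ)).summable_iff]
  have hf : ∀ n, Finite {w : List A // w.length = n} := fun n =>
    inferInstanceAs (Finite (List.Vector A n))
  rw [summable_sigma_of_nonneg (fun z => by simp only [Function.comp]; positivity)]
  refine ⟨fun n => (hasSum_fintype (β := List.Vector A n) _).summable, ?_⟩
  have hs : ∀ n, ∑' w : {w : List A // w.length = n},
      ((fun w : List A => x ^ w.length) ∘ (Equiv.sigmaFiberEquiv List.length)) ⟨n, w⟩ =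
      (Fintype.card A * x) ^ n := by
    intro n
    have h1 : ∀ w : {w : List A // w.length = n},
      ((fun w : List A => x ^ w.length) ∘ (Equiv.sigmaFiberEquiv List.length)) ⟨n, w⟩ = x ^ n := by
      rintro ⟨w, hw⟩
      simp [Equiv.sigmaFiberEquiv, hw]
    simp only [h1]
    change ∑' w : List.Vector A n, x ^ n = _
    rw [tsum_fintype, Finset.sum_const, Finset.card_univ, card_vector, nsmul_eq_mul, mul_pow]
    push_cast
    rfl
  simp only [hs]
  exact summable_geometric_of_lt_one (by positivity) h

/-- A list is empty, or a head followed by a tail. -/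
def listEquivSum (A : Type*) : Unit ⊕ A × List A ≃ List A where
  invFun w := match w with
    | [] => Sum.inl ()
    | a :: w => Sum.inr (a, w)
  toFun z := match z with
    | Sum.inl _ => []
    | Sum.inr (a, w) => a :: w
  right_inv w := by cases w <;> rfl
  left_inv z := by rcases z with _ | ⟨a, w⟩ <;> rfl

/-- The series inverts `n + ∑_a act a` on bounded functions. With `u w = (-1/n)^{|w|} f (w x)`, the
term of `w` is `u w - ∑_a u (a :: w)`. The total is the sum of `u` over all words minus its sum over
nonempty words, that is, `u [] = f x`. The condition `|A| < n` gives absolute convergence. -/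
theorem hasSum_neumann {A X : Type*} [Fintype A] (act : A → X → X) (f g : X → ℂ) (n : ℕ)
    (hA : Fintype.card A < n) {C : ℝ} (hf : ∀ x, ‖f x‖ ≤ C)
    (hfg : ∀ x, n * f x + ∑ a, f (act a x) = g x) (x : X) :
    HasSum (fun w : List A => (n : ℂ)⁻¹ * (-(n : ℂ)⁻¹) ^ w.length * g (w.foldr act x)) (f x) := by
  have hn : (n : ℂ) ≠ 0 := by exact_mod_cast (by omega : n ≠ 0)
  have hn' : (0 : ℝ) < n := by exact_mod_cast (by omega : 0 < n)
  set u : List A → ℂ := fun w => (-(n : ℂ)⁻¹) ^ w.length * f (w.foldr act x) with hu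
  have hus : Summable u := by
    refine Summable.of_norm_bounded (g := fun w => ((n : ℝ)⁻¹) ^ w.length * C)
      ((summable_pow_length (by positivity) ?_).mul_right C) fun w => ?_
    · rw [← div_eq_mul_inv, div_lt_one hn']; exact_mod_cast hA
    · simp only [hu, norm_mul, norm_pow, norm_neg, norm_inv, Complex.norm_natCast]
      gcongr
      exact hf _
  have hcons : Summable fun z : A × List A => u (z.1 :: z.2) :=
    hus.comp_injective (i := fun z : A × List A => z.1 :: z.2) (by
      rintro ⟨a, w⟩ ⟨a', w'⟩ h
      simpa using h)
  have hsplit : ∑' w, u w = u [] + ∑' z : A × List A, u (z.1 :: z.2) := by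
    refine ((listEquivSum A).hasSum_iff.1 (HasSum.sum ?_ ?_)).tsum_eq
    · exact hasSum_unique _
    · exact hcons.hasSum
  have hcons' : HasSum (fun w => ∑ a, u (a :: w)) (∑' z : A × List A, u (z.1 :: z.2)) := by
    have h1 := (Equiv.prodComm (List A) A).hasSum_iff.2 hcons.hasSum
    have h2 := h1.prod_fiberwise (g := fun w => ∑ a, u (a :: w))
      (fun w => hasSum_fintype (fun a => u (a :: w)))
    exact h2
  have hfin := hus.hasSum.sub hcons'
  have e1 : ∑' w, u w - ∑' z : A × List A, u (z.1 :: z.2) = f x := by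
    rw [hsplit]; simp [hu]
  rw [e1] at hfin
  have hterm : ∀ w : List A, (n : ℂ)⁻¹ * (-(n : ℂ)⁻¹) ^ w.length * g (w.foldr act x) =
      u w - ∑ a, u (a :: w) := by
    intro w
    simp only [← hfg, hu, List.length_cons, List.foldr_cons, pow_succ]
    rw [← Finset.mul_sum]
    field_simp
    ring
  simp only [hterm]
  exact hfin

/-! ### Products of transpositions -/

section SwapProd

variable {α : Type*} [DecidableEq α]

theorem swapProd_cons (z : α × α) (w : List (α × α)) :
    swapProd (z :: w) = swap z.1 z.2 * swapProd w := by
  simp [swapProd]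

theorem swapProd_apply_of_notMem (w : List (α × α)) {x : α}
    (h : ∀ z ∈ w, x ≠ z.1 ∧ x ≠ z.2) : swapProd w x = x := by
  induction w with
  | nil => simp [swapProd]
  | cons z w ih =>
    rw [swapProd_cons, Perm.mul_apply, ih fun z hz => h z (by simp [hz])]
    exact swap_apply_of_ne_of_ne (h z (by simp)).1 (h z (by simp)).2

theorem swapProd_invariant (w : List (α × α)) (p : α → Prop) (h : ∀ z ∈ w, p z.1 ↔ p z.2)
    (x : α) : p (swapProd w x) ↔ p x := by
  induction w with
  | nil => simp [swapProd]
  | cons z w ih =>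
    rw [swapProd_cons, Perm.mul_apply, ← ih fun z hz => h z (by simp [hz])]
    generalize swapProd w x = y
    have hz := h z (by simp)
    rcases eq_or_ne y z.1 with rfl | h1
    · rw [swap_apply_left, hz]
    · rcases eq_or_ne y z.2 with rfl | h2
      · rw [swap_apply_right, hz]
      · rw [swap_apply_of_ne_of_ne h1 h2]

end SwapProd

/-! ### Pairings and monotone walks -/

section Walk

variable {I : Type*} [Fintype I] [LinearOrder I]

/-- The word of transpositions `(a b)`, `a ∈ L b`, arranged by increasing `b`. -/
def walkWord (L : I → List I) : List (I × I) :=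
  (Finset.univ.sort (· ≤ ·)).flatMap fun b => (L b).map fun a => (a, b)

/-- The number of transpositions of a walk. -/
def walkLength (L : I → List I) : ℕ := ∑ b, (L b).length

theorem length_walkWord (L : I → List I) : (walkWord L).length = walkLength L := by
  rw [walkWord, walkLength, List.length_flatMap]
  simp only [List.length_map]
  rw [← Multiset.sum_coe, ← Multiset.map_coe, Finset.sort_eq]
  rfl

theorem mem_walkWord {L : I → List I} {z : I × I} : z ∈ walkWord L ↔ z.1 ∈ L z.2 := by
  rw [walkWord, List.mem_flatMap]
  constructor
  · rintro ⟨b, _, hb⟩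
    obtain ⟨a, ha, rfl⟩ := List.mem_map.1 hb
    exact ha
  · intro h
    exact ⟨z.2, by simp, List.mem_map.2 ⟨z.1, h, rfl⟩⟩

/-- The permutation `τ_1 τ_2 ⋯ τ_r` of a walk. -/
def walkPerm (L : I → List I) : Perm I := swapProd (walkWord L)

/-- The word is arranged by increasing second component, and no letter has one which is at least
`b`; the new letters therefore come last. -/
theorem walkWord_update {L : I → List I} {b : I} (hL : ∀ x, b ≤ x → L x = []) (w : List I) :
    walkWord (Function.update L b w) = walkWord L ++ w.map fun a => (a, b) := by
  unfold walkWord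
  have hb : b ∈ (Finset.univ : Finset I).sort (· ≤ ·) := by simp
  have hs := (Finset.sortedLT_sort (Finset.univ : Finset I)).pairwise
  obtain ⟨l₁, l₂, hl⟩ := List.append_of_mem hb
  rw [hl] at hs ⊢
  rw [List.pairwise_append, List.pairwise_cons] at hs
  obtain ⟨-, ⟨h2, -⟩, h3⟩ := hs
  have e1 : l₁.flatMap (fun x => (Function.update L b w x).map fun a => (a, x)) =
      l₁.flatMap (fun x => (L x).map fun a => (a, x)) := by
    refine List.flatMap_congr fun x hx => ?_
    rw [Function.update_of_ne (ne_of_lt (h3 x hx b (by simp)))]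
  have e2 : l₂.flatMap (fun x => (Function.update L b w x).map fun a => (a, x)) = [] := by
    rw [List.flatMap_eq_nil_iff]
    intro x hx
    rw [Function.update_of_ne (ne_of_gt (h2 x hx)), hL x (h2 x hx).le, List.map_nil]
  have e3 : l₂.flatMap (fun x => (L x).map fun a => (a, x)) = [] := by
    rw [List.flatMap_eq_nil_iff]
    intro x hx
    rw [hL x (h2 x hx).le, List.map_nil]
  rw [List.flatMap_append, List.flatMap_append, List.flatMap_cons, List.flatMap_cons, e1, e2, e3,
    Function.update_self, hL b le_rfl]
  simp

/-- A pairing `D.1` of `S`, exchanging the signs, together with a monotone walk `D.2` on the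
elements of `S` of sign `1`. -/
structure IsWalk (ε : I → ℤˣ) (S : Finset I) (D : Perm I × (I → List I)) : Prop where
  invol : ∀ k, D.1 (D.1 k) = k
  fix : ∀ k, k ∉ S → D.1 k = k
  sign : ∀ k ∈ S, ε (D.1 k) = -ε k
  mem : ∀ b, ∀ a ∈ D.2 b, a < b ∧ a ∈ S ∧ b ∈ S ∧ ε a = 1 ∧ ε b = 1

/-- The type of walks on `S`. -/
abbrev Walk (ε : I → ℤˣ) (S : Finset I) : Type _ := {D : Perm I × (I → List I) // IsWalk ε S D}

/-- The elements of `S` of sign `1`. -/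
abbrev outs (ε : I → ℤˣ) (S : Finset I) : Finset I := S.filter fun k => ε k = 1

/-- The elements of `S` of sign `-1`. -/
abbrev ins (ε : I → ℤˣ) (S : Finset I) : Finset I := S.filter fun k => ε k ≠ 1

theorem sign_ne_neg (e : ℤˣ) : -e ≠ e := by
  rcases Int.units_eq_one_or e with rfl | rfl <;> decide

theorem sign_ne_one_iff {e : ℤˣ} : e ≠ 1 ↔ e = -1 := by
  rcases Int.units_eq_one_or e with rfl | rfl <;> decide

namespace IsWalk

variable {ε : I → ℤˣ} {S : Finset I} {D : Perm I × (I → List I)}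

theorem apply_mem (h : IsWalk ε S D) {k : I} (hk : k ∈ S) : D.1 k ∈ S := by
  by_contra hc
  have h1 := h.fix _ hc
  rw [h.invol] at h1
  have h2 := h.sign k hk
  rw [← h1] at h2
  exact sign_ne_neg _ h2.symm

theorem card_outs (h : IsWalk ε S D) : (outs ε S).card = (ins ε S).card := by
  refine Finset.card_bij' (fun k _ => D.1 k) (fun k _ => D.1 k) ?_ ?_ (fun k _ => h.invol k)
    (fun k _ => h.invol k)
  · intro k hk
    rw [Finset.mem_filter] at hk ⊢
    refine ⟨h.apply_mem hk.1, ?_⟩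
    rw [h.sign k hk.1, hk.2]; decide
  · intro k hk
    rw [Finset.mem_filter] at hk ⊢
    refine ⟨h.apply_mem hk.1, ?_⟩
    rw [h.sign k hk.1, sign_ne_one_iff.1 hk.2, neg_neg]

theorem word_mem (h : IsWalk ε S D) {z : I × I} (hz : z ∈ walkWord D.2) :
    z.1 < z.2 ∧ z.1 ∈ S ∧ z.2 ∈ S ∧ ε z.1 = 1 ∧ ε z.2 = 1 :=
  h.mem z.2 z.1 (mem_walkWord.1 hz)

theorem perm_mem_iff (h : IsWalk ε S D) (k : I) : walkPerm D.2 k ∈ S ↔ k ∈ S :=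
  swapProd_invariant _ (· ∈ S) (fun _ hz => iff_of_true (h.word_mem hz).2.1 (h.word_mem hz).2.2.1) k

theorem perm_sign (h : IsWalk ε S D) (k : I) : ε (walkPerm D.2 k) = ε k := by
  have := swapProd_invariant (walkWord D.2) (fun x => ε x = ε k)
    (fun z hz => by rw [(h.word_mem hz).2.2.2.1, (h.word_mem hz).2.2.2.2]) k
  exact this.2 rfl

theorem perm_of_notMem (h : IsWalk ε S D) {k : I} (hk : k ∉ S) : walkPerm D.2 k = k :=
  swapProd_apply_of_notMem _ fun _ hz =>
    ⟨fun e => hk (e ▸ (h.word_mem hz).2.1), fun e => hk (e ▸ (h.word_mem hz).2.2.1)⟩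

theorem eq_nil (h : IsWalk ε S D) {b : I} (hb : ¬ (b ∈ S ∧ ε b = 1)) : D.2 b = [] := by
  rw [List.eq_nil_iff_forall_not_mem]
  intro a ha
  exact hb ⟨(h.mem b a ha).2.2.1, (h.mem b a ha).2.2.2.2⟩

end IsWalk

/-- The list of elements of a list of a subtype. -/
abbrev valList {A : Finset I} (w : List {a // a ∈ A}) : List I := w.map Subtype.val

/-- The smaller pairing fixes `b` and `k`, so that multiplying by their transposition simply adds a
pair. The steps at `b` start from smaller elements because `b` is the largest of sign `1`. -/
theorem isWalk_extend {ε : I → ℤˣ} {S : Finset I} {b : I} (hb : b ∈ outs ε S)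
    (hmax : ∀ x ∈ outs ε S, x ≤ b) (w : List {a // a ∈ (outs ε S).erase b}) {k : I}
    (hk : k ∈ ins ε S) {D : Perm I × (I → List I)} (hD : IsWalk ε ((S.erase b).erase k) D) :
    IsWalk ε S (D.1 * swap b k, Function.update D.2 b (valList w)) := by
  rw [Finset.mem_filter] at hb hk
  have hbk : b ≠ k := fun e => hk.2 (e ▸ hb.2)
  have fb : D.1 b = b := hD.fix b (by simp)
  have fk : D.1 k = k := hD.fix k (by simp)
  have hne : ∀ x, x ≠ b → x ≠ k → D.1 x ≠ b ∧ D.1 x ≠ k := by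
    intro x h1 h2
    exact ⟨fun e => h1 (D.1.injective (e.trans fb.symm)),
      fun e => h2 (D.1.injective (e.trans fk.symm))⟩
  refine ⟨fun x => ?_, fun x hx => ?_, fun x hx => ?_, fun x a ha => ?_⟩
  · simp only [Perm.mul_apply]
    rcases eq_or_ne x b with rfl | h1
    · simp [fk, fb]
    · rcases eq_or_ne x k with rfl | h2
      · simp [fk, fb]
      · rw [swap_apply_of_ne_of_ne h1 h2, swap_apply_of_ne_of_ne (hne x h1 h2).1 (hne x h1 h2).2,
          hD.invol]
  · have h1 : x ≠ b := fun e => hx (e ▸ hb.1)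
    have h2 : x ≠ k := fun e => hx (e ▸ hk.1)
    rw [Perm.mul_apply, swap_apply_of_ne_of_ne h1 h2]
    exact hD.fix x (by simp [hx])
  · simp only [Perm.mul_apply]
    rcases eq_or_ne x b with rfl | h1
    · rw [swap_apply_left, fk, hb.2, sign_ne_one_iff.1 hk.2]
    · rcases eq_or_ne x k with rfl | h2
      · rw [swap_apply_right, fb, hb.2, sign_ne_one_iff.1 hk.2, neg_neg]
      · rw [swap_apply_of_ne_of_ne h1 h2]
        exact hD.sign x (by simp [h1, h2, hx])
  · rcases eq_or_ne x b with rfl | h1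
    · simp only [Function.update_self] at ha
      obtain ⟨⟨a, ha'⟩, -, rfl⟩ := List.mem_map.1 ha
      rw [Finset.mem_erase] at ha'
      have h3 := Finset.mem_filter.1 ha'.2
      exact ⟨lt_of_le_of_ne (hmax _ ha'.2) ha'.1, h3.1, hb.1, h3.2, hb.2⟩
    · simp only [Function.update_of_ne h1] at ha
      have := hD.mem x a ha
      simp only [Finset.mem_erase] at this
      exact ⟨this.1, this.2.1.2.2, this.2.2.1.2.2, this.2.2.2⟩

/-- A walk on `S` is given by its steps at the largest element `b` of sign `1`, by the element `k`
paired with `b`, and by a walk on `S \ {b, k}`. -/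
noncomputable def walkEquiv {ε : I → ℤˣ} {S : Finset I} {b : I} (hb : b ∈ outs ε S)
    (hmax : ∀ x ∈ outs ε S, x ≤ b) :
    List {a // a ∈ (outs ε S).erase b} ×
      (Σ k : {k // k ∈ ins ε S}, Walk ε ((S.erase b).erase k.1)) ≃ Walk ε S :=
  Equiv.ofBijective (fun z => ⟨(z.2.2.1.1 * swap b z.2.1.1,
      Function.update z.2.2.1.2 b (valList z.1)), isWalk_extend hb hmax z.1 z.2.1.2 z.2.2.2⟩) <| by
    have hb' := Finset.mem_filter.1 hb
    constructor
    · rintro ⟨w, ⟨k, hk⟩, ⟨⟨α, L⟩, hD⟩⟩ ⟨w', ⟨k', hk'⟩, ⟨⟨α', L'⟩, hD'⟩⟩ h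
      simp only [Subtype.mk.injEq, Prod.mk.injEq] at h
      obtain ⟨h1, h2⟩ := h
      have hkk : k = k' := by
        have := congrArg (fun f : Perm I => f b) h1
        simp only [Perm.mul_apply, swap_apply_left] at this
        rwa [hD.fix k (by simp), hD'.fix k' (by simp)] at this
      subst hkk
      have hα : α = α' := mul_right_cancel h1
      subst hα
      have hw : w = w' := by
        have := congrFun h2 b
        simp only [Function.update_self] at this
        exact List.map_injective_iff.2 Subtype.val_injective this
      subst hw
      have hL : L = L' := by
        funext x
        rcases eq_or_ne x b with rfl | hx
        · rw [show L x = [] from hD.eq_nil (by simp), show L' x = [] from hD'.eq_nil (by simp)]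
        · have := congrFun h2 x
          rwa [Function.update_of_ne hx, Function.update_of_ne hx] at this
      subst hL
      rfl
    · rintro ⟨⟨α, L⟩, hD⟩
      have hα : ε (α b) = -1 := by rw [hD.sign b hb'.1, hb'.2]
      have hk : α b ∈ ins ε S :=
        Finset.mem_filter.2 ⟨hD.apply_mem hb'.1, by rw [hα]; decide⟩
      have hbk : b ≠ α b := fun e => by rw [← e, hb'.2] at hα; exact absurd hα (by decide)
      have hinv : ∀ x, α (α x) = x := hD.invol
      have hw : ∀ a ∈ L b, a ∈ (outs ε S).erase b := by
        intro a ha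
        have := hD.mem b a ha
        exact Finset.mem_erase.2 ⟨this.1.ne, Finset.mem_filter.2 ⟨this.2.1, this.2.2.2.1⟩⟩
      -- Conversely, a walk on `S` is stripped of the pair `{b, α b}` and of its steps at `b`. No
      -- remaining step involves `b`, by maximality, nor `α b`, which has sign `-1`.
      have hD' : IsWalk ε ((S.erase b).erase (α b))
          (α * swap b (α b), Function.update L b []) := by
        have hne : ∀ x, x ≠ b → x ≠ α b → α x ≠ b ∧ α x ≠ α b := by
          intro x h1 h2
          exact ⟨fun e => h2 (by rw [← e, hinv]), fun e => h1 (α.injective e)⟩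
        refine ⟨fun x => ?_, fun x hx => ?_, fun x hx => ?_, fun x a ha => ?_⟩
        · simp only [Perm.mul_apply]
          rcases eq_or_ne x b with rfl | h1
          · simp [hinv]
          · rcases eq_or_ne x (α b) with rfl | h2
            · simp
            · rw [swap_apply_of_ne_of_ne h1 h2,
                swap_apply_of_ne_of_ne (hne x h1 h2).1 (hne x h1 h2).2, hinv]
        · simp only [Perm.mul_apply]
          rcases eq_or_ne x b with rfl | h1
          · simp [hinv]
          · rcases eq_or_ne x (α b) with rfl | h2
            · simp
            · rw [swap_apply_of_ne_of_ne h1 h2]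
              exact hD.fix x fun hS => hx (by simp [h1, h2, hS])
        · simp only [Finset.mem_erase] at hx
          simp only [Perm.mul_apply]
          rw [swap_apply_of_ne_of_ne hx.2.1 hx.1]
          exact hD.sign x hx.2.2
        · rcases eq_or_ne x b with rfl | h1
          · simp at ha
          · simp only [Function.update_of_ne h1] at ha
            have h2 := hD.mem x a ha
            have hxb : x ≤ b := hmax x (Finset.mem_filter.2 ⟨h2.2.2.1, h2.2.2.2.2⟩)
            have hn : ∀ y, ε y = 1 → y ≠ α b := fun y hy e => by
              rw [e, hα] at hy; exact absurd hy (by decide)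
            refine ⟨h2.1, ?_, ?_, h2.2.2.2⟩
            · simp [hn a h2.2.2.2.1, (h2.1.trans_le hxb).ne, h2.2.1]
            · simp [hn x h2.2.2.2.2, h1, h2.2.2.1]
      refine ⟨⟨(L b).attach.map fun a => ⟨a.1, hw a.1 a.2⟩, ⟨α b, hk⟩, ⟨_, hD'⟩⟩, ?_⟩
      apply Subtype.ext
      simp only [mul_assoc, Equiv.swap_mul_self, mul_one, Function.update_idem, Prod.mk.injEq,
        true_and]
      funext x
      rcases eq_or_ne x b with rfl | hx
      · simp [valList]
      · rw [Function.update_of_ne hx]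

end Walk

/-! ### Expansion of the moments over walks -/

section Expansion

variable {I : Type*} [Fintype I] [LinearOrder I]

/-- The coefficient of a walk. -/
noncomputable def walkCoeff (N : ℕ) (ε : I → ℤˣ) (S : Finset I) (L : I → List I) : ℂ :=
  ((N : ℂ)⁻¹) ^ (outs ε S).card * (-(N : ℂ)⁻¹) ^ walkLength L

theorem walkLength_update {L : I → List I} {b : I} (hL : L b = []) (w : List I) :
    walkLength (Function.update L b w) = w.length + walkLength L := by
  unfold walkLength
  rw [← Finset.add_sum_erase _ _ (Finset.mem_univ b), ← Finset.add_sum_erase _ (fun b => _)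
    (Finset.mem_univ b), Function.update_self, hL, List.length_nil, zero_add]
  congr 1
  refine Finset.sum_congr rfl fun x hx => ?_
  rw [Function.update_of_ne (Finset.ne_of_mem_erase hx)]

theorem outs_erase_erase {ε : I → ℤˣ} {S : Finset I} {b k : I} (hk : k ∈ ins ε S) :
    outs ε ((S.erase b).erase k) = (outs ε S).erase b := by
  rw [Finset.mem_filter] at hk
  ext x
  simp only [Finset.mem_filter, Finset.mem_erase]
  constructor
  · rintro ⟨⟨h1, h2, h3⟩, h4⟩
    exact ⟨h2, h3, h4⟩
  · rintro ⟨h2, h3, h4⟩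
    exact ⟨⟨fun e => hk.2 (e ▸ h4), h2, h3⟩, h4⟩

theorem card_erase_erase {ε : I → ℤˣ} {S : Finset I} {b k : I} (hb : b ∈ outs ε S)
    (hk : k ∈ ins ε S) : ((S.erase b).erase k).card + 2 = S.card := by
  rw [Finset.mem_filter] at hb hk
  have hkb : k ≠ b := fun e => hk.2 (e ▸ hb.2)
  have h1 : k ∈ S.erase b := Finset.mem_erase.2 ⟨hkb, hk.1⟩
  rw [← Finset.card_erase_add_one hb.1, ← Finset.card_erase_add_one h1]

theorem walkCoeff_extend {N : ℕ} {ε : I → ℤˣ} {S : Finset I} {b k : I} (hb : b ∈ outs ε S)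
    (hk : k ∈ ins ε S) {L : I → List I} (hL : L b = []) (w : List I) :
    walkCoeff N ε S (Function.update L b w) =
      ((N : ℂ)⁻¹ * (-(N : ℂ)⁻¹) ^ w.length) * walkCoeff N ε ((S.erase b).erase k) L := by
  unfold walkCoeff
  rw [walkLength_update hL, outs_erase_erase hk, ← Finset.card_erase_add_one hb]
  ring

/-- Transpositions act on families of indices by precomposition, which reverses the order; hence the
inverse of the product. -/
theorem foldr_comp_swap {X : Type*} (b : I) {A : Finset I} (w : List {a // a ∈ A}) (j : I → X) :
    w.foldr (fun a j => j ∘ swap a.1 b) j =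
      j ∘ ((swapProd ((valList w).map fun a => (a, b)))⁻¹ : Perm I) := by
  induction w with
  | nil => simp [swapProd]
  | cons a w ih =>
    rw [List.foldr_cons, ih, valList, valList, List.map_cons, List.map_cons, swapProd_cons,
      _root_.mul_inv_rev, swap_inv]
    rfl

/-- Since `b` is the largest element, the steps at `b` are the rightmost factor `s` of the
permutation of the walk, and the change of variable `x ↦ s⁻¹ x` moves them onto `j`. The smaller
walk fixes `b` and `k`, so the conditions at these two points separate: they are the Kronecker
symbols of `entryMoment_recursion`. -/
theorem walk_condition {X : Type*} {ε : I → ℤˣ} {S : Finset I} {b k : I} (hb : b ∈ outs ε S)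
    (hmax : ∀ x ∈ outs ε S, x ≤ b) (hk : k ∈ ins ε S) {D : Perm I × (I → List I)}
    (hD : IsWalk ε ((S.erase b).erase k) D) (w : List {a // a ∈ (outs ε S).erase b})
    (j i : I → X) :
    (∀ x ∈ S, j x = i ((D.1 * swap b k) (walkPerm (Function.update D.2 b (valList w)) x))) ↔
    ((i k = w.foldr (fun a j => j ∘ swap a.1 b) j b ∧
      w.foldr (fun a j => j ∘ swap a.1 b) j k = i b) ∧
      ∀ x ∈ (S.erase b).erase k, w.foldr (fun a j => j ∘ swap a.1 b) j x =
        i (D.1 (walkPerm D.2 x))) := by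
  have hb' := Finset.mem_filter.1 hb
  have hk' := Finset.mem_filter.1 hk
  have hkb : k ≠ b := fun e => hk'.2 (e ▸ hb'.2)
  rw [foldr_comp_swap]
  set s := swapProd ((valList w).map fun a => (a, b)) with hs
  have hnil : ∀ x, b ≤ x → D.2 x = [] := by
    intro x hx
    refine hD.eq_nil ?_
    rintro ⟨h1, h2⟩
    simp only [Finset.mem_erase] at h1
    exact h1.2.1 (le_antisymm (hmax x (Finset.mem_filter.2 ⟨h1.2.2, h2⟩)) hx)
  have hperm : walkPerm (Function.update D.2 b (valList w)) = walkPerm D.2 * s := by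
    rw [walkPerm, walkWord_update hnil, swapProd_append]
    rfl
  have hsS : ∀ x, s x ∈ S ↔ x ∈ S := by
    refine swapProd_invariant _ (· ∈ S) fun z hz => ?_
    obtain ⟨a, ha, rfl⟩ := List.mem_map.1 hz
    obtain ⟨⟨a, ha'⟩, -, rfl⟩ := List.mem_map.1 ha
    have := Finset.mem_filter.1 (Finset.mem_of_mem_erase ha')
    exact iff_of_true this.1 hb'.1
  have h1 : (∀ x ∈ S, j x = i ((D.1 * swap b k)
      (walkPerm (Function.update D.2 b (valList w)) x))) ↔
      ∀ x ∈ S, (j ∘ (s⁻¹ : Perm I)) x = i ((D.1 * swap b k) (walkPerm D.2 x)) := by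
    rw [hperm]
    constructor
    · intro h x hx
      have := h (s⁻¹ x) ((hsS _).1 (by simpa using hx))
      simpa using this
    · intro h x hx
      have := h (s x) ((hsS _).2 hx)
      simpa using this
  have fb : D.1 b = b := hD.fix b (by simp)
  have fk : D.1 k = k := hD.fix k (by simp)
  have pb : walkPerm D.2 b = b := hD.perm_of_notMem (by simp)
  have pk : walkPerm D.2 k = k := hD.perm_of_notMem (by simp)
  rw [h1]
  constructor
  · intro h
    refine ⟨⟨?_, ?_⟩, fun x hx => ?_⟩
    · have := h b hb'.1
      rw [pb, Perm.mul_apply, swap_apply_left, fk] at this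
      exact this.symm
    · have := h k hk'.1
      rw [pk, Perm.mul_apply, swap_apply_right, fb] at this
      exact this
    · have hx' := (hD.perm_mem_iff x).2 hx
      simp only [Finset.mem_erase] at hx hx'
      have := h x hx.2.2
      rwa [Perm.mul_apply, swap_apply_of_ne_of_ne hx'.2.1 hx'.1] at this
  · rintro ⟨⟨h2, h3⟩, h4⟩ x hx
    rcases eq_or_ne x b with rfl | hxb
    · rw [pb, Perm.mul_apply, swap_apply_left, fk]
      exact h2.symm
    · rcases eq_or_ne x k with rfl | hxk
      · rw [pk, Perm.mul_apply, swap_apply_right, fb]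
        exact h3
      · have hx2 : x ∈ (S.erase b).erase k := by simp [hxb, hxk, hx]
        have hx' := (hD.perm_mem_iff x).2 hx2
        simp only [Finset.mem_erase] at hx'
        rw [Perm.mul_apply, swap_apply_of_ne_of_ne hx'.2.1 hx'.1]
        exact h4 x hx2

theorem walkCoeff_walkEquiv {N : ℕ} {ε : I → ℤˣ} {S : Finset I} {b : I} (hb : b ∈ outs ε S)
    (hmax : ∀ x ∈ outs ε S, x ≤ b) (w : List {a // a ∈ (outs ε S).erase b})
    (z : Σ k : {k // k ∈ ins ε S}, Walk ε ((S.erase b).erase k.1)) :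
    walkCoeff N ε S (walkEquiv hb hmax (w, z)).1.2 = ((N : ℂ)⁻¹ * (-(N : ℂ)⁻¹) ^ w.length) *
        walkCoeff N ε ((S.erase b).erase z.1.1) z.2.1.2 := by
  have := walkCoeff_extend (N := N) hb z.1.2 (z.2.2.eq_nil (b := b) (by simp)) (valList w)
  simp only [List.length_map] at this
  exact this

theorem walkEquiv_condition {X : Type*} {ε : I → ℤˣ} {S : Finset I} {b : I} (hb : b ∈ outs ε S)
    (hmax : ∀ x ∈ outs ε S, x ≤ b) (w : List {a // a ∈ (outs ε S).erase b})
    (z : Σ k : {k // k ∈ ins ε S}, Walk ε ((S.erase b).erase k.1)) (j i : I → X) :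
    (∀ x ∈ S, j x = i ((walkEquiv hb hmax (w, z)).1.1
      (walkPerm (walkEquiv hb hmax (w, z)).1.2 x))) ↔
    ((i z.1.1 = w.foldr (fun a j => j ∘ swap a.1 b) j b ∧
      w.foldr (fun a j => j ∘ swap a.1 b) j z.1.1 = i b) ∧
      ∀ x ∈ (S.erase b).erase z.1.1, w.foldr (fun a j => j ∘ swap a.1 b) j x =
        i (z.2.1.1 (walkPerm z.2.1.2 x))) :=
  walk_condition hb hmax z.1.2 z.2.2 w j i

/-- A Weingarten-type expansion, by induction on `S`. Solving `entryMoment_recursion` at the largest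
`b` of sign `1` by a Neumann series gives a sum over words at `b` and over the partner `k` of `b`,
with moments on a smaller set to which the induction applies. This is exactly the decomposition of a
walk in `walkEquiv`. -/
theorem hasSum_walk {N : ℕ} (ε : I → ℤˣ) (S : Finset I) (hS : S.card ≤ 2 * N) :
    (Summable fun D : Walk ε S => ‖walkCoeff N ε S D.1.2‖) ∧ ∀ j i : I → Fin N,
      HasSum (fun D : Walk ε S => walkCoeff N ε S D.1.2 *
        if ∀ x ∈ S, j x = i (D.1.1 (walkPerm D.1.2 x)) then 1 else 0) (entryMoment ε S j i) := by
  induction hn : S.card using Nat.strong_induction_on generalizing S with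
  | _ n ih =>
  by_cases hbal : (outs ε S).card = (ins ε S).card
  swap
  -- Without as many signs `1` as `-1` there is no pairing, and the moment vanishes too.
  · have : IsEmpty (Walk ε S) := ⟨fun D => hbal D.2.card_outs⟩
    refine ⟨summable_empty, fun j i => ?_⟩
    rw [entryMoment_eq_zero ε S j i hbal]
    exact hasSum_empty
  have hcard : (outs ε S).card + (ins ε S).card = S.card :=
    Finset.card_filter_add_card_filter_not _
  rcases (outs ε S).eq_empty_or_nonempty with hO | hO
  · have hSe : S = ∅ := by
      rw [← Finset.card_eq_zero, ← hcard, ← hbal, hO]; rfl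
    subst hSe
    have huniq : ∀ D : Walk ε (∅ : Finset I), D = ⟨(1, fun _ => []),
        ⟨fun _ => rfl, fun _ _ => rfl, by simp, by simp⟩⟩ := by
      rintro ⟨⟨α, L⟩, hD⟩
      apply Subtype.ext
      refine Prod.ext ?_ ?_
      · ext x; exact hD.fix x (by simp)
      · funext x; exact hD.eq_nil (by simp)
    have hU : Unique (Walk ε (∅ : Finset I)) := ⟨⟨_⟩, huniq⟩
    refine ⟨(hasSum_unique _).summable, fun j i => ?_⟩
    rw [entryMoment_empty]
    convert hasSum_unique _ using 1
    rw [huniq default]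
    simp [walkCoeff, walkLength]
  obtain ⟨b, hb, hmax⟩ : ∃ b ∈ outs ε S, ∀ x ∈ outs ε S, x ≤ b :=
    ⟨_, Finset.max'_mem _ hO, fun x hx => Finset.le_max' _ x hx⟩
  have hb' := Finset.mem_filter.1 hb
  -- With balanced signs there are at most `N` elements of sign `1`; removing `b` leaves strictly
  -- fewer than `N` letters, as the Neumann series requires.
  have hA : Fintype.card {a // a ∈ (outs ε S).erase b} < N := by
    rw [Fintype.card_coe, Finset.card_erase_of_mem hb]
    have : 0 < (outs ε S).card := Finset.card_pos.2 hO
    omega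
  have hN : (0 : ℝ) < N := by exact_mod_cast (by omega : 0 < N)
  have ih' : ∀ k : {k // k ∈ ins ε S},
      (Summable fun D : Walk ε ((S.erase b).erase k.1) =>
        ‖walkCoeff N ε ((S.erase b).erase k.1) D.1.2‖) ∧ ∀ j i : I → Fin N,
      HasSum (fun D : Walk ε ((S.erase b).erase k.1) =>
        walkCoeff N ε ((S.erase b).erase k.1) D.1.2 *
        if ∀ x ∈ ((S.erase b).erase k.1), j x = i (D.1.1 (walkPerm D.1.2 x)) then 1 else 0)
        (entryMoment ε ((S.erase b).erase k.1) j i) := by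
    intro k
    have := card_erase_erase hb k.2
    exact ih _ (by omega) _ (by omega) rfl
  have hsig : Summable fun z : (Σ k : {k // k ∈ ins ε S}, Walk ε ((S.erase b).erase k.1)) =>
      ‖walkCoeff N ε ((S.erase b).erase z.1.1) z.2.1.2‖ := by
    rw [summable_sigma_of_nonneg (fun _ => norm_nonneg _)]
    exact ⟨fun k => (ih' k).1, (hasSum_fintype _).summable⟩
  have hlist : Summable fun w : List {a // a ∈ (outs ε S).erase b} =>
      ‖(N : ℂ)⁻¹ * (-(N : ℂ)⁻¹) ^ w.length‖ := by
    simp only [norm_mul, norm_pow, norm_neg, norm_inv, Complex.norm_natCast]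
    refine (summable_pow_length (by positivity) ?_).mul_left _
    rw [← div_eq_mul_inv, div_lt_one hN]
    exact_mod_cast hA
  have hsum : Summable fun D : Walk ε S => ‖walkCoeff N ε S D.1.2‖ := by
    rw [← (walkEquiv hb hmax).summable_iff]
    have h := hlist.mul_norm (g := fun z : (Σ k : {k // k ∈ ins ε S},
      Walk ε ((S.erase b).erase k.1)) => walkCoeff N ε ((S.erase b).erase z.1.1) z.2.1.2) hsig
    refine (summable_congr fun z => ?_).1 h
    obtain ⟨w, z⟩ := z
    rw [Function.comp, walkCoeff_walkEquiv hb hmax w z]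
  refine ⟨hsum, fun j i => ?_⟩
  have hall : Summable (fun D : Walk ε S => walkCoeff N ε S D.1.2 *
        if ∀ x ∈ S, j x = i (D.1.1 (walkPerm D.1.2 x)) then 1 else 0) := by
    refine Summable.of_norm_bounded hsum fun D => ?_
    rw [norm_mul]
    refine mul_le_of_le_one_right (norm_nonneg _) ?_
    split_ifs <;> simp
  have hneu := hasSum_neumann (fun (a : {a // a ∈ (outs ε S).erase b}) (j : I → Fin N) =>
    j ∘ swap a.1 b) (fun j => entryMoment ε S j i)
    (fun j => ∑ k : {k // k ∈ ins ε S}, (if i k.1 = j b ∧ j k.1 = i b then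
      entryMoment ε ((S.erase b).erase k.1) j i else 0)) N hA
    (fun j => norm_entryMoment_le ε S j i) (fun j => by
      have := entryMoment_recursion ε S j i hb'.1 hb'.2
      rw [← Finset.sum_coe_sort (S.filter fun k => ε k ≠ 1),
        ← Finset.sum_coe_sort ((S.filter fun k => ε k = 1).erase b)] at this
      exact this) j
  have h1 := (walkEquiv hb hmax).hasSum_iff.2 hall.hasSum
  -- Absolute summability allows summing first over the partner of `b` and the smaller walk, for a
  -- fixed word at `b`. The outer series is then the Neumann series of the moment.
  have h2 := h1.prod_fiberwise (g := fun w : List {a // a ∈ (outs ε S).erase b} =>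
    (N : ℂ)⁻¹ * (-(N : ℂ)⁻¹) ^ w.length * ∑ k : {k // k ∈ ins ε S},
      (if i k.1 = w.foldr (fun a j => j ∘ swap a.1 b) j b ∧
        w.foldr (fun a j => j ∘ swap a.1 b) j k.1 = i b then
      entryMoment ε ((S.erase b).erase k.1) (w.foldr (fun a j => j ∘ swap a.1 b) j) i else 0)) ?_
  · rw [hneu.unique h2]
    exact hall.hasSum
  · intro w
    set j' := w.foldr (fun a j => j ∘ swap a.1 b) j with hj'
    have hterm : ∀ z : (Σ k : {k // k ∈ ins ε S}, Walk ε ((S.erase b).erase k.1)),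
        ((fun D : Walk ε S => walkCoeff N ε S D.1.2 *
          if ∀ x ∈ S, j x = i (D.1.1 (walkPerm D.1.2 x)) then 1 else 0) ∘ walkEquiv hb hmax)
          (w, z) = ((N : ℂ)⁻¹ * (-(N : ℂ)⁻¹) ^ w.length) *
          ((if i z.1.1 = j' b ∧ j' z.1.1 = i b then 1 else 0) *
            (walkCoeff N ε ((S.erase b).erase z.1.1) z.2.1.2 *
          if ∀ x ∈ ((S.erase b).erase z.1.1), j' x = i (z.2.1.1 (walkPerm z.2.1.2 x))
            then 1 else 0)) := by
      intro z
      simp only [Function.comp, walkCoeff_walkEquiv hb hmax w z,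
        walkEquiv_condition hb hmax w z j i, ← hj']
      by_cases h1 : i z.1.1 = j' b ∧ j' z.1.1 = i b
      · simp only [h1, true_and, if_true, one_mul, and_self]
        ring
      · simp only [h1, false_and, if_false, zero_mul, mul_zero]
    simp only [hterm]
    refine HasSum.mul_left _ ?_
    have hs : Summable fun z : (Σ k : {k // k ∈ ins ε S}, Walk ε ((S.erase b).erase k.1)) =>
        ((if i z.1.1 = j' b ∧ j' z.1.1 = i b then 1 else 0) *
            (walkCoeff N ε ((S.erase b).erase z.1.1) z.2.1.2 *
          if ∀ x ∈ ((S.erase b).erase z.1.1), j' x = i (z.2.1.1 (walkPerm z.2.1.2 x))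
            then 1 else 0)) := by
      refine Summable.of_norm_bounded hsig fun z => ?_
      split_ifs <;> simp
    have h3 := hs.hasSum.sigma fun k => (?_ : HasSum _
      (if i k.1 = j' b ∧ j' k.1 = i b then
        entryMoment ε ((S.erase b).erase k.1) j' i else 0))
    · rw [(hasSum_fintype _).unique h3]
      exact hs.hasSum
    · have h4 := ((ih' k).2 j' i).mul_left (if i k.1 = j' b ∧ j' k.1 = i b then (1 : ℂ) else 0)
      rwa [show ∀ (c : Prop) [Decidable c] (x : ℂ), (if c then (1 : ℂ) else 0) * x =
        if c then x else 0 from fun c _ x => by split_ifs <;> simp] at h4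

end Expansion

/-! ### Averages over indices and traces along cycles -/

section Avg

variable {I : Type*} [Fintype I] [DecidableEq I] {N : ℕ}

/-- The average of a function over all the families of indices in `Fin N`. -/
noncomputable def idxAvg (F : (I → Fin N) → ℂ) : ℂ :=
  ((N : ℂ)⁻¹) ^ Fintype.card I * ∑ i, F i

/-- The coordinates of a uniformly distributed family of indices are independent: functions of
disjoint sets of coordinates have multiplicative averages. -/
theorem idxAvg_mul (hN : N ≠ 0) (A : I → Prop) [DecidablePred A] {F G : (I → Fin N) → ℂ}
    (hF : ∀ i i' : I → Fin N, (∀ k, A k → i k = i' k) → F i = F i')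
    (hG : ∀ i i' : I → Fin N, (∀ k, ¬ A k → i k = i' k) → G i = G i') :
    idxAvg (fun i => F i * G i) = idxAvg F * idxAvg G := by
  classical
  have hN' : (N : ℂ) ≠ 0 := by exact_mod_cast hN
  have := NeZero.mk hN
  set e := Equiv.piEquivPiSubtypeProd A (fun _ => Fin N) with he
  set F' : ({k // A k} → Fin N) → ℂ := fun x => F (e.symm (x, fun _ => 0)) with hF'
  set G' : ({k // ¬ A k} → Fin N) → ℂ := fun y => G (e.symm (fun _ => 0, y)) with hG'
  have h1 : ∀ z, F (e.symm z) = F' z.1 := fun z => hF _ _ fun k hk => by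
    simp [he, Equiv.piEquivPiSubtypeProd, hk]
  have h2 : ∀ z, G (e.symm z) = G' z.2 := fun z => hG _ _ fun k hk => by
    simp [he, Equiv.piEquivPiSubtypeProd, hk]
  have e1 : ∑ i, F i = (∑ x, F' x) * (N : ℂ) ^ Fintype.card {k // ¬ A k} := by
    rw [← e.symm.sum_comp, Fintype.sum_prod_type]
    simp only [h1, Finset.sum_const, nsmul_eq_mul, Finset.card_univ, Fintype.card_pi,
      Fintype.card_fin, Finset.prod_const, ← Finset.mul_sum]
    push_cast
    ring
  have e2 : ∑ i, G i = (N : ℂ) ^ Fintype.card {k // A k} * ∑ y, G' y := by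
    rw [← e.symm.sum_comp, Fintype.sum_prod_type]
    simp only [h2, Finset.sum_const, nsmul_eq_mul, Finset.card_univ, Fintype.card_pi,
      Fintype.card_fin, Finset.prod_const]
    push_cast
    ring
  have e3 : ∑ i, F i * G i = (∑ x, F' x) * ∑ y, G' y := by
    rw [← e.symm.sum_comp, Fintype.sum_prod_type, Finset.sum_mul_sum]
    simp only [h1, h2]
  have hc : Fintype.card {k // A k} + Fintype.card {k // ¬ A k} = Fintype.card I := by
    rw [← Fintype.card_sum]
    exact Fintype.card_congr (Equiv.sumCompl A)
  have e4 : ((N : ℂ)⁻¹) ^ Fintype.card I * ((N : ℂ) ^ Fintype.card {k // A k} *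
      (N : ℂ) ^ Fintype.card {k // ¬ A k}) = 1 := by
    rw [← pow_add, hc, ← mul_pow, inv_mul_cancel₀ hN', one_pow]
  unfold idxAvg
  rw [e1, e2, e3]
  linear_combination (-(∑ x, F' x) * (∑ y, G' y) * ((N : ℂ)⁻¹) ^ Fintype.card I) * e4

/-- The restriction of a uniform family along an injection is again uniform. -/
theorem idxAvg_comp {J : Type*} [Fintype J] [DecidableEq J] (hN : N ≠ 0) {e : J → I}
    (he : Function.Injective e) (G : (J → Fin N) → ℂ) :
    (N : ℂ) ^ Fintype.card J * idxAvg (fun i : I → Fin N => G (i ∘ e)) = ∑ y, G y := by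
  classical
  have hN' : (N : ℂ) ≠ 0 := by exact_mod_cast hN
  set A : I → Prop := fun k => k ∈ Set.range e with hA
  set e' : J ≃ {k // A k} := Equiv.ofInjective e he with he'
  set f := Equiv.piEquivPiSubtypeProd A (fun _ => Fin N) with hf
  have h1 : ∀ z, G (f.symm z ∘ e) = G (z.1 ∘ e') := by
    intro z
    congr 1
    funext k
    have : A (e k) := ⟨k, rfl⟩
    simp only [hf, Equiv.piEquivPiSubtypeProd, Equiv.coe_fn_symm_mk, Function.comp, this, dif_pos]
    rfl
  have hc : Fintype.card J + Fintype.card {k // ¬ A k} = Fintype.card I := by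
    rw [Fintype.card_congr e', ← Fintype.card_sum]
    exact Fintype.card_congr (Equiv.sumCompl A)
  have e1 : ∑ i : I → Fin N, G (i ∘ e) =
      (∑ y, G y) * (N : ℂ) ^ Fintype.card {k // ¬ A k} := by
    rw [← f.symm.sum_comp, Fintype.sum_prod_type]
    simp only [h1, Finset.sum_const, nsmul_eq_mul, Finset.card_univ, Fintype.card_pi,
      Fintype.card_fin, Finset.prod_const, ← Finset.mul_sum]
    rw [mul_comm]
    push_cast
    congr 1
    exact (Equiv.arrowCongr e'.symm (Equiv.refl (Fin N))).sum_comp G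
  have e4 : ((N : ℂ)⁻¹) ^ Fintype.card I * ((N : ℂ) ^ Fintype.card J *
      (N : ℂ) ^ Fintype.card {k // ¬ A k}) = 1 := by
    rw [← pow_add, hc, ← mul_pow, inv_mul_cancel₀ hN', one_pow]
  rw [idxAvg, e1]
  linear_combination (∑ y, G y) * e4

theorem idxAvg_prod (S : Finset I) (hN : N ≠ 0) (g : I → Fin N → ℂ) :
    (N : ℂ) ^ S.card * idxAvg (fun j : I → Fin N => ∏ k ∈ S, g k (j k)) =
      ∏ k ∈ S, ∑ x, g k x := by
  classical
  have hN' : (N : ℂ) ≠ 0 := by exact_mod_cast hN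
  have h1 : ∑ j : I → Fin N, ∏ k ∈ S, g k (j k) =
      ∏ k, ∑ x, (if k ∈ S then g k x else 1) := by
    rw [Finset.prod_univ_sum]
    simp only [Fintype.piFinset_univ]
    refine Finset.sum_congr rfl fun j _ => ?_
    rw [Finset.prod_ite_mem, Finset.univ_inter]
  have h2 : ∏ k, ∑ x, (if k ∈ S then g k x else 1) =
      (∏ k ∈ S, ∑ x, g k x) * (N : ℂ) ^ (Sᶜ).card := by
    rw [← Finset.prod_mul_prod_compl S]
    congr 1
    · exact Finset.prod_congr rfl fun k hk => by simp [hk]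
    · rw [← Finset.prod_const]
      refine Finset.prod_congr rfl fun k hk => ?_
      simp [Finset.mem_compl.1 hk]
  have e4 : ((N : ℂ)⁻¹) ^ Fintype.card I * ((N : ℂ) ^ S.card * (N : ℂ) ^ (Sᶜ).card) = 1 := by
    rw [← pow_add, Finset.card_add_card_compl, ← mul_pow, inv_mul_cancel₀ hN', one_pow]
  rw [idxAvg, h1, h2]
  linear_combination (∏ k ∈ S, ∑ x, g k x) * e4

/-- The product over the cycles of `φ` contained in `S` of the traces along these cycles. -/
noncomputable def traceOn (S : Finset I) (Q : I → Matrix (Fin N) (Fin N) ℂ) (φ : Perm I) : ℂ :=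
  (N : ℂ) ^ S.card * idxAvg fun i : I → Fin N => ∏ k ∈ S, Q k (i k) (i (φ k))

theorem traceOn_congr {S : Finset I} {Q Q' : I → Matrix (Fin N) (Fin N) ℂ} {φ φ' : Perm I}
    (h : ∀ k ∈ S, φ k = φ' k) (hQ : ∀ k ∈ S, Q k = Q' k) : traceOn S Q φ = traceOn S Q' φ' := by
  unfold traceOn
  congr 2
  funext i
  exact Finset.prod_congr rfl fun k hk => by rw [h k hk, hQ k hk]

theorem traceOn_empty (hN : N ≠ 0) (Q : I → Matrix (Fin N) (Fin N) ℂ) (φ : Perm I) :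
    traceOn ∅ Q φ = 1 := by
  have := idxAvg_prod (I := I) ∅ hN fun _ _ => 1
  simpa [traceOn] using this

/-- The normalization of `traceOn` makes the indices outside `S` irrelevant. For disjoint stable
sets, the two factors depend on disjoint sets of indices and are therefore independent. -/
theorem traceOn_union (hN : N ≠ 0) {S S' : Finset I} (hd : Disjoint S S')
    (Q : I → Matrix (Fin N) (Fin N) ℂ) {φ : Perm I} (h : ∀ k ∈ S, φ k ∈ S)
    (h' : ∀ k ∈ S', φ k ∈ S') : traceOn (S ∪ S') Q φ = traceOn S Q φ * traceOn S' Q φ := by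
  unfold traceOn
  simp only [Finset.prod_union hd]
  rw [idxAvg_mul hN (· ∈ S), Finset.card_union_of_disjoint hd, pow_add]
  · ring
  · intro i i' hi
    exact Finset.prod_congr rfl fun k hk => by rw [hi k hk, hi _ (h k hk)]
  · intro i i' hi
    have hS' : ∀ k ∈ S', k ∉ S := fun k hk hk' => Finset.disjoint_left.1 hd hk' hk
    exact Finset.prod_congr rfl fun k hk => by rw [hi k (hS' k hk), hi _ (hS' _ (h' k hk))]

theorem list_ofFn_prod_apply (q : ℕ) (A : Fin (q + 1) → Matrix (Fin N) (Fin N) ℂ) (a b : Fin N) :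
    (List.ofFn A).prod a b = ∑ y : Fin q → Fin N, ∏ n : Fin (q + 1),
      A n ((Fin.cons a y : Fin (q + 1) → Fin N) n) ((Fin.snoc y b : Fin (q + 1) → Fin N) n) := by
  induction q generalizing a b with
  | zero => simp [Fin.snoc]
  | succ q ih =>
    rw [List.ofFn_succ, List.prod_cons, Matrix.mul_apply,
      ← (Fin.consEquiv fun _ : Fin (q + 1) => Fin N).sum_comp, Fintype.sum_prod_type]
    refine Finset.sum_congr rfl fun c _ => ?_
    rw [ih, Finset.mul_sum]
    refine Finset.sum_congr rfl fun y _ => ?_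
    rw [Fin.prod_univ_succ (n := q + 1)]
    simp only [Fin.consEquiv, Equiv.coe_fn_mk, Fin.cons_zero, Fin.cons_succ]
    rw [← Fin.cons_snoc_eq_snoc_cons]
    simp only [Fin.cons_zero, Fin.cons_succ]

/-- A trace is a sum over closed paths of indices: the expansion over open paths of
`list_ofFn_prod_apply`, with both ends identified. -/
theorem trace_list_ofFn (q : ℕ) (A : Fin (q + 1) → Matrix (Fin N) (Fin N) ℂ) :
    (List.ofFn A).prod.trace = ∑ y : Fin (q + 1) → Fin N,
      ∏ n, A n (y n) (y (finRotate (q + 1) n)) := by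
  rw [Matrix.trace, ← (Fin.consEquiv fun _ : Fin (q + 1) => Fin N).sum_comp,
    Fintype.sum_prod_type]
  refine Finset.sum_congr rfl fun a _ => ?_
  rw [Matrix.diag_apply, list_ofFn_prod_apply]
  refine Finset.sum_congr rfl fun y _ => Finset.prod_congr rfl fun n _ => ?_
  congr 1
  induction n using Fin.lastCases with
  | last => rw [Fin.snoc_last, finRotate_last]; rfl
  | cast n =>
    rw [Fin.snoc_castSucc, finRotate_apply, Fin.coeSucc_eq_succ]
    rfl

/-- The iterates of `x` up to the period parametrize its cycle by `Fin (q + 1)` and transport the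
cyclic shift to `φ`, which reduces the claim to `trace_list_ofFn`. -/
theorem traceOn_cycle (hN : N ≠ 0) (Q : I → Matrix (Fin N) (Fin N) ℂ) (φ : Perm I)
    (x : I) [DecidablePred (φ.SameCycle x)] :
    traceOn (Finset.univ.filter (φ.SameCycle x)) Q φ = (cycleProd φ Q x).trace := by
  obtain ⟨q, hq⟩ : ∃ q, Function.minimalPeriod φ x = q + 1 :=
    Nat.exists_eq_succ_of_ne_zero (Function.minimalPeriod_pos_of_mem_periodicPts
      ((Function.Injective.mem_periodicPts φ.injective) x)).ne'
  set e : Fin (q + 1) → I := fun n => φ^[n] x with he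
  have hinj : Function.Injective e := by
    intro n n' h
    have := Function.iterate_injOn_Iio_minimalPeriod (f := φ) (x := x)
      (by rw [hq]; exact n.2 : (n : ℕ) ∈ Set.Iio _) (by rw [hq]; exact n'.2) h
    exact Fin.ext this
  have hrot : ∀ n, e (finRotate (q + 1) n) = φ (e n) := by
    intro n
    induction n using Fin.lastCases with
    | last =>
      rw [finRotate_last]
      simp only [he, Fin.val_last, Fin.val_zero, Function.iterate_zero, id]
      rw [← Function.iterate_succ_apply' φ, Nat.succ_eq_add_one, ← hq,
        Function.iterate_minimalPeriod]
    | cast n =>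
      rw [finRotate_apply, Fin.coeSucc_eq_succ]
      simp only [he, Fin.val_succ, Fin.val_castSucc]
      rw [Function.iterate_succ_apply']
  have himg : Finset.univ.filter (φ.SameCycle x) = Finset.univ.image e := by
    ext y
    simp only [Finset.mem_filter, Finset.mem_univ, true_and, Finset.mem_image]
    constructor
    · intro h
      obtain ⟨n, hn⟩ := h.exists_nat_pow_eq
      refine ⟨⟨n % (q + 1), Nat.mod_lt _ (Nat.succ_pos q)⟩, ?_⟩
      simp only [he]
      rw [← hq, Function.iterate_mod_minimalPeriod_eq, Perm.iterate_eq_pow, hn]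
    · rintro ⟨n, rfl⟩
      exact ⟨n, by simp [he, Perm.iterate_eq_pow]⟩
  have hprod : cycleProd φ Q x = (List.ofFn fun n => Q (e n)).prod := by
    rw [cycleProd, hq]
    congr 1
    apply List.ext_getElem
    · simp
    · intro n h1 h2
      rw [List.getElem_ofFn, List.getElem_map, List.getElem_range]
  rw [hprod, trace_list_ofFn, himg, traceOn, Finset.card_image_of_injective _ hinj,
    Finset.card_univ, ← idxAvg_comp hN hinj]
  congr 2
  funext i
  rw [Finset.prod_image fun a _ b _ h => hinj h]
  simp only [Function.comp, hrot]

theorem traceOn_univ (hN : N ≠ 0) (Q : I → Matrix (Fin N) (Fin N) ℂ) (φ : Perm I) :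
    traceOn Finset.univ Q φ = (N : ℂ) ^ numCycles φ * trPerm φ Q := by
  classical
  have hN' : (N : ℂ) ≠ 0 := by exact_mod_cast hN
  have := Fintype.ofFinite (Cyc φ)
  -- The cycles are added one at a time, each being a stable set disjoint from the previous ones.
  have key : ∀ T : Finset (Cyc φ), traceOn (Finset.univ.filter fun k => (⟦k⟧ : Cyc φ) ∈ T) Q φ =
      ∏ c ∈ T, (cycleProd φ Q c.out).trace := by
    intro T
    induction T using Finset.induction_on with
    | empty => simpa using traceOn_empty hN Q φ
    | insert c T hc ih =>
      have hφ : ∀ k, (⟦φ k⟧ : Cyc φ) = ⟦k⟧ := fun k =>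
        Quotient.sound (s := SameCycle.setoid φ) ⟨-1, by simp⟩
      have h1 : (Finset.univ.filter fun k => (⟦k⟧ : Cyc φ) ∈ insert c T) =
          (Finset.univ.filter (φ.SameCycle c.out)) ∪
            (Finset.univ.filter fun k => (⟦k⟧ : Cyc φ) ∈ T) := by
        ext k
        simp only [Finset.mem_filter, Finset.mem_univ, true_and, Finset.mem_insert,
          Finset.mem_union]
        refine or_congr ⟨fun h => ?_, fun h => ?_⟩ Iff.rfl
        · subst h
          exact Quotient.exact (s := SameCycle.setoid φ) (Quotient.out_eq _)
        · rw [← Quotient.out_eq c]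
          exact Quotient.sound (s := SameCycle.setoid φ) h.symm
      rw [h1, traceOn_union hN, traceOn_cycle hN, ih, Finset.prod_insert hc]
      · rw [Finset.disjoint_left]
        intro k hk hk'
        simp only [Finset.mem_filter, Finset.mem_univ, true_and] at hk hk'
        apply hc
        rw [← Quotient.out_eq c]
        have : (⟦c.out⟧ : Cyc φ) = ⟦k⟧ := Quotient.sound (s := SameCycle.setoid φ) hk
        rw [this]
        exact hk'
      · intro k hk
        simp only [Finset.mem_filter, Finset.mem_univ, true_and] at hk ⊢
        exact hk.trans ⟨1, by simp⟩
      · intro k hk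
        simp only [Finset.mem_filter, Finset.mem_univ, true_and] at hk ⊢
        rwa [hφ]
  have h := key Finset.univ
  simp only [Finset.mem_univ, Finset.filter_true] at h
  rw [h, trPerm, finprod_eq_prod_of_fintype, numCycles, Nat.card_eq_fintype_card]
  simp only [ntr]
  rw [Finset.prod_mul_distrib, Finset.prod_const, Finset.card_univ, ← mul_assoc, ← mul_pow,
    mul_inv_cancel₀ hN', one_pow, one_mul]

end Avg

/-! ### Moments of traces as sums over walks -/

section TraceMoment

variable {I : Type*} [Fintype I] [LinearOrder I] {N : ℕ}

/-- The product of traces is a sum over indices `i` before each `M k` and `j` after it, with the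
moment of the entries `(j k, i (γ k))` as only random part. The expansion over walks forces `j = i ∘
γ α τ`, and the sum over `i` closes up into traces along the cycles of `γ α τ`. -/
theorem hasSum_traceOn (hN : N ≠ 0) (ε : I → ℤˣ) (S : Finset I) (hS : S.card ≤ 2 * N)
    (M : I → Matrix (Fin N) (Fin N) ℂ) (γ : Perm I) :
    HasSum (fun D : Walk ε S => walkCoeff N ε S D.1.2 *
      traceOn S M (γ * (D.1.1 * walkPerm D.1.2)))
      (∫ U : Matrix.unitaryGroup (Fin N) ℂ,
        traceOn S (fun k => M k * signPow (ε k) (U : Matrix _ _ ℂ)) γ ∂(haarU N)) := by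
  -- The normalization of `traceOn`. It appears squared because the sums over the families `i` and
  -- `j` both run over all of `I`, not only over `S`.
  set a : ℂ := (N : ℂ) ^ S.card * ((N : ℂ)⁻¹) ^ Fintype.card I with ha
  have h1 : ∀ U : Matrix.unitaryGroup (Fin N) ℂ,
      traceOn S (fun k => M k * signPow (ε k) (U : Matrix _ _ ℂ)) γ =
      ∑ i : I → Fin N, ∑ j : I → Fin N, (a * a * ∏ k ∈ S, M k (i k) (j k)) *
        ∏ k ∈ S, signPow (ε k) (U : Matrix _ _ ℂ) (j k) ((i ∘ γ) k) := by
    intro U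
    rw [traceOn, idxAvg, ← mul_assoc, ← ha, Finset.mul_sum]
    refine Finset.sum_congr rfl fun i _ => ?_
    simp only [Matrix.mul_apply]
    rw [← idxAvg_prod S hN (fun k x => M k (i k) x * signPow (ε k) (U : Matrix _ _ ℂ) x (i (γ k))),
      idxAvg, ← mul_assoc ((N : ℂ) ^ S.card), ← ha, ← mul_assoc, Finset.mul_sum]
    refine Finset.sum_congr rfl fun j _ => ?_
    rw [Finset.prod_mul_distrib]
    simp only [Function.comp]
    ring
  have h2 : ∫ U : Matrix.unitaryGroup (Fin N) ℂ,
        traceOn S (fun k => M k * signPow (ε k) (U : Matrix _ _ ℂ)) γ ∂(haarU N) =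
      ∑ i : I → Fin N, ∑ j : I → Fin N, (a * a * ∏ k ∈ S, M k (i k) (j k)) *
        entryMoment ε S j (i ∘ γ) := by
    simp only [h1]
    have hc : ∀ i j : I → Fin N, Integrable (fun U : Matrix.unitaryGroup (Fin N) ℂ =>
        (a * a * ∏ k ∈ S, M k (i k) (j k)) *
        ∏ k ∈ S, signPow (ε k) (U : Matrix _ _ ℂ) (j k) ((i ∘ γ) k)) (haarU N) := fun i j =>
      (integrable_haarU (continuous_finsetProd _ fun k _ => continuous_signPow _ _ _)).const_mul _
    rw [integral_finsetSum _ fun i _ => integrable_finsetSum _ fun j _ => hc i j]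
    refine Finset.sum_congr rfl fun i _ => ?_
    rw [integral_finsetSum _ fun j _ => hc i j]
    refine Finset.sum_congr rfl fun j _ => ?_
    rw [integral_const_mul]
    rfl
  rw [h2]
  have h3 : HasSum (fun D : Walk ε S => ∑ i : I → Fin N, ∑ j : I → Fin N,
      (a * a * ∏ k ∈ S, M k (i k) (j k)) * (walkCoeff N ε S D.1.2 *
        if ∀ x ∈ S, j x = (i ∘ γ) (D.1.1 (walkPerm D.1.2 x)) then 1 else 0))
      (∑ i : I → Fin N, ∑ j : I → Fin N, (a * a * ∏ k ∈ S, M k (i k) (j k)) *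
        entryMoment ε S j (i ∘ γ)) :=
    hasSum_sum fun i _ => hasSum_sum fun j _ => ((hasSum_walk ε S hS).2 j (i ∘ γ)).mul_left _
  have h4 : ∀ D : Walk ε S, walkCoeff N ε S D.1.2 *
      traceOn S M (γ * (D.1.1 * walkPerm D.1.2)) = ∑ i : I → Fin N, ∑ j : I → Fin N,
      (a * a * ∏ k ∈ S, M k (i k) (j k)) * (walkCoeff N ε S D.1.2 *
        if ∀ x ∈ S, j x = (i ∘ γ) (D.1.1 (walkPerm D.1.2 x)) then 1 else 0) := by
    intro D
    rw [traceOn, idxAvg, ← mul_assoc ((N : ℂ) ^ S.card), ← ha, Finset.mul_sum, Finset.mul_sum]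
    refine Finset.sum_congr rfl fun i _ => ?_
    -- The second index of `M k` is freed by a Kronecker symbol, so that the sum over `j` reappears.
    have h5 : ∏ k ∈ S, M k (i k) (i ((γ * (D.1.1 * walkPerm D.1.2)) k)) =
        ∏ k ∈ S, ∑ x, (M k (i k) x *
          if x = (i ∘ γ) (D.1.1 (walkPerm D.1.2 k)) then 1 else 0) := by
      refine Finset.prod_congr rfl fun k _ => ?_
      simp
    rw [h5, ← idxAvg_prod S hN, idxAvg, ← mul_assoc ((N : ℂ) ^ S.card), ← ha, Finset.mul_sum,
      Finset.mul_sum, Finset.mul_sum]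
    refine Finset.sum_congr rfl fun j _ => ?_
    rw [Finset.prod_mul_distrib, Finset.prod_ite_zero]
    simp only [Finset.prod_const_one]
    ring
  simp only [h4]
  exact h3

/-- Any function of the permutation is bounded, as there are finitely many permutations; the
summability of the coefficients suffices. -/
theorem summable_norm_walk (ε : I → ℤˣ) (S : Finset I) (hS : S.card ≤ 2 * N)
    (F : Perm I → ℂ) (γ : Perm I) :
    Summable fun D : Walk ε S => ‖walkCoeff N ε S D.1.2 *
      F (γ * (D.1.1 * walkPerm D.1.2))‖ := by
  obtain ⟨C, hC⟩ : ∃ C, ∀ φ, ‖F φ‖ ≤ C := by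
    refine ⟨∑ φ, ‖F φ‖, fun φ => ?_⟩
    exact Finset.single_le_sum (f := fun φ => ‖F φ‖) (fun _ _ => norm_nonneg _)
      (Finset.mem_univ φ)
  refine Summable.of_nonneg_of_le (fun _ => norm_nonneg _) (fun D => ?_)
    ((hasSum_walk ε S hS).1.mul_right C)
  rw [norm_mul]
  exact mul_le_mul_of_nonneg_left (hC _) (norm_nonneg _)

end TraceMoment

/-! ### Moments and cumulants -/

section Cumulant

variable {K : Type*} [Fintype K] [DecidableEq K]

/-- The sum over the partitions of `s` of the products of the values of `c` on the blocks. -/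
noncomputable def partitionSum (c : Finset K → ℂ) (s : Finset K) : ℂ :=
  ∑ π : Finpartition s, ∏ B ∈ π.parts, c B

/-- A partition of `s` is the same as its block `B` containing `x` together with a partition of `s \
B`. -/
theorem partitionSum_recursion (c : Finset K → ℂ) {s : Finset K} {x : K} (hx : x ∈ s) :
    partitionSum c s = ∑ B : {B // B ⊆ s ∧ x ∈ B}, c B.1 * partitionSum c (s \ B.1) := by
  unfold partitionSum
  simp only [Finset.mul_sum]
  rw [← Fintype.sum_sigma' (fun (B : {B // B ⊆ s ∧ x ∈ B}) (π : Finpartition (s \ B.1)) =>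
    c B.1 * ∏ B ∈ π.parts, c B)]
  symm
  have hext : ∀ z : (Σ B : {B // B ⊆ s ∧ x ∈ B}, Finpartition (s \ B.1)),
      (s \ z.1.1) ⊔ z.1.1 = s := fun z => Finset.sdiff_union_of_subset z.1.2.1
  have hnot : ∀ z : (Σ B : {B // B ⊆ s ∧ x ∈ B}, Finpartition (s \ B.1)), z.1.1 ∉ z.2.parts := by
    intro z hz
    have := z.2.subset hz z.1.2.2
    exact (Finset.mem_sdiff.1 this).2 z.1.2.2
  refine Fintype.sum_bijective (fun z => z.2.extend (b := z.1.1)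
    (Finset.ne_empty_of_mem z.1.2.2) Finset.sdiff_disjoint (hext z)) ⟨?_, ?_⟩ _ _ ?_
  · rintro ⟨⟨B, hB⟩, π⟩ ⟨⟨B', hB'⟩, π'⟩ h
    have hp : insert B π.parts = insert B' π'.parts := congrArg Finpartition.parts h
    have hBB : B = B' := by
      have : B ∈ insert B' π'.parts := hp ▸ Finset.mem_insert_self _ _
      rcases Finset.mem_insert.1 this with h1 | h1
      · exact h1
      · exact absurd hB'.2 (Finset.mem_sdiff.1 (π'.subset h1 hB.2)).2
    subst hBB
    have hn1 := hnot ⟨⟨B, hB⟩, π⟩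
    have hn2 := hnot ⟨⟨B, hB⟩, π'⟩
    have : π = π' := by
      apply Finpartition.ext
      rw [← Finset.erase_insert hn1, hp, Finset.erase_insert hn2]
    subst this
    rfl
  · intro π
    refine ⟨⟨⟨π.part x, π.part_subset x, π.mem_part_self.2 hx⟩, π.avoid (π.part x)⟩, ?_⟩
    apply Finpartition.ext
    change insert (π.part x) (π.avoid (π.part x)).parts = π.parts
    have hpm : π.part x ∈ π.parts := π.part_mem.2 hx
    ext C
    rw [Finset.mem_insert, Finpartition.mem_avoid]
    constructor
    · rintro (rfl | ⟨d, hd, hne, rfl⟩)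
      · exact hpm
      · have hdn : d ≠ π.part x := fun e => hne e.le
        have : _root_.Disjoint d (π.part x) := π.disjoint hd hpm hdn
        rw [Finset.sdiff_eq_self_of_disjoint this]
        exact hd
    · intro hC
      by_cases h : C = π.part x
      · exact Or.inl h
      · have : _root_.Disjoint C (π.part x) := π.disjoint hC hpm h
        refine Or.inr ⟨C, hC, fun hle => ?_, Finset.sdiff_eq_self_of_disjoint this⟩
        exact π.ne_bot hC (le_bot_iff.1 (this le_rfl hle))
  · intro z
    change _ = ∏ B ∈ insert z.1.1 z.2.parts, c B
    rw [Finset.prod_insert (hnot z)]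

/-- The definition of the cumulant isolates the one-block partition; putting it back gives the sum
over all partitions. -/
theorem jointMoment_eq_partitionSum {Ω : Type*} [MeasurableSpace Ω] (μ : Measure Ω)
    [IsProbabilityMeasure μ] (X : K → Ω → ℂ) (s : Finset K) :
    jointMoment μ X s = partitionSum (jointCumulant μ X) s := by
  classical
  have hdef := jointCumulant.eq_1 μ X s
  have hsub : ∑ π : {π : Finpartition s // 2 ≤ π.parts.card},
      ∏ B : {B : Finset K // B ∈ π.1.parts}, jointCumulant μ X B.1 =
      ∑ π ∈ (Finset.univ : Finset (Finpartition s)).filter (fun π => 2 ≤ π.parts.card),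
        ∏ B ∈ π.parts, jointCumulant μ X B := by
    rw [← Finset.sum_subtype (p := fun π : Finpartition s => 2 ≤ π.parts.card)
      (F := inferInstance) (s := Finset.univ.filter (fun π : Finpartition s => 2 ≤ π.parts.card))
      (by simp) (f := fun π => ∏ B : {B : Finset K // B ∈ π.parts}, jointCumulant μ X B.1)]
    refine Finset.sum_congr rfl fun π _ => ?_
    exact Finset.prod_coe_sort π.parts (fun B => jointCumulant μ X B)
  rw [hsub] at hdef
  rw [partitionSum, ← Finset.sum_filter_add_sum_filter_not Finset.univ
    (fun π : Finpartition s => 2 ≤ π.parts.card)]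
  rcases s.eq_empty_or_nonempty with rfl | hs
  -- The empty set has a single partition, without blocks; both sides equal `1`, since the measure
  -- has mass one.
  · have h0 : ∀ π : Finpartition (∅ : Finset K), π.parts = ∅ := fun π =>
      π.parts_eq_empty_iff.2 rfl
    have : Unique (Finpartition (∅ : Finset K)) := inferInstanceAs (Unique (Finpartition ⊥))
    simp [h0, jointMoment]
  · have hsing : (Finset.univ.filter fun π : Finpartition s => ¬ 2 ≤ π.parts.card) =
        {Finpartition.indiscrete (Finset.nonempty_iff_ne_empty.1 hs)} := by
      ext π
      simp only [Finset.mem_filter, Finset.mem_univ, true_and, Finset.mem_singleton]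
      constructor
      · intro h
        have hne : 0 < π.parts.card :=
          Finset.card_pos.2 (π.parts_nonempty (Finset.nonempty_iff_ne_empty.1 hs))
        obtain ⟨C, hC⟩ := Finset.card_eq_one.1 (by omega : π.parts.card = 1)
        apply Finpartition.ext
        have hbu := π.biUnion_parts
        rw [hC, Finset.singleton_biUnion] at hbu
        rw [hC]
        change {C} = {s}
        rw [← hbu]; rfl
      · rintro rfl
        change ¬ 2 ≤ ({s} : Finset (Finset K)).card
        simp
    rw [hsing, Finset.sum_singleton]
    change _ = _ + ∏ B ∈ {s}, _
    rw [Finset.prod_singleton, hdef]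
    ring

/-- In the recursion for `s`, the term `B = s` is `c s · m ∅ = c s`, and all the other terms involve
smaller nonempty sets. The values on nonempty sets are thus determined by `m`. -/
theorem cumulant_unique {m c k : Finset K → ℂ} (hm : m ∅ = 1)
    (hc : ∀ s : Finset K, ∀ x ∈ s, m s = ∑ B : {B // B ⊆ s ∧ x ∈ B}, c B.1 * m (s \ B.1))
    (hk : ∀ s : Finset K, ∀ x ∈ s, m s = ∑ B : {B // B ⊆ s ∧ x ∈ B}, k B.1 * m (s \ B.1))
    (s : Finset K) (hs : s.Nonempty) : c s = k s := by
  induction s using Finset.strongInduction with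
  | H s ih =>
    obtain ⟨x, hx⟩ := hs
    have h := (hc s x hx).symm.trans (hk s x hx)
    have hsx : (⟨s, le_rfl, hx⟩ : {B // B ⊆ s ∧ x ∈ B}) ∈ Finset.univ := Finset.mem_univ _
    rw [← Finset.add_sum_erase _ _ hsx, ← Finset.add_sum_erase _ _ hsx] at h
    simp only [Finset.sdiff_self, hm, mul_one] at h
    have he : ∑ B ∈ Finset.univ.erase (⟨s, le_rfl, hx⟩ : {B // B ⊆ s ∧ x ∈ B}),
        c B.1 * m (s \ B.1) =
        ∑ B ∈ Finset.univ.erase (⟨s, le_rfl, hx⟩ : {B // B ⊆ s ∧ x ∈ B}),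
        k B.1 * m (s \ B.1) := by
      refine Finset.sum_congr rfl fun B hB => ?_
      rw [ih B.1 (lt_of_le_of_ne B.2.1 fun e => Finset.ne_of_mem_erase hB (Subtype.ext e))
        ⟨x, B.2.2⟩]
    rw [he] at h
    exact add_right_cancel h

end Cumulant

/-! ### Decomposition of walks into connected components -/

section Components

variable {I : Type*} [Fintype I] [LinearOrder I]

/-- Points of `T` stay in `T` under the transpositions inside `T`, and are fixed by the
transpositions outside `T`. Dropping the latter changes nothing on `T`, whatever the interleaving.
-/
theorem walkPerm_restrict {L L' : I → List I} (T : I → Prop)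
    (h : ∀ b, (L b = L' b ∧ ∀ a ∈ L b, T a ∧ T b) ∨ (L' b = [] ∧ ∀ a ∈ L b, ¬ T a ∧ ¬ T b))
    {k : I} (hk : T k) : walkPerm L k = walkPerm L' k := by
  unfold walkPerm walkWord
  induction (Finset.univ : Finset I).sort (· ≤ ·) with
  | nil => rfl
  | cons b l ih =>
    rw [List.flatMap_cons, List.flatMap_cons, swapProd_append, swapProd_append, Perm.mul_apply,
      Perm.mul_apply, ih]
    rcases h b with ⟨h1, -⟩ | ⟨h1, h2⟩
    · rw [h1]
    · rw [h1]
      have hT : T (swapProd (l.flatMap fun b => (L' b).map fun a => (a, b)) k) := by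
        refine (swapProd_invariant _ T (fun z hz => ?_) k).2 hk
        obtain ⟨b', -, hb'⟩ := List.mem_flatMap.1 hz
        obtain ⟨a, ha, rfl⟩ := List.mem_map.1 hb'
        rcases h b' with ⟨h3, h4⟩ | ⟨h3, h4⟩
        · rw [h3] at h4
          exact iff_of_true (h4 a ha).1 (h4 a ha).2
        · rw [h3] at ha
          simp at ha
      rw [swapProd_apply_of_notMem]
      · simp [swapProd]
      · intro z hz
        obtain ⟨a, ha, rfl⟩ := List.mem_map.1 hz
        exact ⟨fun e => (h2 a ha).1 ((congrArg T e).mp hT),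
          fun e => (h2 a ha).2 ((congrArg T e).mp hT)⟩

variable {K : Type*} [Fintype K] [DecidableEq K] (bl : I → K)

/-- The elements of the blocks in `s`. -/
abbrev blockSet (s : Finset K) : Finset I := Finset.univ.filter fun k => bl k ∈ s

theorem mem_blockSet {s : Finset K} {k : I} : k ∈ blockSet bl s ↔ bl k ∈ s := by simp

/-- A set of blocks is closed if it is not linked to its complement. -/
def IsClosedFor (D : Perm I × (I → List I)) (B : Finset K) : Prop :=
  (∀ k, bl (D.1 k) ∈ B ↔ bl k ∈ B) ∧ ∀ b, ∀ a ∈ D.2 b, bl a ∈ B ↔ bl b ∈ B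

/-- A walk is connected if it links all the blocks. -/
def IsConnectedFor (D : Perm I × (I → List I)) (s : Finset K) : Prop :=
  ∀ B ⊆ s, IsClosedFor bl D B → B = ∅ ∨ B = s

/-- Juxtaposition of two walks. -/
def glueWalk (D E : Perm I × (I → List I)) : Perm I × (I → List I) :=
  (D.1 * E.1, fun b => D.2 b ++ E.2 b)

/-! ### Juxtaposition of walks on disjoint sets of blocks -/

section Glue

variable {bl} {ε : I → ℤˣ} {B C : Finset K} {D E : Perm I × (I → List I)}

theorem glue_apply_left (hd : Disjoint B C)
    (hE : IsWalk ε (blockSet bl C) E) {k : I} (hk : bl k ∈ B) : (glueWalk D E).1 k = D.1 k := by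
  have : k ∉ blockSet bl C := fun h =>
    Finset.disjoint_left.1 hd hk ((mem_blockSet bl).1 h)
  rw [glueWalk, Perm.mul_apply, hE.fix k this]

theorem glue_apply_right (hd : Disjoint B C) (hD : IsWalk ε (blockSet bl B) D)
    (hE : IsWalk ε (blockSet bl C) E) {k : I} (hk : bl k ∈ C) : (glueWalk D E).1 k = E.1 k := by
  have h1 := hE.apply_mem ((mem_blockSet bl).2 hk)
  rw [glueWalk, Perm.mul_apply]
  exact hD.fix _ fun h => Finset.disjoint_left.1 hd ((mem_blockSet bl).1 h)
    ((mem_blockSet bl).1 h1)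

theorem glue_apply_of_notMem (hD : IsWalk ε (blockSet bl B) D)
    (hE : IsWalk ε (blockSet bl C) E) {k : I} (hB : bl k ∉ B) (hC : bl k ∉ C) :
    (glueWalk D E).1 k = k := by
  rw [glueWalk, Perm.mul_apply, hE.fix k (by simpa using hC), hD.fix k (by simpa using hB)]

theorem glue_list_left (hd : Disjoint B C)
    (hE : IsWalk ε (blockSet bl C) E) {b : I} (hb : bl b ∈ B) : (glueWalk D E).2 b = D.2 b := by
  have : E.2 b = [] := hE.eq_nil fun h =>
    Finset.disjoint_left.1 hd hb ((mem_blockSet bl).1 h.1)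
  simp [glueWalk, this]

theorem glue_list_of_notMem (hD : IsWalk ε (blockSet bl B) D) {b : I} (hb : bl b ∉ B) :
    (glueWalk D E).2 b = E.2 b := by
  have : D.2 b = [] := hD.eq_nil fun h => hb ((mem_blockSet bl).1 h.1)
  simp [glueWalk, this]

theorem isWalk_glue (hd : Disjoint B C) (hD : IsWalk ε (blockSet bl B) D)
    (hE : IsWalk ε (blockSet bl C) E) : IsWalk ε (blockSet bl (B ∪ C)) (glueWalk D E) := by
  have mB : ∀ {k}, bl k ∈ B → bl (D.1 k) ∈ B := fun hk =>
    (mem_blockSet bl).1 (hD.apply_mem ((mem_blockSet bl).2 hk))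
  have mC : ∀ {k}, bl k ∈ C → bl (E.1 k) ∈ C := fun hk =>
    (mem_blockSet bl).1 (hE.apply_mem ((mem_blockSet bl).2 hk))
  refine ⟨fun k => ?_, fun k hk => ?_, fun k hk => ?_, fun b a ha => ?_⟩
  · by_cases h1 : bl k ∈ B
    · rw [glue_apply_left hd hE h1, glue_apply_left hd hE (mB h1), hD.invol]
    · by_cases h2 : bl k ∈ C
      · rw [glue_apply_right hd hD hE h2, glue_apply_right hd hD hE (mC h2), hE.invol]
      · rw [glue_apply_of_notMem hD hE h1 h2, glue_apply_of_notMem hD hE h1 h2]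
  · simp only [mem_blockSet, Finset.mem_union, not_or] at hk
    exact glue_apply_of_notMem hD hE hk.1 hk.2
  · simp only [mem_blockSet, Finset.mem_union] at hk
    rcases hk with h1 | h1
    · rw [glue_apply_left hd hE h1]
      exact hD.sign k (by simpa using h1)
    · rw [glue_apply_right hd hD hE h1]
      exact hE.sign k (by simpa using h1)
  · simp only [mem_blockSet, Finset.mem_union]
    rcases List.mem_append.1 ha with h | h
    · have := hD.mem b a h
      simp only [mem_blockSet] at this
      exact ⟨this.1, Or.inl this.2.1, Or.inl this.2.2.1, this.2.2.2⟩
    · have := hE.mem b a h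
      simp only [mem_blockSet] at this
      exact ⟨this.1, Or.inr this.2.1, Or.inr this.2.2.1, this.2.2.2⟩

theorem glue_walkPerm_left (hd : Disjoint B C) (hD : IsWalk ε (blockSet bl B) D)
    (hE : IsWalk ε (blockSet bl C) E) {k : I} (hk : bl k ∈ B) :
    walkPerm (glueWalk D E).2 k = walkPerm D.2 k := by
  refine walkPerm_restrict (fun x => bl x ∈ B) (fun b => ?_) hk
  by_cases hb : bl b ∈ B
  · refine Or.inl ⟨glue_list_left hd hE hb, fun a ha => ?_⟩
    rw [glue_list_left hd hE hb] at ha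
    exact ⟨(mem_blockSet bl).1 (hD.mem b a ha).2.1, hb⟩
  · refine Or.inr ⟨hD.eq_nil fun h => hb ((mem_blockSet bl).1 h.1), fun a ha => ?_⟩
    rw [glue_list_of_notMem hD hb] at ha
    exact ⟨fun h => Finset.disjoint_left.1 hd h ((mem_blockSet bl).1 (hE.mem b a ha).2.1), hb⟩

theorem glue_walkPerm_right (hd : Disjoint B C) (hD : IsWalk ε (blockSet bl B) D)
    (hE : IsWalk ε (blockSet bl C) E) {k : I} (hk : bl k ∈ C) :
    walkPerm (glueWalk D E).2 k = walkPerm E.2 k := by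
  refine walkPerm_restrict (fun x => bl x ∈ C) (fun b => ?_) hk
  by_cases hb : bl b ∈ B
  · have hbC : bl b ∉ C := Finset.disjoint_left.1 hd hb
    refine Or.inr ⟨hE.eq_nil fun h => hbC ((mem_blockSet bl).1 h.1), fun a ha => ?_⟩
    rw [glue_list_left hd hE hb] at ha
    exact ⟨Finset.disjoint_left.1 hd ((mem_blockSet bl).1 (hD.mem b a ha).2.1), hbC⟩
  · refine Or.inl ⟨glue_list_of_notMem hD hb, fun a ha => ?_⟩
    rw [glue_list_of_notMem hD hb] at ha
    have := hE.mem b a ha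
    exact ⟨(mem_blockSet bl).1 this.2.1, (mem_blockSet bl).1 this.2.2.1⟩

theorem isClosedFor_glue (hd : Disjoint B C) (hD : IsWalk ε (blockSet bl B) D)
    (hE : IsWalk ε (blockSet bl C) E) : IsClosedFor bl (glueWalk D E) B := by
  have key : ∀ k, bl k ∈ B → bl ((glueWalk D E).1 k) ∈ B := fun k hk => by
    rw [glue_apply_left hd hE hk]
    exact (mem_blockSet bl).1 (hD.apply_mem ((mem_blockSet bl).2 hk))
  refine ⟨fun k => ⟨fun h => ?_, key k⟩, fun b a ha => ?_⟩
  · have := key _ h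
    rwa [(isWalk_glue hd hD hE).invol] at this
  · rcases List.mem_append.1 ha with h | h
    · have := hD.mem b a h
      exact iff_of_true ((mem_blockSet bl).1 this.2.1) ((mem_blockSet bl).1 this.2.2.1)
    · have := hE.mem b a h
      exact iff_of_false
        (fun h => Finset.disjoint_left.1 hd h ((mem_blockSet bl).1 this.2.1))
        (fun h => Finset.disjoint_left.1 hd h ((mem_blockSet bl).1 this.2.2.1))

/-- The second walk lives on blocks disjoint from `B`, hence from `A`, and imposes no condition on
`A`. -/
theorem isClosedFor_glue_iff (hd : Disjoint B C) (hD : IsWalk ε (blockSet bl B) D)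
    (hE : IsWalk ε (blockSet bl C) E) {A : Finset K} (hA : A ⊆ B) :
    IsClosedFor bl (glueWalk D E) A ↔ IsClosedFor bl D A := by
  have hB := isClosedFor_glue hd hD hE
  constructor
  · rintro ⟨h1, h2⟩
    refine ⟨fun k => ?_, fun b a ha => h2 b a (List.mem_append_left _ ha)⟩
    by_cases hk : bl k ∈ B
    · rw [← glue_apply_left hd hE hk, h1]
    · rw [hD.fix k (by simpa using hk)]
  · rintro ⟨h1, h2⟩
    refine ⟨fun k => ?_, fun b a ha => ?_⟩
    · by_cases hk : bl k ∈ B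
      · rw [glue_apply_left hd hE hk, h1]
      · exact iff_of_false (fun h => hk ((hB.1 k).1 (hA h))) fun h => hk (hA h)
    · rcases List.mem_append.1 ha with h | h
      · exact h2 b a h
      · have := hE.mem b a h
        exact iff_of_false
          (fun h => Finset.disjoint_left.1 hd (hA h) ((mem_blockSet bl).1 this.2.1))
          (fun h => Finset.disjoint_left.1 hd (hA h) ((mem_blockSet bl).1 this.2.2.1))

theorem IsClosedFor.inter {A : Finset K} (hA : IsClosedFor bl D A) (hB : IsClosedFor bl D B) :
    IsClosedFor bl D (A ∩ B) := by
  refine ⟨fun k => ?_, fun b a ha => ?_⟩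
  · rw [Finset.mem_inter, Finset.mem_inter, hA.1, hB.1]
  · rw [Finset.mem_inter, Finset.mem_inter, hA.2 b a ha, hB.2 b a ha]

theorem IsClosedFor.sdiff {A : Finset K} (hA : IsClosedFor bl D A) (hB : IsClosedFor bl D B) :
    IsClosedFor bl D (A \ B) := by
  refine ⟨fun k => ?_, fun b a ha => ?_⟩
  · rw [Finset.mem_sdiff, Finset.mem_sdiff, hA.1, hB.1]
  · rw [Finset.mem_sdiff, Finset.mem_sdiff, hA.2 b a ha, hB.2 b a ha]

/-- Restriction of a walk to a closed set of blocks. -/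
def restrictWalk (hinv : ∀ k, D.1 (D.1 k) = k) (hB : IsClosedFor bl D B) :
    Perm I × (I → List I) :=
  (Function.Involutive.toPerm (fun k => if bl k ∈ B then D.1 k else k) (fun k => by
    by_cases hk : bl k ∈ B
    · simp only [hk, if_true, (hB.1 k).2 hk, hinv]
    · simp only [hk, if_false]), fun b => if bl b ∈ B then D.2 b else [])

theorem isWalk_restrict {s : Finset K} (hD : IsWalk ε (blockSet bl s) D) (hBs : B ⊆ s)
    (hB : IsClosedFor bl D B) : IsWalk ε (blockSet bl B) (restrictWalk hD.invol hB) := by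
  have happ : ∀ k, (restrictWalk hD.invol hB).1 k = if bl k ∈ B then D.1 k else k := fun k => rfl
  refine ⟨fun k => ?_, fun k hk => ?_, fun k hk => ?_, fun b a ha => ?_⟩
  · rw [happ, happ]
    by_cases hk : bl k ∈ B
    · simp only [hk, if_true, (hB.1 k).2 hk, hD.invol]
    · simp only [hk, if_false]
  · rw [happ, if_neg (by simpa using hk)]
  · rw [mem_blockSet] at hk
    rw [happ, if_pos hk]
    exact hD.sign k (by simpa using hBs hk)
  · simp only [restrictWalk] at ha
    split_ifs at ha with hb
    · have := hD.mem b a ha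
      refine ⟨this.1, ?_, by simpa using hb, this.2.2.2⟩
      simpa using (hB.2 b a ha).2 hb
    · simp at ha

end Glue

variable {bl} in
/-- A walk on `s` is uniquely the juxtaposition of a connected walk on the blocks linked to `x`
and of a walk on the other blocks. -/
theorem glue_bijective {ε : I → ℤˣ} {s : Finset K} {x : K} (hx : x ∈ s) :
    Function.Bijective (fun z : (Σ B : {B // B ⊆ s ∧ x ∈ B},
      {D : Walk ε (blockSet bl B.1) // IsConnectedFor bl D.1 B.1} ×
        Walk ε (blockSet bl (s \ B.1))) =>
      (⟨glueWalk z.2.1.1.1 z.2.2.1, by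
        have := isWalk_glue Finset.disjoint_sdiff z.2.1.1.2 z.2.2.2
        rwa [Finset.union_sdiff_of_subset z.1.2.1] at this⟩ : Walk ε (blockSet bl s))) := by
  classical
  constructor
  · rintro ⟨⟨B, hB⟩, ⟨⟨D, hD⟩, hc⟩, ⟨E, hE⟩⟩ ⟨⟨B', hB'⟩, ⟨⟨D', hD'⟩, hc'⟩, ⟨E', hE'⟩⟩ h
    have hg : glueWalk D E = glueWalk D' E' := congrArg Subtype.val h
    have hd : Disjoint B (s \ B) := Finset.disjoint_sdiff
    have hd' : Disjoint B' (s \ B') := Finset.disjoint_sdiff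
    have c1 := isClosedFor_glue hd hD hE
    have c2 := isClosedFor_glue hd' hD' hE'
    rw [← hg] at c2
    -- The intersection is closed for the common glued walk and contains `x`. Connectedness of each
    -- of the two components forces it to be equal to both.
    have c3 := c1.inter c2
    have hne : B ∩ B' ≠ ∅ := Finset.ne_empty_of_mem (Finset.mem_inter.2 ⟨hB.2, hB'.2⟩)
    have h1 : B ∩ B' = B := (hc _ Finset.inter_subset_left
      ((isClosedFor_glue_iff hd hD hE Finset.inter_subset_left).1 c3)).resolve_left hne
    rw [hg] at c3
    have h2 : B ∩ B' = B' := (hc' _ Finset.inter_subset_right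
      ((isClosedFor_glue_iff hd' hD' hE' Finset.inter_subset_right).1 c3)).resolve_left hne
    have hBB : B = B' := h1.symm.trans h2
    subst hBB
    have hDD : D = D' := by
      refine Prod.ext ?_ ?_
      · ext k
        by_cases hk : bl k ∈ B
        · rw [← glue_apply_left (D := D) hd hE hk, hg, glue_apply_left hd hE' hk]
        · rw [hD.fix k (by simpa using hk), hD'.fix k (by simpa using hk)]
      · funext b
        by_cases hk : bl b ∈ B
        · rw [← glue_list_left (D := D) hd hE hk, hg, glue_list_left hd hE' hk]
        · rw [hD.eq_nil fun h => hk ((mem_blockSet bl).1 h.1),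
            hD'.eq_nil fun h => hk ((mem_blockSet bl).1 h.1)]
    subst hDD
    have hEE : E = E' := by
      have h3 := congrArg Prod.fst hg
      have h4 := congrArg Prod.snd hg
      refine Prod.ext (mul_left_cancel h3) ?_
      funext b
      exact List.append_cancel_left (congrFun h4 b)
    subst hEE
    rfl
  · rintro ⟨D, hD⟩
    -- The component of `x` is the smallest closed set containing `x`.
    set B : Finset K := s.filter fun y => ∀ A ⊆ s, IsClosedFor bl D A → x ∈ A → y ∈ A with hBdef
    have hBs : B ⊆ s := Finset.filter_subset _ _
    have hxB : x ∈ B := Finset.mem_filter.2 ⟨hx, fun A _ _ h => h⟩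
    have hs : IsClosedFor bl D s := by
      refine ⟨fun k => ?_, fun b a ha => ?_⟩
      · have key : ∀ k, bl k ∈ s → bl (D.1 k) ∈ s := fun k hk =>
          (mem_blockSet bl).1 (hD.apply_mem ((mem_blockSet bl).2 hk))
        exact ⟨fun h => by have := key _ h; rwa [hD.invol] at this, key k⟩
      · have := hD.mem b a ha
        exact iff_of_true ((mem_blockSet bl).1 this.2.1) ((mem_blockSet bl).1 this.2.2.1)
    have hB : IsClosedFor bl D B := by
      refine ⟨fun k => ?_, fun b a ha => ?_⟩
      · simp only [hBdef, Finset.mem_filter, hs.1 k]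
        exact and_congr_right fun _ => forall_congr' fun A => forall_congr' fun _ =>
          forall_congr' fun hA => forall_congr' fun _ => hA.1 k
      · simp only [hBdef, Finset.mem_filter, hs.2 b a ha]
        exact and_congr_right fun _ => forall_congr' fun A => forall_congr' fun _ =>
          forall_congr' fun hA => forall_congr' fun _ => hA.2 b a ha
    have hmin : ∀ A ⊆ s, IsClosedFor bl D A → x ∈ A → B ⊆ A := fun A h1 h2 h3 y hy =>
      (Finset.mem_filter.1 hy).2 A h1 h2 h3
    have hC : IsClosedFor bl D (s \ B) := hs.sdiff hB
    have hw1 := isWalk_restrict hD hBs hB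
    have hw2 := isWalk_restrict hD Finset.sdiff_subset hC
    have hd : Disjoint B (s \ B) := Finset.disjoint_sdiff
    have hglue : glueWalk (restrictWalk hD.invol hB) (restrictWalk hD.invol hC) = D := by
      refine Prod.ext ?_ ?_
      · ext k
        by_cases h1 : bl k ∈ B
        · rw [glue_apply_left hd hw2 h1]
          change (if bl k ∈ B then D.1 k else k) = _
          rw [if_pos h1]
        · by_cases h2 : bl k ∈ s
          · have h3 : bl k ∈ s \ B := Finset.mem_sdiff.2 ⟨h2, h1⟩
            rw [glue_apply_right hd hw1 hw2 h3]
            change (if bl k ∈ s \ B then D.1 k else k) = _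
            rw [if_pos h3]
          · rw [glue_apply_of_notMem hw1 hw2 h1 fun h => h2 (Finset.mem_sdiff.1 h).1,
              hD.fix k (by simpa using h2)]
      · funext b
        by_cases h1 : bl b ∈ B
        · rw [glue_list_left hd hw2 h1]
          simp [restrictWalk, h1]
        · rw [glue_list_of_notMem hw1 h1]
          by_cases h2 : bl b ∈ s
          · simp [restrictWalk, h1, h2]
          · rw [hD.eq_nil fun h => h2 ((mem_blockSet bl).1 h.1)]
            simp [restrictWalk, h2]
    refine ⟨⟨⟨B, hBs, hxB⟩, ⟨⟨_, hw1⟩, fun A hA hAc => ?_⟩, ⟨_, hw2⟩⟩, Subtype.ext hglue⟩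
    have hAD : IsClosedFor bl D A := by
      rw [← hglue]
      exact (isClosedFor_glue_iff hd hw1 hw2 hA).2 hAc
    by_cases hxA : x ∈ A
    · exact Or.inr (le_antisymm hA (hmin A (hA.trans hBs) hAD hxA))
    · left
      -- If `A` omits `x`, then `B \ A` is closed and contains `x`; by minimality it is all of `B`,
      -- so `A` is empty.
      have h5 := hmin (B \ A) (Finset.sdiff_subset.trans hBs) (hB.sdiff hAD)
        (Finset.mem_sdiff.2 ⟨hxB, hxA⟩)
      rw [Finset.eq_empty_iff_forall_notMem]
      intro y hy
      exact (Finset.mem_sdiff.1 (h5 (hA hy))).2 hy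

/-- The contribution of a walk on the blocks in `s`. -/
noncomputable def walkWeight {N : ℕ} (ε : I → ℤˣ) (M : I → Matrix (Fin N) (Fin N) ℂ) (γ : Perm I)
    (s : Finset K) (D : Perm I × (I → List I)) : ℂ :=
  walkCoeff N ε (blockSet bl s) D.2 * traceOn (blockSet bl s) M (γ * (D.1 * walkPerm D.2))

variable {bl} in
-- Numbers of signs and of transpositions add up, and the permutation `γ α τ` preserves each of the
-- two sets of blocks, on which it is the one of the corresponding walk. The traces then factor by
-- `traceOn_union`.
theorem walkWeight_glue {N : ℕ} (hN : N ≠ 0) {ε : I → ℤˣ} {B C s : Finset K}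
    {D E : Perm I × (I → List I)} (M : I → Matrix (Fin N) (Fin N) ℂ) {γ : Perm I}
    (hγ : ∀ k, bl (γ k) = bl k) (hd : Disjoint B C) (hs : B ∪ C = s)
    (hD : IsWalk ε (blockSet bl B) D) (hE : IsWalk ε (blockSet bl C) E) :
    walkWeight bl ε M γ s (glueWalk D E) =
      walkWeight bl ε M γ B D * walkWeight bl ε M γ C E := by
  subst hs
  have hS : blockSet bl (B ∪ C) = blockSet bl B ∪ blockSet bl C := by
    ext k; simp [Finset.mem_union]
  have hdS : Disjoint (blockSet bl B) (blockSet bl C) := by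
    rw [Finset.disjoint_left]
    intro k h1 h2
    exact Finset.disjoint_left.1 hd ((mem_blockSet bl).1 h1) ((mem_blockSet bl).1 h2)
  have hpB : ∀ k ∈ blockSet bl B, (γ * (D.1 * walkPerm D.2)) k ∈ blockSet bl B := by
    intro k hk
    rw [Perm.mul_apply, Perm.mul_apply, mem_blockSet, hγ, ← mem_blockSet]
    exact hD.apply_mem ((hD.perm_mem_iff k).2 hk)
  have hpC : ∀ k ∈ blockSet bl C, (γ * (E.1 * walkPerm E.2)) k ∈ blockSet bl C := by
    intro k hk
    rw [Perm.mul_apply, Perm.mul_apply, mem_blockSet, hγ, ← mem_blockSet]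
    exact hE.apply_mem ((hE.perm_mem_iff k).2 hk)
  have heB : ∀ k ∈ blockSet bl B, (γ * ((glueWalk D E).1 * walkPerm (glueWalk D E).2)) k =
      (γ * (D.1 * walkPerm D.2)) k := by
    intro k hk
    have h1 := (mem_blockSet bl).1 ((hD.perm_mem_iff k).2 hk)
    simp only [Perm.mul_apply]
    rw [glue_walkPerm_left hd hD hE ((mem_blockSet bl).1 hk), glue_apply_left hd hE h1]
  have heC : ∀ k ∈ blockSet bl C, (γ * ((glueWalk D E).1 * walkPerm (glueWalk D E).2)) k =
      (γ * (E.1 * walkPerm E.2)) k := by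
    intro k hk
    have h1 := (mem_blockSet bl).1 ((hE.perm_mem_iff k).2 hk)
    simp only [Perm.mul_apply]
    rw [glue_walkPerm_right hd hD hE ((mem_blockSet bl).1 hk), glue_apply_right hd hD hE h1]
  unfold walkWeight
  rw [hS, traceOn_union hN hdS]
  · rw [traceOn_congr heB fun _ _ => rfl, traceOn_congr heC fun _ _ => rfl]
    have hlen : walkLength (glueWalk D E).2 = walkLength D.2 + walkLength E.2 := by
      simp [walkLength, glueWalk, Finset.sum_add_distrib]
    have hcard : (outs ε (blockSet bl B ∪ blockSet bl C)).card =
        (outs ε (blockSet bl B)).card + (outs ε (blockSet bl C)).card := by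
      rw [outs, Finset.filter_union, Finset.card_union_of_disjoint]
      exact Finset.disjoint_filter_filter hdS
    unfold walkCoeff
    rw [hlen, hcard]
    ring
  · intro k hk
    rw [heB k hk]
    exact hpB k hk
  · intro k hk
    rw [heC k hk]
    exact hpC k hk

/-- The moment–cumulant recursion at the level of walks: a walk is split into the component `B` of
`x` and the rest, and the weights multiply. Absolute convergence justifies the rearrangement. -/
theorem walk_recursion {N : ℕ} (hN : N ≠ 0) {ε : I → ℤˣ} (hI : Fintype.card I ≤ 2 * N)
    (M : I → Matrix (Fin N) (Fin N) ℂ) {γ : Perm I} (hγ : ∀ k, bl (γ k) = bl k)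
    {s : Finset K} {x : K} (hx : x ∈ s) :
    ∑' D : Walk ε (blockSet bl s), walkWeight bl ε M γ s D.1 =
    ∑ B : {B // B ⊆ s ∧ x ∈ B},
      (∑' D : {D : Walk ε (blockSet bl B.1) // IsConnectedFor bl D.1 B.1},
        walkWeight bl ε M γ B.1 D.1.1) *
      ∑' D : Walk ε (blockSet bl (s \ B.1)), walkWeight bl ε M γ (s \ B.1) D.1 := by
  have hsum : ∀ s : Finset K, Summable fun D : Walk ε (blockSet bl s) =>
      ‖walkWeight bl ε M γ s D.1‖ := fun s =>
    summable_norm_walk ε (blockSet bl s) ((Finset.card_le_univ _).trans hI)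
      (fun φ => traceOn (blockSet bl s) M φ) γ
  have hb := glue_bijective (bl := bl) (ε := ε) hx
  rw [← (Equiv.ofBijective _ hb).tsum_eq, Summable.tsum_sigma]
  · rw [tsum_fintype]
    refine Finset.sum_congr rfl fun B _ => ?_
    rw [tsum_mul_tsum_of_summable_norm
      ((hsum B.1).comp_injective Subtype.val_injective) (hsum (s \ B.1))]
    refine tsum_congr fun z => ?_
    exact walkWeight_glue hN M hγ Finset.disjoint_sdiff
      (Finset.union_sdiff_of_subset B.2.1) z.1.1.2 z.2.2
  · exact (Equiv.ofBijective _ hb).summable_iff.2 (hsum s).of_norm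

end Components

end

section

open Equiv Equiv.Perm

/-! ### Structure of the maps of unitary type -/

namespace UnitaryMap

variable {I : Type*} {r : ℕ} {H : Type*} (C : UnitaryMap I r H)

/-- White half-edges have time `0`, the half-edges at the black vertex `k` have time `k + 1`. -/
def time (h : H) : ℕ := (C.vertex h).elim 0 fun k => k + 1

theorem time_of_vertex {h : H} {k : Fin r} (hk : C.vertex h = some k) : C.time h = k + 1 := by
  simp [time, hk]

theorem time_eq_zero_iff {h : H} : C.time h = 0 ↔ C.White h := by
  unfold time White
  cases C.vertex h <;> simp

theorem time_le (h : H) : C.time h ≤ r := by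
  unfold time
  cases C.vertex h with
  | none => simp
  | some k => exact k.2

theorem exists_vertex {h : H} (hb : ¬ C.White h) : ∃ k, C.vertex h = some k :=
  Option.ne_none_iff_exists'.1 hb

theorem time_eq_of_vertex_eq {h h' : H} (hv : C.vertex h = C.vertex h') :
    C.time h = C.time h' := by
  unfold time; rw [hv]

theorem time_σ (h : H) : C.time (C.σ h) = C.time h := C.time_eq_of_vertex_eq (C.vertex_σ h)

theorem σ_σ_inv (h : H) : C.σ (C.σ⁻¹ h) = h := by simp

theorem vertex_σ_inv (h : H) : C.vertex (C.σ⁻¹ h) = C.vertex h := by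
  rw [← C.vertex_σ (C.σ⁻¹ h)]; simp

theorem white_σ {h : H} : C.White (C.σ h) ↔ C.White h := by
  unfold White; rw [C.vertex_σ]

theorem white_σ_inv {h : H} : C.White (C.σ⁻¹ h) ↔ C.White h := by
  unfold White; rw [C.vertex_σ_inv]

theorem φ_apply (h : H) : C.φ h = C.σ⁻¹ (C.α h) := by
  have : C.α⁻¹ h = C.α h := by rw [Perm.inv_eq_iff_eq, C.α_α]
  rw [OrientedMap.φ, Perm.mul_apply, this]

theorem φ_inv_apply (h : H) : (C.φ⁻¹ : Perm H) h = C.α (C.σ h) := by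
  simp [OrientedMap.φ]

theorem φ_prev (h : H) : C.φ (C.α (C.σ h)) = h := by
  rw [C.φ_apply, C.α_α]; simp

theorem orient_σ_inv {h : H} (hb : ¬ C.White h) : C.orient (C.σ⁻¹ h) = -C.orient h := by
  have := C.black_alternated (C.σ⁻¹ h) (by rwa [C.vertex_σ_inv])
  rw [C.σ_σ_inv] at this
  rw [this, neg_neg]

theorem orient_prev {h : H} (ho : C.orient h = 1) (hb : ¬ C.White h) :
    C.orient (C.α (C.σ h)) = 1 := by
  rw [C.orient_α, C.black_alternated h hb, ho, neg_neg]

/-- The half-edge `α (σ h)` precedes `h` around the face, and its edge ends at the vertex of `h`.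
Edges between black vertices increase the numbers, and white half-edges have time `0`. -/
theorem time_prev {h : H} (ho : C.orient h = 1) (hb : ¬ C.White h) :
    C.time (C.α (C.σ h)) < C.time h := by
  obtain ⟨k, hk⟩ := C.exists_vertex hb
  rw [C.time_of_vertex hk]
  by_cases hw : C.White (C.α (C.σ h))
  · rw [C.time_eq_zero_iff.2 hw]; omega
  · obtain ⟨k', hk'⟩ := C.exists_vertex hw
    rw [C.time_of_vertex hk']
    have := C.black_increasing _ k' k (C.orient_prev ho hb) hk' (by rw [C.α_α, C.vertex_σ, hk])
    have : (k' : ℕ) < k := this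
    omega

theorem label_labelOf {h : H} (hw : C.White h) : (C.label (C.labelOf h) : H) = h := by
  classical
  have : Nat.find (C.exists_white h) = 0 := by
    rw [Nat.find_eq_zero]; exact hw
  simp only [labelOf, Equiv.apply_symm_apply]
  convert rfl
  rw [this]
  rfl

theorem labelOf_label (i : I) : C.labelOf (C.label i) = i :=
  C.label.injective (Subtype.ext (C.label_labelOf (C.label i).2))

theorem labelOf_prev {h : H} (hb : ¬ C.White h) : C.labelOf (C.α (C.σ h)) = C.labelOf h := by
  classical
  apply C.label.injective
  apply Subtype.ext
  simp only [labelOf, Equiv.apply_symm_apply]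
  have hex : ∃ j : ℕ, C.White ((C.φ⁻¹ : Perm H)^[j + 1] h) := by
    obtain ⟨j, hj⟩ := C.exists_white (C.α (C.σ h))
    exact ⟨j, by rwa [Function.iterate_succ_apply, C.φ_inv_apply]⟩
  have h1 := Nat.find_comp_succ (C.exists_white h) hex hb
  have h2 : Nat.find (C.exists_white (C.α (C.σ h))) = Nat.find hex := by
    apply Nat.find_congr'
    intro n
    rw [Function.iterate_succ_apply, C.φ_inv_apply]
  have e1 : (C.φ⁻¹ : Perm H)^[Nat.find (C.exists_white (C.α (C.σ h)))] (C.α (C.σ h)) =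
      (C.φ⁻¹ : Perm H)^[Nat.find (C.exists_white h)] h := by
    rw [h1, h2, Function.iterate_succ_apply, C.φ_inv_apply]
  convert e1

/-- The outgoing half-edges with a given label form a chain, along which the time increases. -/
theorem exists_chain {h : H} (ho : C.orient h = 1) : ∃ j : ℕ,
    C.φ^[j] (C.label (C.labelOf h)) = h ∧
    (∀ i ≤ j, C.orient (C.φ^[i] (C.label (C.labelOf h))) = 1) ∧
    ∀ i < j, C.time (C.φ^[i] (C.label (C.labelOf h))) <
      C.time (C.φ^[i + 1] (C.label (C.labelOf h))) := by
  induction hn : C.time h using Nat.strong_induction_on generalizing h with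
  | _ n ih =>
  by_cases hw : C.White h
  · refine ⟨0, C.label_labelOf hw, fun i hi => ?_, by simp⟩
    rw [Nat.le_zero.1 hi, Function.iterate_zero, id, C.label_labelOf hw, ho]
  · obtain ⟨j, h1, h2, h3⟩ := ih _ (hn ▸ C.time_prev ho hw) (C.orient_prev ho hw) rfl
    rw [C.labelOf_prev hw] at h1 h2 h3
    have h4 : C.φ^[j + 1] (C.label (C.labelOf h)) = h := by
      rw [Function.iterate_succ_apply', h1, C.φ_prev]
    refine ⟨j + 1, h4, fun i hi => ?_, fun i hi => ?_⟩
    · rcases Nat.lt_or_ge i (j + 1) with h5 | h5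
      · exact h2 i (by omega)
      · rw [le_antisymm hi h5, h4, ho]
    · rcases Nat.lt_or_ge i j with h5 | h5
      · exact h3 i h5
      · have : i = j := by omega
        subst this
        rw [h4, h1]
        exact C.time_prev ho hw

theorem eps_labelOf {h : H} (ho : C.orient h = 1) : C.eps (C.labelOf h) = 1 := by
  obtain ⟨j, -, h2, -⟩ := C.exists_chain ho
  exact h2 0 (Nat.zero_le j)

theorem chain_mono {x : H} {j : ℕ}
    (h : ∀ i < j, C.time (C.φ^[i] x) < C.time (C.φ^[i + 1] x)) {a b : ℕ} (hab : a ≤ b)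
    (hb : b ≤ j) : C.time (C.φ^[a] x) ≤ C.time (C.φ^[b] x) := by
  induction b, hab using Nat.le_induction with
  | base => exact le_rfl
  | succ b hab ih => exact (ih (by omega)).trans (h b (by omega)).le

theorem chain_strictMono {x : H} {j : ℕ}
    (h : ∀ i < j, C.time (C.φ^[i] x) < C.time (C.φ^[i + 1] x)) {a b : ℕ} (hab : a < b)
    (hb : b ≤ j) : C.time (C.φ^[a] x) < C.time (C.φ^[b] x) :=
  (h a (by omega)).trans_le (C.chain_mono h hab hb)

/-- Both half-edges lie on the chain issued from the same white half-edge, along which the time is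
strictly increasing. -/
theorem out_ext {h h' : H} (ho : C.orient h = 1) (ho' : C.orient h' = 1)
    (hl : C.labelOf h = C.labelOf h') (ht : C.time h = C.time h') : h = h' := by
  obtain ⟨j, h1, -, h3⟩ := C.exists_chain ho
  obtain ⟨j', h1', -, h3'⟩ := C.exists_chain ho'
  rw [← hl] at h1' h3'
  rcases lt_trichotomy j j' with hj | hj | hj
  · have := C.chain_strictMono h3' hj le_rfl
    rw [h1, h1'] at this; omega
  · rw [← h1, ← h1', hj]
  · have := C.chain_strictMono h3 hj le_rfl
    rw [h1, h1'] at this; omega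

/-- In a chain, nothing lies strictly between a half-edge and its predecessor. This characterizes
the predecessor by labels and times alone. -/
theorem time_le_time_prev {h h' : H} (ho : C.orient h = 1) (ho' : C.orient h' = 1)
    (hl : C.labelOf h = C.labelOf h') (ht : C.time h < C.time h') :
    C.time h ≤ C.time (C.α (C.σ h')) := by
  obtain ⟨j, h1, -, h3⟩ := C.exists_chain ho
  obtain ⟨j', h1', -, h3'⟩ := C.exists_chain ho'
  rw [← hl] at h1' h3'
  have hj : j < j' := by
    by_contra hc
    have := C.chain_mono h3 (not_lt.1 hc) le_rfl
    rw [h1, h1'] at this; omega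
  obtain ⟨i, rfl⟩ : ∃ i, j' = i + 1 := ⟨j' - 1, by omega⟩
  have hp : C.α (C.σ h') = C.φ^[i] (C.label (C.labelOf h)) := by
    apply C.φ.injective
    rw [C.φ_prev, ← Function.iterate_succ_apply' C.φ, h1']
  have := C.chain_mono h3' (by omega : j ≤ i) (by omega)
  rwa [h1, ← hp] at this

/-- When the edge of `h` ends at a white vertex, the next half-edge of the face is white and has
time `0`; the chain therefore stops at `h`. -/
theorem time_le_of_white {h h' : H} (ho : C.orient h = 1) (ho' : C.orient h' = 1)
    (hl : C.labelOf h = C.labelOf h') (hw : C.White (C.α h)) : C.time h' ≤ C.time h := by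
  obtain ⟨j, h1, -, h3⟩ := C.exists_chain ho
  obtain ⟨j', h1', -, h3'⟩ := C.exists_chain ho'
  rw [← hl] at h1' h3'
  rcases Nat.lt_or_ge j j' with hj | hj
  · have := h3' j hj
    rw [Function.iterate_succ_apply', h1, C.φ_apply,
      C.time_eq_zero_iff.2 (C.white_σ_inv.2 hw)] at this
    omega
  · have := C.chain_mono h3 hj le_rfl
    rwa [h1, h1'] at this

theorem label_rho_inv (i : I) : (C.label (C.rho⁻¹ i) : H) = C.σ⁻¹ (C.label i) := by
  rw [Perm.eq_inv_iff_eq, ← C.label_rho]; simp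

section Finite

variable [Finite H]

theorem minimalPeriod_σ {h : H} (hb : ¬ C.White h) : Function.minimalPeriod C.σ h = 4 := by
  obtain ⟨k, hk⟩ := C.exists_vertex hb
  have hpos : 0 < Function.minimalPeriod C.σ h :=
    Function.minimalPeriod_pos_of_mem_periodicPts
      ((Function.Injective.mem_periodicPts C.σ.injective) h)
  have hv : ∀ n : ℕ, C.vertex (C.σ^[n] h) = some k := by
    intro n
    induction n with
    | zero => exact hk
    | succ n ih => rw [Function.iterate_succ_apply', C.vertex_σ, ih]
  rw [← C.black_degree k, ← Nat.card_fin (Function.minimalPeriod C.σ h)]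
  refine Nat.card_eq_of_bijective (fun n => ⟨C.σ^[n] h, hv n⟩) ⟨?_, ?_⟩
  · intro n n' hn
    exact Fin.ext (Function.iterate_injOn_Iio_minimalPeriod n.2 n'.2 (congrArg Subtype.val hn))
  · rintro ⟨h', hh'⟩
    obtain ⟨n, hn⟩ := (C.black_cycle h h' hb (hk.trans hh'.symm)).exists_nat_pow_eq
    refine ⟨⟨n % Function.minimalPeriod C.σ h, Nat.mod_lt _ hpos⟩, Subtype.ext ?_⟩
    simp only [Function.iterate_mod_minimalPeriod_eq, Perm.iterate_eq_pow, hn]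

theorem σ_σ_ne {h : H} (hb : ¬ C.White h) : C.σ (C.σ h) ≠ h := by
  intro e
  have : Function.IsPeriodicPt C.σ 2 h := e
  have := this.minimalPeriod_le (by norm_num)
  rw [C.minimalPeriod_σ hb] at this
  omega

theorem σ_pow_four {h : H} (hb : ¬ C.White h) : C.σ (C.σ (C.σ (C.σ h))) = h := by
  have := Function.iterate_minimalPeriod (f := C.σ) (x := h)
  rwa [C.minimalPeriod_σ hb] at this

theorem σ_inv_eq {h : H} (hb : ¬ C.White h) : C.σ⁻¹ h = C.σ (C.σ (C.σ h)) := by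
  rw [Perm.inv_eq_iff_eq, C.σ_pow_four hb]

theorem eq_or_eq_of_vertex_eq {h h' : H} (hb : ¬ C.White h)
    (hv : C.vertex h' = C.vertex h) (ho : C.orient h' = C.orient h) :
    h' = h ∨ h' = C.σ (C.σ h) := by
  obtain ⟨n, hn⟩ := (C.black_cycle h h' hb hv.symm).exists_nat_pow_eq
  have hn' : C.σ^[n % 4] h = h' := by
    rw [← C.minimalPeriod_σ hb, Function.iterate_mod_minimalPeriod_eq, Perm.iterate_eq_pow, hn]
  have hlt : n % 4 < 4 := Nat.mod_lt _ (by norm_num)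
  have a1 := C.black_alternated h hb
  have b1 : ¬ C.White (C.σ (C.σ h)) := by rwa [C.white_σ, C.white_σ]
  have a2 := C.black_alternated (C.σ h) (by rwa [C.vertex_σ])
  have a3 := C.black_alternated (C.σ (C.σ h)) b1
  interval_cases n % 4
  · left; exact hn'.symm
  · exfalso
    have : C.σ h = h' := hn'
    rw [← this, a1] at ho
    exact sign_ne_neg _ ho
  · right; exact hn'.symm
  · exfalso
    have : C.σ (C.σ (C.σ h)) = h' := hn'
    rw [← this, a3, a2, a1, neg_neg] at ho
    exact sign_ne_neg _ ho

/-- The two outgoing half-edges of a black vertex have the same time, and an outgoing half-edge is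
determined by its label and its time. -/
theorem labelOf_σ_σ_ne {h : H} (ho : C.orient h = 1) (hb : ¬ C.White h) :
    C.labelOf (C.σ (C.σ h)) ≠ C.labelOf h := by
  intro e
  refine C.σ_σ_ne hb (C.out_ext ?_ ho e ?_)
  · rw [C.black_alternated (C.σ h) (by rwa [C.vertex_σ]), C.black_alternated h hb, neg_neg, ho]
  · rw [C.time_σ, C.time_σ]

theorem orient_σ_σ {h : H} (hb : ¬ C.White h) : C.orient (C.σ (C.σ h)) = C.orient h := by
  rw [C.black_alternated (C.σ h) (by rwa [C.vertex_σ]), C.black_alternated h hb, neg_neg]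

variable [LinearOrder I]

theorem exists_pair (k : Fin r) : ∃ z : I × I, z.1 < z.2 ∧
    ∀ o, (∃ h, C.vertex h = some k ∧ C.orient h = 1 ∧ C.labelOf h = o) ↔ o = z.1 ∨ o = z.2 := by
  obtain ⟨h, hk, ho⟩ := C.blackOut_nonempty k
  have hb : ¬ C.White h := by simp [White, hk]
  have key : ∀ o, (∃ h, C.vertex h = some k ∧ C.orient h = 1 ∧ C.labelOf h = o) ↔
      o = C.labelOf h ∨ o = C.labelOf (C.σ (C.σ h)) := by
    intro o
    constructor
    · rintro ⟨h', hk', ho', rfl⟩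
      rcases C.eq_or_eq_of_vertex_eq hb (hk'.trans hk.symm) (ho'.trans ho.symm) with rfl | rfl
      · exact Or.inl rfl
      · exact Or.inr rfl
    · rintro (rfl | rfl)
      · exact ⟨h, hk, ho, rfl⟩
      · exact ⟨_, by rw [C.vertex_σ, C.vertex_σ, hk], by rw [C.orient_σ_σ hb, ho], rfl⟩
  rcases lt_or_gt_of_ne (C.labelOf_σ_σ_ne ho hb) with hlt | hlt
  · exact ⟨(C.labelOf (C.σ (C.σ h)), C.labelOf h), hlt, fun o => (key o).trans or_comm⟩
  · exact ⟨(C.labelOf h, C.labelOf (C.σ (C.σ h))), hlt, key⟩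

/-- The two labels of the outgoing half-edges at a black vertex, in increasing order. -/
noncomputable def pair (k : Fin r) : I × I := (C.exists_pair k).choose

theorem pair_lt (k : Fin r) : (C.pair k).1 < (C.pair k).2 := (C.exists_pair k).choose_spec.1

theorem mem_pair (k : Fin r) (o : I) :
    (∃ h, C.vertex h = some k ∧ C.orient h = 1 ∧ C.labelOf h = o) ↔
      o = (C.pair k).1 ∨ o = (C.pair k).2 := (C.exists_pair k).choose_spec.2 o

theorem pair_eq {k : Fin r} {z : I × I} (hz : z.1 < z.2)
    (h : ∀ o, (∃ h, C.vertex h = some k ∧ C.orient h = 1 ∧ C.labelOf h = o) ↔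
      o = z.1 ∨ o = z.2) : C.pair k = z := by
  have h1 := C.pair_lt k
  have key : ∀ o, (o = (C.pair k).1 ∨ o = (C.pair k).2) ↔ o = z.1 ∨ o = z.2 := fun o =>
    (C.mem_pair k o).symm.trans (h o)
  have k1 := (key (C.pair k).1).1 (Or.inl rfl)
  have k2 := (key (C.pair k).2).1 (Or.inr rfl)
  rcases k1 with k1 | k1 <;> rcases k2 with k2 | k2
  · rw [k1, k2] at h1; exact absurd h1 (lt_irrefl _)
  · exact Prod.ext k1 k2
  · rw [k1, k2] at h1; exact absurd (h1.trans hz) (lt_irrefl _)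
  · rw [k1, k2] at h1; exact absurd h1 (lt_irrefl _)

theorem val_eq_pair (k : Fin r) : C.val k = (C.pair k).2 := by
  apply le_antisymm
  · refine Finset.sup'_le _ _ fun h hh => ?_
    have hh' : C.vertex h = some k ∧ C.orient h = 1 := by simpa [blackOut] using hh
    rcases (C.mem_pair k (C.labelOf h)).1 ⟨h, hh'.1, hh'.2, rfl⟩ with e | e
    · rw [e]; exact (C.pair_lt k).le
    · rw [e]
  · obtain ⟨h, h1, h2, h3⟩ := (C.mem_pair k (C.pair k).2).2 (Or.inr rfl)
    rw [← h3]
    refine Finset.le_sup' C.labelOf ?_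
    simpa [blackOut] using ⟨h1, h2⟩

theorem eps_pair (k : Fin r) : C.eps (C.pair k).1 = 1 ∧ C.eps (C.pair k).2 = 1 := by
  obtain ⟨h, -, h2, h3⟩ := (C.mem_pair k (C.pair k).1).2 (Or.inl rfl)
  obtain ⟨h', -, h2', h3'⟩ := (C.mem_pair k (C.pair k).2).2 (Or.inr rfl)
  rw [← h3, ← h3']
  exact ⟨C.eps_labelOf h2, C.eps_labelOf h2'⟩

theorem swap_pair {h : H} {k : Fin r} (hk : C.vertex h = some k) (ho : C.orient h = 1) :
    swap (C.pair k).1 (C.pair k).2 (C.labelOf h) = C.labelOf (C.σ (C.σ h)) := by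
  have hb : ¬ C.White h := by simp [White, hk]
  have hne := C.labelOf_σ_σ_ne ho hb
  have h1 := (C.mem_pair k (C.labelOf h)).1 ⟨h, hk, ho, rfl⟩
  have h2 := (C.mem_pair k (C.labelOf (C.σ (C.σ h)))).1
    ⟨_, by rw [C.vertex_σ, C.vertex_σ, hk], by rw [C.orient_σ_σ hb, ho], rfl⟩
  rcases h1 with h1 | h1 <;> rcases h2 with h2 | h2
  · exact absurd (h2.trans h1.symm) hne
  · rw [h1, h2, swap_apply_left]
  · rw [h1, h2, swap_apply_right]
  · exact absurd (h2.trans h1.symm) hne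

/-- The word of the pairs of labels at the black vertices. -/
noncomputable def pairWord : List (I × I) := List.ofFn C.pair

theorem take_pairWord_succ (k : Fin r) :
    swapProd (C.pairWord.take (k + 1)) =
      swapProd (C.pairWord.take k) * swap (C.pair k).1 (C.pair k).2 := by
  have hk : (k : ℕ) < C.pairWord.length := by simp [pairWord]
  rw [← List.take_append_getElem hk, swapProd_append]
  simp [swapProd, pairWord]

/-- The transpositions numbered from `a` to `b - 1` act first and fix `o`. -/
theorem take_pairWord_apply {a b : ℕ} (hab : a ≤ b) (hb : b ≤ r) {o : I}
    (h : ∀ k : Fin r, a ≤ k → (k : ℕ) < b → o ≠ (C.pair k).1 ∧ o ≠ (C.pair k).2) :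
    swapProd (C.pairWord.take b) o = swapProd (C.pairWord.take a) o := by
  induction b, hab using Nat.le_induction with
  | base => rfl
  | succ b hab ih =>
    have hk := h ⟨b, by omega⟩ hab (by simp)
    rw [C.take_pairWord_succ ⟨b, by omega⟩, Perm.mul_apply, swap_apply_of_ne_of_ne hk.1 hk.2]
    exact ih (by omega) fun k h1 h2 => h k h1 (by omega)

/-- `i` is the label of the first white half-edge met from `x` on. -/
def FirstWhite (x : H) (i : I) : Prop :=
  ∃ j : ℕ, C.φ^[j] x = C.label i ∧ ∀ j' < j, ¬ C.White (C.φ^[j'] x)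

theorem phi_eq_of_firstWhite {i i' : I} (h : C.FirstWhite (C.φ (C.label i)) i') :
    C.phi i = i' := by
  classical
  obtain ⟨j, h1, h2⟩ := h
  change C.nextWhite i = i'
  apply C.label.injective
  apply Subtype.ext
  rw [C.label_nextWhite]
  have : Nat.find (C.exists_return i) = j := by
    rw [Nat.find_eq_iff]
    refine ⟨?_, fun n hn => ?_⟩
    · rw [Function.iterate_succ_apply, h1]
      exact (C.label i').2
    · rw [Function.iterate_succ_apply]
      exact h2 n hn
  rw [this, Function.iterate_succ_apply, h1]

/-- This computes the faces, by induction on the time of `y`. At a black vertex, `σ⁻¹ y = σ z` with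
`z` the opposite outgoing half-edge, and the face leaves through the edge of `σ z`, traversed
backwards towards the predecessor `α (σ z)` of `z` in its chain. Turning at the vertex exchanges the
labels of `y` and `z`, which is the transposition of the vertex; then the walk continues from a
smaller time. -/
theorem firstWhite_σ_inv {y : H} (ho : C.orient y = 1) :
    C.FirstWhite (C.σ⁻¹ y) (C.rho⁻¹ (swapProd (C.pairWord.take (C.time y)) (C.labelOf y))) := by
  induction hn : C.time y using Nat.strong_induction_on generalizing y with
  | _ n ih =>
  subst hn
  by_cases hw : C.White y
  · refine ⟨0, ?_, by simp⟩
    rw [C.time_eq_zero_iff.2 hw, C.label_rho_inv]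
    simp [swapProd, C.label_labelOf hw]
  · obtain ⟨k, hk⟩ := C.exists_vertex hw
    set z := C.σ (C.σ y) with hz
    have hzw : ¬ C.White z := by rwa [hz, C.white_σ, C.white_σ]
    have hzo : C.orient z = 1 := by rw [hz, C.orient_σ_σ hw, ho]
    have hzt : C.time z = C.time y := by rw [hz, C.time_σ, C.time_σ]
    have hinv : C.σ⁻¹ y = C.σ z := C.σ_inv_eq hw
    have hlt : C.time (C.α (C.σ z)) < C.time y := hzt ▸ C.time_prev hzo hzw
    have hstep : C.φ (C.σ⁻¹ y) = C.σ⁻¹ (C.α (C.σ z)) := by rw [C.φ_apply, hinv]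
    obtain ⟨j, h1, h2⟩ := ih _ hlt (C.orient_prev hzo hzw) rfl
    rw [C.labelOf_prev hzw] at h1
    -- Between the predecessor of `z` and the present vertex, no black vertex carries the label of
    -- `z`; the corresponding transpositions may be omitted.
    have heq : swapProd (C.pairWord.take (C.time y)) (C.labelOf y) =
        swapProd (C.pairWord.take (C.time (C.α (C.σ z)))) (C.labelOf z) := by
      have hty := C.time_of_vertex hk
      rw [hty] at hlt ⊢
      rw [C.take_pairWord_succ, Perm.mul_apply, C.swap_pair hk ho]
      refine C.take_pairWord_apply (by omega) (by omega) fun k' h3 h4 => ?_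
      rw [← not_or]
      rintro h5
      obtain ⟨h', hv', ho', hl'⟩ := (C.mem_pair k' _).2 h5
      have ht' := C.time_of_vertex hv'
      have := C.time_le_time_prev ho' hzo hl' (by omega)
      omega
    refine ⟨j + 1, ?_, fun j' hj' => ?_⟩
    · rw [Function.iterate_succ_apply, hstep, h1, heq]
    · rcases j' with _ | j'
      · rw [Function.iterate_zero, id, C.white_σ_inv]
        exact hw
      · rw [Function.iterate_succ_apply, hstep]
        exact h2 j' (by omega)

/-- The label of the edge arriving at an ingoing white half-edge. -/
noncomputable def endLabel (n : I) : I := C.labelOf (C.α (C.label n))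

theorem orient_α_label {n : I} (hn : C.eps n = -1) : C.orient (C.α (C.label n)) = 1 := by
  have : C.orient (C.label n) = -1 := hn
  rw [C.orient_α, this, neg_neg]

/-- The face of an ingoing half-edge `n` goes back along the edge arriving at `n`, so
`firstWhite_σ_inv` applies to `α n`. The black vertices with larger numbers do not carry its label,
which allows using the whole word. -/
theorem phi_of_in {n : I} (hn : C.eps n = -1) :
    C.phi n = C.rho⁻¹ (swapProd C.pairWord (C.endLabel n)) := by
  have ho := C.orient_α_label hn
  have h1 := C.firstWhite_σ_inv ho
  have h2 : swapProd C.pairWord (C.endLabel n) =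
      swapProd (C.pairWord.take (C.time (C.α (C.label n)))) (C.labelOf (C.α (C.label n))) := by
    have h3 : C.pairWord = C.pairWord.take r := by
      rw [List.take_of_length_le]
      simp [pairWord]
    conv_lhs => rw [h3]
    refine C.take_pairWord_apply (C.time_le _) le_rfl fun k h4 _ => ?_
    rw [← not_or]
    rintro h5
    obtain ⟨h', hv', ho', hl'⟩ := (C.mem_pair k _).2 h5
    have := C.time_le_of_white ho ho' hl'.symm (by rw [C.α_α]; exact (C.label n).2)
    rw [C.time_of_vertex hv'] at this
    omega
  rw [h2]
  exact C.phi_eq_of_firstWhite (by rwa [C.φ_apply])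

/-- The face of the outgoing white half-edge follows its chain up to the edge arriving at `n`, and
turns there around the white vertex of `n`. -/
theorem phi_endLabel {n : I} (hn : C.eps n = -1) : C.phi (C.endLabel n) = C.rho⁻¹ n := by
  have ho := C.orient_α_label hn
  obtain ⟨j, h1, h2, h3⟩ := C.exists_chain ho
  refine C.phi_eq_of_firstWhite ⟨j, ?_, fun j' hj' => ?_⟩
  · rw [← Function.iterate_succ_apply, Function.iterate_succ_apply']
    change C.φ (C.φ^[j] (C.label (C.labelOf (C.α (C.label n))))) = _
    rw [h1, C.φ_apply, C.α_α, C.label_rho_inv]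
  · rw [← Function.iterate_succ_apply, ← C.time_eq_zero_iff]
    have h4 := h3 j' hj'
    exact fun h => by
      change C.time (C.φ^[j' + 1] (C.label (C.labelOf (C.α (C.label n))))) = 0 at h
      omega

/-- The last half-edge of the chain of `o` must point to a white vertex: otherwise the half-edge
just before its end around that black vertex would prolong the chain at a later time. -/
theorem exists_endLabel {o : I} (ho : C.eps o = 1) : ∃ n, C.eps n = -1 ∧ C.endLabel n = o := by
  have hfin : {h : H | C.orient h = 1 ∧ C.labelOf h = o}.Finite := Set.toFinite _
  obtain ⟨x, ⟨hx1, hx2⟩, hmax⟩ := Set.exists_max_image _ C.time hfin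
    ⟨C.label o, ho, C.labelOf_label o⟩
  have hin : C.orient (C.α x) = -1 := by rw [C.orient_α, hx1]
  have hw : C.White (C.α x) := by
    by_contra hb
    have hb' : ¬ C.White (C.σ⁻¹ (C.α x)) := by rwa [C.white_σ_inv]
    have ho' : C.orient (C.σ⁻¹ (C.α x)) = 1 := by rw [C.orient_σ_inv hb, hin, neg_neg]
    have hprev : C.α (C.σ (C.σ⁻¹ (C.α x))) = x := by rw [C.σ_σ_inv, C.α_α]
    have h1 := C.time_prev ho' hb'
    have h2 := C.labelOf_prev hb'
    rw [hprev] at h1 h2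
    have := hmax _ ⟨ho', by rw [← h2, hx2]⟩
    omega
  refine ⟨C.labelOf (C.α x), ?_, ?_⟩
  · change C.orient (C.label _) = -1
    rw [C.label_labelOf hw, hin]
  · rw [endLabel, C.label_labelOf hw, C.α_α, hx2]

theorem endLabel_injective {n n' : I} (hn : C.eps n = -1) (hn' : C.eps n' = -1)
    (h : C.endLabel n = C.endLabel n') : n = n' := by
  have h1 := C.phi_endLabel hn
  have h2 := C.phi_endLabel hn'
  rw [h, h2] at h1
  exact (C.rho⁻¹.injective h1).symm

/-- The labels at black vertices are labels of outgoing white half-edges, so the word does not move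
ingoing ones. -/
theorem swapProd_pairWord_of_in {n : I} (hn : C.eps n = -1) : swapProd C.pairWord n = n := by
  refine swapProd_apply_of_notMem _ fun z hz => ?_
  obtain ⟨k, rfl⟩ := (List.mem_ofFn' C.pair z).1 hz
  have := C.eps_pair k
  constructor
  · rintro rfl; rw [this.1] at hn; exact absurd hn (by decide)
  · rintro rfl; rw [this.2] at hn; exact absurd hn (by decide)

/-- The pairing of the labels of the white half-edges joined by a path of edges with constant
label. -/
noncomputable def endPairing : Perm I := (swapProd C.pairWord)⁻¹ * C.rho * C.phi

theorem endPairing_of_in {n : I} (hn : C.eps n = -1) : C.endPairing n = C.endLabel n := by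
  simp [endPairing, C.phi_of_in hn]

theorem endPairing_endLabel {n : I} (hn : C.eps n = -1) : C.endPairing (C.endLabel n) = n := by
  rw [endPairing, Perm.mul_apply, Perm.mul_apply, C.phi_endLabel hn]
  have : C.rho (C.rho⁻¹ n) = n := by simp
  rw [this, Perm.inv_eq_iff_eq, C.swapProd_pairWord_of_in hn]

theorem endPairing_sign (i : I) : C.eps (C.endPairing i) = -C.eps i := by
  rcases Int.units_eq_one_or (C.eps i) with h | h
  · obtain ⟨n, hn, rfl⟩ := C.exists_endLabel h
    rw [C.endPairing_endLabel hn, hn, h]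
  · rw [C.endPairing_of_in h, h, neg_neg]
    exact C.eps_labelOf (C.orient_α_label h)

theorem endPairing_endPairing (i : I) : C.endPairing (C.endPairing i) = i := by
  rcases Int.units_eq_one_or (C.eps i) with h | h
  · obtain ⟨n, hn, rfl⟩ := C.exists_endLabel h
    rw [C.endPairing_endLabel hn, C.endPairing_of_in hn]
  · rw [C.endPairing_of_in h, C.endPairing_endLabel h]

end Finite

end UnitaryMap

/-! ### A map of unitary type is determined by its word and its pairing -/

namespace UnitaryMap

variable {I : Type*} [LinearOrder I] {r : ℕ} {H H' : Type*} [Finite H] [Finite H']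

/-- Two maps have the same signs, cyclic orders at the white vertices, labels at the black
vertices and end labels. -/
structure SameData (C : UnitaryMap I r H) (D : UnitaryMap I r H') : Prop where
  eps : ∀ i, C.eps i = D.eps i
  rho : C.rho = D.rho
  pair : ∀ k, C.pair k = D.pair k
  endLabel : ∀ n, C.eps n = -1 → C.endLabel n = D.endLabel n

namespace SameData

variable {C : UnitaryMap I r H} {D : UnitaryMap I r H'}

theorem symm (hd : SameData C D) : SameData D C :=
  ⟨fun i => (hd.eps i).symm, hd.rho.symm, fun k => (hd.pair k).symm,
    fun n hn => (hd.endLabel n ((hd.eps n).trans hn)).symm⟩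

/-- A pair formed of a label and a vertex carries an outgoing half-edge exactly when the label is in
the pair of the black vertex, or is the white outgoing half-edge itself. This depends only on the
data. -/
theorem exists_out (hd : SameData C D) {h : H} (ho : C.orient h = 1) :
    ∃ h', D.orient h' = 1 ∧ D.vertex h' = C.vertex h ∧ D.labelOf h' = C.labelOf h := by
  by_cases hw : C.White h
  · refine ⟨D.label (C.labelOf h), ?_, ?_, D.labelOf_label _⟩
    · exact (hd.eps _).symm.trans (C.eps_labelOf ho)
    · rw [(D.label _).2]; exact hw.symm
  · obtain ⟨k, hk⟩ := C.exists_vertex hw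
    have := (C.mem_pair k (C.labelOf h)).1 ⟨h, hk, ho, rfl⟩
    rw [hd.pair] at this
    obtain ⟨h', h1, h2, h3⟩ := (D.mem_pair k _).2 this
    exact ⟨h', h2, h1.trans hk.symm, h3⟩

theorem orient_α_of_ne {h : H} (ho : C.orient h ≠ 1) : C.orient (C.α h) = 1 := by
  rw [C.orient_α, sign_ne_one_iff.1 ho, neg_neg]

open Classical in
/-- The half-edge of `D` corresponding to a half-edge of `C`. -/
noncomputable def transfer (hd : SameData C D) (h : H) : H' :=
  if ho : C.orient h = 1 then (hd.exists_out ho).choose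
  else D.α (hd.exists_out (orient_α_of_ne ho)).choose

theorem transfer_spec (hd : SameData C D) {h : H} (ho : C.orient h = 1) :
    D.orient (hd.transfer h) = 1 ∧ D.vertex (hd.transfer h) = C.vertex h ∧
      D.labelOf (hd.transfer h) = C.labelOf h := by
  rw [transfer, dif_pos ho]
  exact (hd.exists_out ho).choose_spec

theorem transfer_α (hd : SameData C D) (h : H) : hd.transfer (C.α h) = D.α (hd.transfer h) := by
  by_cases ho : C.orient h = 1
  · have ho' : C.orient (C.α h) ≠ 1 := by rw [C.orient_α, ho]; decide
    have hx : ∀ x (hx : C.orient x = 1), x = h →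
        (hd.exists_out hx).choose = (hd.exists_out ho).choose := by
      rintro x hx rfl; rfl
    rw [transfer, dif_neg ho', transfer, dif_pos ho, hx _ (orient_α_of_ne ho') (C.α_α h)]
  · rw [transfer, dif_pos (orient_α_of_ne ho), transfer, dif_neg ho, D.α_α]

theorem orient_transfer (hd : SameData C D) (h : H) :
    D.orient (hd.transfer h) = C.orient h := by
  by_cases ho : C.orient h = 1
  · rw [(hd.transfer_spec ho).1, ho]
  · have h1 := (hd.transfer_spec (orient_α_of_ne ho)).1
    rw [hd.transfer_α, D.orient_α] at h1
    rw [sign_ne_one_iff.1 ho, ← h1, neg_neg]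

theorem time_transfer (hd : SameData C D) {h : H} (ho : C.orient h = 1) :
    D.time (hd.transfer h) = C.time h := by
  unfold time; rw [(hd.transfer_spec ho).2.1]

theorem transfer_symm_transfer (hd : SameData C D) (h : H) :
    hd.symm.transfer (hd.transfer h) = h := by
  have key : ∀ h, C.orient h = 1 → hd.symm.transfer (hd.transfer h) = h := by
    intro h ho
    have h1 := hd.transfer_spec ho
    have h2 := hd.symm.transfer_spec h1.1
    refine C.out_ext h2.1 ho (h2.2.2.trans h1.2.2) (C.time_eq_of_vertex_eq ?_)
    exact h2.2.1.trans h1.2.1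
  by_cases ho : C.orient h = 1
  · exact key h ho
  · have := key _ (orient_α_of_ne ho)
    rw [hd.transfer_α, hd.symm.transfer_α] at this
    exact C.α.injective this

/-- The bijection between the half-edges of two maps with the same data. -/
noncomputable def equiv (hd : SameData C D) : H ≃ H' where
  toFun := hd.transfer
  invFun := hd.symm.transfer
  left_inv := hd.transfer_symm_transfer
  right_inv := hd.symm.transfer_symm_transfer

theorem transfer_injective (hd : SameData C D) : Function.Injective hd.transfer :=
  hd.equiv.injective

theorem white_transfer_of_out (hd : SameData C D) {h : H} (ho : C.orient h = 1) :
    D.White (hd.transfer h) ↔ C.White h := by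
  unfold White; rw [(hd.transfer_spec ho).2.1]

/-- The predecessor of `y` is the latest outgoing half-edge with the same label and an earlier time.
Labels and times are preserved, and the two inequalities come from the maximality in `D` and in `C`.
-/
theorem transfer_prev (hd : SameData C D) {y : H} (ho : C.orient y = 1) (hb : ¬ C.White y) :
    hd.transfer (C.α (C.σ y)) = D.α (D.σ (hd.transfer y)) := by
  have hx := C.orient_prev ho hb
  have hy' := hd.transfer_spec ho
  have hb' : ¬ D.White (hd.transfer y) := by rwa [hd.white_transfer_of_out ho]
  have hx' := D.orient_prev hy'.1 hb'
  have hex := hd.transfer_spec hx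
  have hfx := hd.symm.transfer_spec hx'
  have hl : D.labelOf (hd.transfer (C.α (C.σ y))) = D.labelOf (hd.transfer y) := by
    rw [hex.2.2, hy'.2.2, C.labelOf_prev hb]
  refine D.out_ext hex.1 hx' (hl.trans (D.labelOf_prev hb').symm) (le_antisymm ?_ ?_)
  · refine D.time_le_time_prev hex.1 hy'.1 hl ?_
    rw [hd.time_transfer hx, hd.time_transfer ho]
    exact C.time_prev ho hb
  · rw [hd.time_transfer hx, ← hd.symm.time_transfer hx']
    refine C.time_le_time_prev hfx.1 ho ?_ ?_
    · rw [hfx.2.2, D.labelOf_prev hb', hy'.2.2]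
    · rw [hd.symm.time_transfer hx', ← hd.time_transfer ho]
      exact D.time_prev hy'.1 hb'

theorem transfer_σ_of_out (hd : SameData C D) {y : H} (ho : C.orient y = 1)
    (hb : ¬ C.White y) : hd.transfer (C.σ y) = D.σ (hd.transfer y) := by
  have := hd.transfer_prev ho hb
  rw [hd.transfer_α] at this
  exact D.α.injective this

theorem vertex_transfer_of_black (hd : SameData C D) {h : H} (hb : ¬ C.White h) :
    D.vertex (hd.transfer h) = C.vertex h := by
  by_cases ho : C.orient h = 1
  · exact (hd.transfer_spec ho).2.1
  · have hb' : ¬ C.White (C.σ⁻¹ h) := by rwa [C.white_σ_inv]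
    have ho' : C.orient (C.σ⁻¹ h) = 1 := by
      rw [C.orient_σ_inv hb, sign_ne_one_iff.1 ho, neg_neg]
    have := hd.transfer_σ_of_out ho' hb'
    rw [C.σ_σ_inv] at this
    rw [this, D.vertex_σ, (hd.transfer_spec ho').2.1, C.vertex_σ_inv]

/-- Black half-edges keep their vertex; the same holds for the inverse correspondence, so that white
ones remain white. -/
theorem vertex_transfer (hd : SameData C D) (h : H) :
    D.vertex (hd.transfer h) = C.vertex h := by
  by_cases hb : C.White h
  · by_contra hne
    have hw : ¬ D.White (hd.transfer h) := fun hw => hne (hw.trans hb.symm)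
    have := hd.symm.vertex_transfer_of_black hw
    rw [hd.transfer_symm_transfer] at this
    exact hne this.symm
  · exact hd.vertex_transfer_of_black hb

/-- An outgoing white half-edge is recognized by its own label, an ingoing one by the label of the
edge arriving at it, since `endLabel` is injective on ingoing labels. -/
theorem transfer_label (hd : SameData C D) (i : I) : hd.transfer (C.label i) = D.label i := by
  have hw : D.White (hd.transfer (C.label i)) :=
    (hd.vertex_transfer _).trans (C.label i).2
  suffices h : D.labelOf (hd.transfer (C.label i)) = i by
    have h2 := D.label_labelOf hw
    rw [h] at h2
    exact h2.symm
  rcases Int.units_eq_one_or (C.eps i) with h | h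
  · rw [(hd.transfer_spec (show C.orient (C.label i) = 1 from h)).2.2, C.labelOf_label]
  · refine D.endLabel_injective ?_ ((hd.eps i).symm.trans h) ?_
    · change D.orient (D.label _) = -1
      rw [D.label_labelOf hw, hd.orient_transfer]
      exact h
    · rw [UnitaryMap.endLabel, D.label_labelOf hw, ← hd.transfer_α,
        (hd.transfer_spec (C.orient_α_label h)).2.2, ← hd.endLabel i h, UnitaryMap.endLabel]

theorem transfer_σ (hd : SameData C D) (h : H) : hd.transfer (C.σ h) = D.σ (hd.transfer h) := by
  by_cases hw : C.White h
  · rw [← C.label_labelOf hw, ← C.label_rho, hd.transfer_label, hd.transfer_label, hd.rho,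
      D.label_rho]
  · by_cases ho : C.orient h = 1
    · exact hd.transfer_σ_of_out ho hw
    · obtain ⟨y, rfl⟩ := C.σ.surjective h
      rw [C.white_σ] at hw
      have hoy : C.orient y = 1 := by
        have := C.black_alternated y hw
        rw [sign_ne_one_iff.1 ho] at this
        exact (neg_injective this).symm
      have hwz : ¬ D.White (hd.transfer y) := by rwa [hd.white_transfer_of_out hoy]
      -- For an ingoing black half-edge `σ y`, its successor is the only other outgoing half-edge at
      -- the vertex of `y`.
      rw [hd.transfer_σ_of_out hoy hw]
      refine (D.eq_or_eq_of_vertex_eq hwz ?_ ?_).resolve_left ?_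
      · rw [hd.vertex_transfer, hd.vertex_transfer, C.vertex_σ, C.vertex_σ]
      · rw [hd.orient_transfer, hd.orient_transfer, C.orient_σ_σ hw]
      · exact fun e => C.σ_σ_ne hw (hd.transfer_injective e)

end SameData

end UnitaryMap

theorem MapRep.iso_of_sameData {I : Type*} [LinearOrder I] {r : ℕ} {C D : MapRep I r}
    (hd : haveI := C.finite; haveI := D.finite; UnitaryMap.SameData C.map D.map) :
    C.Iso D := by
  have := C.finite
  have := D.finite
  exact ⟨hd.equiv, hd.transfer_σ, hd.transfer_α, hd.orient_transfer, hd.vertex_transfer,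
    hd.transfer_label⟩

/-! ### Existence of a map of unitary type with a given word and a given pairing -/

namespace UnitaryMap

section Extend

variable {I : Type*} {r : ℕ} {H : Type*} (C : UnitaryMap I r H) (i j : I)

open Classical in
/-- The transfer of two ingoing white half-edges to two ingoing half-edges of a new vertex. -/
noncomputable def regraft : Perm (H ⊕ Fin 4) :=
  swap (Sum.inl (C.label i : H)) (Sum.inr 0) * swap (Sum.inl (C.label j : H)) (Sum.inr 2)

variable {i j}

theorem label_ne (hij : i ≠ j) : (C.label i : H) ≠ C.label j := fun h =>
  hij (C.label.injective (Subtype.ext h))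

open Classical in
theorem regraft_left (hij : i ≠ j) : C.regraft i j (Sum.inl (C.label i)) = Sum.inr 0 := by
  have : swap (Sum.inl (C.label j : H)) (Sum.inr 2 : H ⊕ Fin 4) (Sum.inl (C.label i : H)) =
      Sum.inl (C.label i : H) :=
    swap_apply_of_ne_of_ne (by simpa using C.label_ne hij) (by simp)
  rw [regraft, Perm.mul_apply, this, swap_apply_left]

open Classical in
theorem regraft_right : C.regraft i j (Sum.inl (C.label j)) = Sum.inr 2 := by
  rw [regraft, Perm.mul_apply, swap_apply_left, swap_apply_of_ne_of_ne] <;> simp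

open Classical in
theorem regraft_zero : C.regraft i j (Sum.inr 0) = Sum.inl (C.label i : H) := by
  have : swap (Sum.inl (C.label j : H)) (Sum.inr 2 : H ⊕ Fin 4) (Sum.inr 0) = Sum.inr 0 :=
    swap_apply_of_ne_of_ne (by simp) (by simp)
  rw [regraft, Perm.mul_apply, this, swap_apply_right]

open Classical in
theorem regraft_two (hij : i ≠ j) : C.regraft i j (Sum.inr 2) = Sum.inl (C.label j : H) := by
  rw [regraft, Perm.mul_apply, swap_apply_right, swap_apply_of_ne_of_ne]
  · simpa using (C.label_ne hij).symm
  · simp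

open Classical in
theorem regraft_inl {y : H} (hi : y ≠ C.label i) (hj : y ≠ C.label j) :
    C.regraft i j (Sum.inl y) = Sum.inl y := by
  have : swap (Sum.inl (C.label j : H)) (Sum.inr 2 : H ⊕ Fin 4) (Sum.inl y) = Sum.inl y :=
    swap_apply_of_ne_of_ne (by simpa using hj) (by simp)
  rw [regraft, Perm.mul_apply, this, swap_apply_of_ne_of_ne (by simpa using hi) (by simp)]

open Classical in
theorem regraft_inr {q : Fin 4} (h0 : q ≠ 0) (h2 : q ≠ 2) :
    C.regraft i j (Sum.inr q) = Sum.inr q := by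
  have : swap (Sum.inl (C.label j : H)) (Sum.inr 2 : H ⊕ Fin 4) (Sum.inr q) = Sum.inr q :=
    swap_apply_of_ne_of_ne (by simp) (by simpa using h2)
  rw [regraft, Perm.mul_apply, this, swap_apply_of_ne_of_ne (by simp) (by simpa using h0)]

/-- The orientation of the half-edges, with a new alternated vertex of degree four. -/
def extendOrient : H ⊕ Fin 4 → ℤˣ := Sum.elim C.orient ![-1, 1, -1, 1]

/-- The pairing of the half-edges when a new vertex without edge to the others is added. -/
def disjointα : Perm (H ⊕ Fin 4) := Perm.sumCongr C.α (swap 0 3 * swap 1 2)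

theorem disjointα_disjointα (z : H ⊕ Fin 4) : C.disjointα (C.disjointα z) = z := by
  rcases z with y | q
  · simp [disjointα, C.α_α]
  · have : ∀ q : Fin 4, (swap 0 3 * swap 1 2 : Perm (Fin 4))
        ((swap 0 3 * swap 1 2 : Perm (Fin 4)) q) = q := by decide
    simp only [disjointα, Perm.sumCongr_apply, Sum.map_inr, this]

theorem extendOrient_disjointα (z : H ⊕ Fin 4) :
    C.extendOrient (C.disjointα z) = -C.extendOrient z := by
  rcases z with y | q
  · simp [disjointα, extendOrient, C.orient_α]
  · have : ∀ q : Fin 4, (![-1, 1, -1, 1] : Fin 4 → ℤˣ) ((swap 0 3 * swap 1 2 : Perm (Fin 4)) q) =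
        -(![-1, 1, -1, 1] : Fin 4 → ℤˣ) q := by decide
    exact this q

theorem regraft_cases (hij : i ≠ j) (z : H ⊕ Fin 4) :
    (z = Sum.inl (C.label i : H) ∧ C.regraft i j z = Sum.inr 0) ∨
    (z = Sum.inl (C.label j : H) ∧ C.regraft i j z = Sum.inr 2) ∨
    (z = Sum.inr 0 ∧ C.regraft i j z = Sum.inl (C.label i : H)) ∨
    (z = Sum.inr 2 ∧ C.regraft i j z = Sum.inl (C.label j : H)) ∨
    C.regraft i j z = z := by
  rcases z with y | q
  · by_cases h1 : y = C.label i
    · subst h1; simp [C.regraft_left hij]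
    by_cases h2 : y = C.label j
    · subst h2; simp [C.regraft_right]
    simp [C.regraft_inl h1 h2]
  · by_cases h1 : q = 0
    · subst h1; simp [C.regraft_zero]
    by_cases h2 : q = 2
    · subst h2; simp [C.regraft_two hij]
    simp [C.regraft_inr h1 h2]

/-- All the half-edges exchanged by `regraft` are ingoing. Conjugating a pairing by `regraft` thus
preserves both involutivity and orientation. -/
theorem extendOrient_regraft (hij : i ≠ j) (hi : C.eps i = -1) (hj : C.eps j = -1)
    (z : H ⊕ Fin 4) : C.extendOrient (C.regraft i j z) = C.extendOrient z := by
  have hi' : C.orient (C.label i) = -1 := hi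
  have hj' : C.orient (C.label j) = -1 := hj
  rcases C.regraft_cases hij z with ⟨h1, h2⟩ | ⟨h1, h2⟩ | ⟨h1, h2⟩ | ⟨h1, h2⟩ | h
  · rw [h2, h1]; simp [extendOrient, hi']
  · rw [h2, h1]; simp [extendOrient, hj']
  · rw [h2, h1]; simp [extendOrient, hi']
  · rw [h2, h1]; simp [extendOrient, hj']
  · rw [h]

theorem regraft_of_out (hij : i ≠ j) (hi : C.eps i = -1) (hj : C.eps j = -1)
    {z : H ⊕ Fin 4} (hz : C.extendOrient z = 1) : C.regraft i j z = z := by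
  have hi' : C.orient (C.label i) = -1 := hi
  have hj' : C.orient (C.label j) = -1 := hj
  rcases C.regraft_cases hij z with ⟨rfl, h2⟩ | ⟨rfl, h2⟩ | ⟨rfl, h2⟩ | ⟨rfl, h2⟩ | h
  · simp [extendOrient, hi'] at hz
  · simp [extendOrient, hj'] at hz
  · simp [extendOrient] at hz
  · simp [extendOrient] at hz
  · exact h

/-- The pairing of the half-edges after insertion of a new vertex just before the ends of the
edges arriving at the white half-edges `i` and `j`. -/
noncomputable def extendα (i j : I) : Perm (H ⊕ Fin 4) :=
  C.regraft i j * C.disjointα * (C.regraft i j)⁻¹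

theorem extendα_regraft (z : H ⊕ Fin 4) :
    C.extendα i j (C.regraft i j z) = C.regraft i j (C.disjointα z) := by
  simp [extendα]

theorem extendα_of_out (hij : i ≠ j) (hi : C.eps i = -1) (hj : C.eps j = -1)
    {z : H ⊕ Fin 4} (hz : C.extendOrient z = 1) :
    C.extendα i j z = C.regraft i j (C.disjointα z) := by
  conv_lhs => rw [← C.regraft_of_out hij hi hj hz]
  exact C.extendα_regraft z

theorem extendα_regraft_of_in (hij : i ≠ j) (hi : C.eps i = -1) (hj : C.eps j = -1)
    {z : H ⊕ Fin 4} (hz : C.extendOrient z = -1) :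
    C.extendα i j (C.regraft i j z) = C.disjointα z := by
  rw [C.extendα_regraft, C.regraft_of_out hij hi hj]
  rw [C.extendOrient_disjointα, hz, neg_neg]

/-- The colours and numbers of the vertices, with a new black vertex with the largest number. -/
def extendVertex : H ⊕ Fin 4 → Option (Fin (r + 1)) :=
  Sum.elim (fun h => (C.vertex h).map Fin.castSucc) fun _ => some (Fin.last r)

theorem extendVertex_inl_eq_castSucc {h : H} {k : Fin r} :
    C.extendVertex (Sum.inl h) = some k.castSucc ↔ C.vertex h = some k := by
  simp [extendVertex, Option.map_eq_some_iff]

theorem extendVertex_inl_ne_last {h : H} : C.extendVertex (Sum.inl h) ≠ some (Fin.last r) := by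
  simp only [extendVertex, Sum.elim_inl, ne_eq, Option.map_eq_some_iff, not_exists, not_and]
  intro k _ hk
  exact Fin.castSucc_ne_last k hk

theorem extendVertex_inl_eq_none {h : H} :
    C.extendVertex (Sum.inl h) = none ↔ C.vertex h = none := by
  simp [extendVertex]

theorem sumCongr_pow_inl {α β : Type*} (f : Perm α) (g : Perm β) (n : ℤ) (a : α) :
    ((Perm.sumCongr f g : Perm (α ⊕ β)) ^ n) (Sum.inl a) = Sum.inl ((f ^ n) a) := by
  have := map_zpow (Perm.sumCongrHom α β) (f, g) n
  have h2 : (Perm.sumCongr f g : Perm (α ⊕ β)) ^ n = Perm.sumCongr (f ^ n) (g ^ n) := this.symm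
  rw [h2]; simp

theorem sumCongr_pow_inr {α β : Type*} (f : Perm α) (g : Perm β) (n : ℤ) (b : β) :
    ((Perm.sumCongr f g : Perm (α ⊕ β)) ^ n) (Sum.inr b) = Sum.inr ((g ^ n) b) := by
  have := map_zpow (Perm.sumCongrHom α β) (f, g) n
  have h2 : (Perm.sumCongr f g : Perm (α ⊕ β)) ^ n = Perm.sumCongr (f ^ n) (g ^ n) := this.symm
  rw [h2]; simp

/-- Insertion of a new black vertex just before the ends of the edges arriving at the ingoing
white half-edges `i` and `j`. -/
noncomputable def extend (hij : i ≠ j) (hi : C.eps i = -1) (hj : C.eps j = -1) :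
    UnitaryMap I (r + 1) (H ⊕ Fin 4) where
  σ := Perm.sumCongr C.σ (finRotate 4)
  α := C.extendα i j
  orient := C.extendOrient
  α_α z := by
    obtain ⟨z, rfl⟩ := (C.regraft i j).surjective z
    rw [C.extendα_regraft, C.extendα_regraft, C.disjointα_disjointα]
  orient_α z := by
    obtain ⟨z, rfl⟩ := (C.regraft i j).surjective z
    rw [C.extendα_regraft, C.extendOrient_regraft hij hi hj, C.extendOrient_regraft hij hi hj,
      C.extendOrient_disjointα]
  vertex := C.extendVertex
  vertex_σ z := by
    rcases z with h | q
    · simp [extendVertex, C.vertex_σ]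
    · simp [extendVertex]
  black_cycle z z' hz hzz := by
    rcases z with h | q <;> rcases z' with h' | q'
    · cases hv : C.vertex h with
      | none => exact absurd (C.extendVertex_inl_eq_none.2 hv) hz
      | some k =>
        have h1 := C.extendVertex_inl_eq_castSucc.2 hv
        have h2 := C.extendVertex_inl_eq_castSucc.1 (hzz.symm.trans h1)
        obtain ⟨n, hn⟩ := C.black_cycle h h' (by simp [hv]) (hv.trans h2.symm)
        exact ⟨n, by rw [sumCongr_pow_inl, hn]⟩
    · exact absurd hzz C.extendVertex_inl_ne_last
    · exact absurd hzz.symm C.extendVertex_inl_ne_last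
    · have key : ∀ q q' : Fin 4, ∃ n : Fin 4, ((finRotate 4) ^ (n : ℕ)) q = q' := by decide
      obtain ⟨n, hn⟩ := key q q'
      exact ⟨(n : ℕ), by rw [sumCongr_pow_inr, zpow_natCast, hn]⟩
  black_degree k := by
    rw [Nat.card_congr subtypeSum]
    refine Fin.lastCases ?_ (fun k => ?_) k
    · have : IsEmpty {h : H // C.extendVertex (Sum.inl h) = some (Fin.last r)} :=
        ⟨fun h => C.extendVertex_inl_ne_last h.2⟩
      rw [Nat.card_congr (Equiv.emptySum _ _)]
      exact (Nat.card_congr (Equiv.subtypeUnivEquiv fun q => rfl)).trans (Nat.card_fin 4)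
    · have : IsEmpty {q : Fin 4 // C.extendVertex (Sum.inr q) = some k.castSucc} :=
        ⟨fun q => by
          have := q.2
          simp only [extendVertex, Sum.elim_inr, Option.some.injEq] at this
          exact Fin.castSucc_ne_last k this.symm⟩
      rw [Nat.card_congr (Equiv.sumEmpty _ _)]
      exact (Nat.card_congr (Equiv.subtypeEquivRight fun h =>
        C.extendVertex_inl_eq_castSucc)).trans (C.black_degree k)
  black_alternated z hz := by
    rcases z with h | q
    · exact C.black_alternated h fun hv => hz (C.extendVertex_inl_eq_none.2 hv)
    · have : ∀ q : Fin 4, (![-1, 1, -1, 1] : Fin 4 → ℤˣ) (finRotate 4 q) =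
          -(![-1, 1, -1, 1] : Fin 4 → ℤˣ) q := by decide
      exact this q
  label := C.label.trans
    { toFun := fun h => ⟨Sum.inl h.1, C.extendVertex_inl_eq_none.2 h.2⟩
      invFun := fun z => match z with
        | ⟨Sum.inl h, hh⟩ => ⟨h, C.extendVertex_inl_eq_none.1 hh⟩
        | ⟨Sum.inr q, hh⟩ => by simp [extendVertex] at hh
      left_inv := fun _ => rfl
      right_inv := by
        rintro ⟨h | q, hh⟩
        · rfl
        · simp [extendVertex] at hh }
  black_increasing z k k' hz hk hk' := by
    rw [C.extendα_of_out hij hi hj hz] at hk'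
    rcases z with y | q
    · have hα : C.disjointα (Sum.inl y : H ⊕ Fin 4) = Sum.inl (C.α y) := rfl
      rw [hα] at hk'
      induction k using Fin.lastCases with
      | last => exact absurd hk C.extendVertex_inl_ne_last
      | cast k =>
        induction k' using Fin.lastCases with
        | last => exact Fin.castSucc_lt_last k
        | cast k' =>
          rw [Fin.castSucc_lt_castSucc_iff]
          refine C.black_increasing y k k' hz (C.extendVertex_inl_eq_castSucc.1 hk) ?_
          by_cases h1 : C.α y = C.label i
          · rw [h1, C.regraft_left hij] at hk'
            simp only [extendVertex, Sum.elim_inr, Option.some.injEq] at hk'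
            exact absurd hk'.symm (Fin.castSucc_ne_last k')
          by_cases h2 : C.α y = C.label j
          · rw [h2, C.regraft_right] at hk'
            simp only [extendVertex, Sum.elim_inr, Option.some.injEq] at hk'
            exact absurd hk'.symm (Fin.castSucc_ne_last k')
          rw [C.regraft_inl h1 h2] at hk'
          exact C.extendVertex_inl_eq_castSucc.1 hk'
    -- The edges leaving the new vertex end at the white half-edges `i` and `j`, so there is nothing
    -- to compare. The edges reaching it, treated above, cause no trouble since its number is the
    -- largest.
    · exfalso
      have hi' := C.extendVertex_inl_eq_none.2 (C.label i).2
      have hj' := C.extendVertex_inl_eq_none.2 (C.label j).2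
      have h3 : C.disjointα (Sum.inr 3 : H ⊕ Fin 4) = Sum.inr 0 := rfl
      have h1 : C.disjointα (Sum.inr 1 : H ⊕ Fin 4) = Sum.inr 2 := rfl
      fin_cases q
      · exact absurd hz (by change ¬ ((-1 : ℤˣ) = 1); decide)
      · change C.extendVertex (C.regraft i j (C.disjointα (Sum.inr 1))) = _ at hk'
        rw [h1, C.regraft_two hij, hj'] at hk'
        exact absurd hk' (by simp)
      · exact absurd hz (by change ¬ ((-1 : ℤˣ) = 1); decide)
      · change C.extendVertex (C.regraft i j (C.disjointα (Sum.inr 3))) = _ at hk'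
        rw [h3, C.regraft_zero, hi'] at hk'
        exact absurd hk' (by simp)

variable [LinearOrder I] [Finite H]

variable (hij : i ≠ j) (hi : C.eps i = -1) (hj : C.eps j = -1)

theorem extend_label (n : I) :
    ((C.extend hij hi hj).label n : H ⊕ Fin 4) = Sum.inl (C.label n : H) := rfl

theorem extend_rho : (C.extend hij hi hj).rho = C.rho := by
  ext n
  apply (C.extend hij hi hj).label.injective
  apply Subtype.ext
  rw [label_rho, extend_label, extend_label, C.label_rho]
  rfl

theorem extend_α_inl_label {n : I} (hn : C.eps n = -1) (h1 : n ≠ i) (h2 : n ≠ j) :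
    (C.extend hij hi hj).α (Sum.inl (C.label n : H)) = Sum.inl (C.α (C.label n)) := by
  have := C.extendα_regraft_of_in hij hi hj (z := Sum.inl (C.label n : H)) hn
  rw [C.regraft_inl (C.label_ne h1) (C.label_ne h2)] at this
  exact this

theorem extend_α_inl_black {y : H} (ho : C.orient y = -1) (hb : ¬ C.White y) :
    (C.extend hij hi hj).α (Sum.inl y) = Sum.inl (C.α y) := by
  have := C.extendα_regraft_of_in hij hi hj (z := Sum.inl y) ho
  rw [C.regraft_inl (fun e => hb (by rw [e]; exact (C.label i).2))
    (fun e => hb (by rw [e]; exact (C.label j).2))] at this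
  exact this

/-- Going back along a chain from an old outgoing half-edge only uses old vertices and edges which
end at black vertices; the insertion modifies none of them. -/
theorem extend_labelOf_inl {y : H} (ho : C.orient y = 1) :
    (C.extend hij hi hj).labelOf (Sum.inl y) = C.labelOf y := by
  induction hn : C.time y using Nat.strong_induction_on generalizing y with
  | _ n ih =>
  by_cases hw : C.White y
  · conv_lhs => rw [← C.label_labelOf hw, ← C.extend_label hij hi hj, labelOf_label]
  · have hw' : ¬ (C.extend hij hi hj).White (Sum.inl y) := fun h =>
      hw (C.extendVertex_inl_eq_none.1 h)
    rw [← labelOf_prev _ hw', ← C.labelOf_prev hw,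
      ← ih _ (hn ▸ C.time_prev ho hw) (C.orient_prev ho hw) rfl]
    congr 1
    refine C.extend_α_inl_black hij hi hj ?_ (by rwa [C.white_σ])
    rw [C.black_alternated y hw, ho]

theorem extend_α_zero :
    (C.extend hij hi hj).α (Sum.inr 0) = Sum.inl (C.α (C.label i)) := by
  have := C.extendα_regraft_of_in hij hi hj (z := Sum.inl (C.label i : H)) hi
  rw [C.regraft_left hij] at this
  exact this

theorem extend_α_two :
    (C.extend hij hi hj).α (Sum.inr 2) = Sum.inl (C.α (C.label j)) := by
  have := C.extendα_regraft_of_in hij hi hj (z := Sum.inl (C.label j : H)) hj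
  rw [C.regraft_right] at this
  exact this

theorem extend_not_white_inr (q : Fin 4) : ¬ (C.extend hij hi hj).White (Sum.inr q) :=
  Option.some_ne_none _

/-- The ingoing half-edge `0` receives the edge which used to arrive at `i`, and `σ` sends `3` to
`0`. The label therefore passes from that edge to the outgoing half-edge `3`; likewise from `2` to
`1` for `j`. -/
theorem extend_labelOf_three :
    (C.extend hij hi hj).labelOf (Sum.inr 3) = C.endLabel i := by
  rw [← labelOf_prev _ (C.extend_not_white_inr hij hi hj 3)]
  have : (C.extend hij hi hj).σ (Sum.inr 3) = Sum.inr 0 := rfl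
  rw [this, extend_α_zero, C.extend_labelOf_inl hij hi hj (C.orient_α_label hi), endLabel]

theorem extend_labelOf_one :
    (C.extend hij hi hj).labelOf (Sum.inr 1) = C.endLabel j := by
  rw [← labelOf_prev _ (C.extend_not_white_inr hij hi hj 1)]
  have : (C.extend hij hi hj).σ (Sum.inr 1) = Sum.inr 2 := rfl
  rw [this, extend_α_two, C.extend_labelOf_inl hij hi hj (C.orient_α_label hj), endLabel]

/-- The edges now arriving at `i` and `j` come from the new vertex, through which the labels have
passed unchanged. -/
theorem extend_endLabel {n : I} (hn : C.eps n = -1) :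
    (C.extend hij hi hj).endLabel n = C.endLabel n := by
  rw [endLabel, extend_label]
  by_cases h1 : n = i
  · subst h1
    have := C.extendα_regraft (i := n) (j := j) (Sum.inr 0)
    rw [C.regraft_zero] at this
    have e : (C.extend hij hi hj).α (Sum.inl (C.label n : H)) = Sum.inr 3 :=
      this.trans (C.regraft_inr (q := 3) (by decide) (by decide))
    rw [e, extend_labelOf_three]
  by_cases h2 : n = j
  · subst h2
    have := C.extendα_regraft (i := i) (j := n) (Sum.inr 2)
    rw [C.regraft_two hij] at this
    have e : (C.extend hij hi hj).α (Sum.inl (C.label n : H)) = Sum.inr 1 :=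
      this.trans (C.regraft_inr (q := 1) (by decide) (by decide))
    rw [e, extend_labelOf_one]
  rw [C.extend_α_inl_label hij hi hj hn h1 h2, C.extend_labelOf_inl hij hi hj (C.orient_α_label hn),
    endLabel]

theorem extend_pair_castSucc (k : Fin r) : (C.extend hij hi hj).pair k.castSucc = C.pair k := by
  refine pair_eq _ (C.pair_lt k) fun o => ?_
  rw [← C.mem_pair]
  constructor
  · rintro ⟨y | q, h1, h2, h3⟩
    · rw [C.extend_labelOf_inl hij hi hj h2] at h3
      exact ⟨y, C.extendVertex_inl_eq_castSucc.1 h1, h2, h3⟩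
    · have : some (Fin.last r) = some k.castSucc := h1
      exact absurd (Option.some.inj this).symm (Fin.castSucc_ne_last k)
  · rintro ⟨y, h1, h2, h3⟩
    exact ⟨Sum.inl y, C.extendVertex_inl_eq_castSucc.2 h1, h2, by
      rw [C.extend_labelOf_inl hij hi hj h2, h3]⟩

theorem extend_pair_last (h : C.endLabel i < C.endLabel j) :
    (C.extend hij hi hj).pair (Fin.last r) = (C.endLabel i, C.endLabel j) := by
  refine pair_eq _ h fun o => ?_
  constructor
  · rintro ⟨y | q, h1, h2, h3⟩
    · exact absurd h1 C.extendVertex_inl_ne_last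
    · fin_cases q
      · exact absurd h2 (by change ¬ ((-1 : ℤˣ) = 1); decide)
      · exact Or.inr (h3.symm.trans (C.extend_labelOf_one hij hi hj))
      · exact absurd h2 (by change ¬ ((-1 : ℤˣ) = 1); decide)
      · exact Or.inl (h3.symm.trans (C.extend_labelOf_three hij hi hj))
  · rintro (rfl | rfl)
    · exact ⟨Sum.inr 3, rfl, rfl, C.extend_labelOf_three hij hi hj⟩
    · exact ⟨Sum.inr 1, rfl, rfl, C.extend_labelOf_one hij hi hj⟩

end Extend

section Exists

variable {I : Type} [LinearOrder I] [Finite I]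

/-- The map without black vertices defined by a pairing. -/
def ofPairing {ε : I → ℤˣ} (ρ α : Perm I) (hα : ∀ k, α (α k) = k)
    (hε : ∀ k, ε (α k) = -ε k) : UnitaryMap I 0 I where
  σ := ρ
  α := α
  orient := ε
  α_α := hα
  orient_α := hε
  vertex _ := none
  vertex_σ _ := rfl
  black_cycle _ _ h := absurd rfl h
  black_degree k := k.elim0
  black_alternated _ h := absurd rfl h
  label := (Equiv.subtypeUnivEquiv fun _ => rfl).symm
  black_increasing _ k := k.elim0

/-- Induction on the length of the word. A last letter `(a, b)` is realized by inserting a vertex at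
the ends of the chains labelled `a` and `b`; previous pairs and end labels are not affected. -/
theorem exists_unitaryMap {ε : I → ℤˣ} (ρ α : Perm I) (hα : ∀ k, α (α k) = k)
    (hε : ∀ k, ε (α k) = -ε k) (r : ℕ) (w : Fin r → I × I) (hw : ∀ k, (w k).1 < (w k).2)
    (hw' : ∀ k, ε (w k).1 = 1 ∧ ε (w k).2 = 1) :
    ∃ (H : Type) (_ : Finite H) (C : UnitaryMap I r H), (∀ n, C.eps n = ε n) ∧ C.rho = ρ ∧
      (∀ k, C.pair k = w k) ∧ ∀ n, ε n = -1 → C.endLabel n = α n := by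
  induction r with
  | zero =>
    refine ⟨I, inferInstance, ofPairing ρ α hα hε, fun n => rfl, ?_, fun k => k.elim0,
      fun n _ => ?_⟩
    · ext n
      exact (ofPairing ρ α hα hε).label_rho n
    · exact (ofPairing ρ α hα hε).labelOf_label (α n)
  | succ r ih =>
    obtain ⟨H, hH, C, h1, h2, h3, h4⟩ := ih (fun k => w k.castSucc) (fun k => hw _)
      (fun k => hw' _)
    obtain ⟨ha, hb⟩ := hw' (Fin.last r)
    obtain ⟨i, hi, hia⟩ := C.exists_endLabel ((h1 _).trans ha)
    obtain ⟨j, hj, hjb⟩ := C.exists_endLabel ((h1 _).trans hb)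
    have hlt : C.endLabel i < C.endLabel j := by rw [hia, hjb]; exact hw _
    have hij : i ≠ j := by rintro rfl; exact lt_irrefl _ hlt
    refine ⟨H ⊕ Fin 4, inferInstance, C.extend hij hi hj, fun n => h1 n,
      (C.extend_rho hij hi hj).trans h2, fun k => ?_, fun n hn => ?_⟩
    · refine Fin.lastCases ?_ (fun k => ?_) k
      · rw [C.extend_pair_last hij hi hj hlt, hia, hjb]
      · rw [C.extend_pair_castSucc, h3]
    · rw [C.extend_endLabel hij hi hj ((h1 n).trans hn), h4 n hn]

end Exists

end UnitaryMap

/-! ### Sorted words -/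

section Words

variable {I : Type*} [LinearOrder I]

/-- The word of the first components of the letters of `w` with second component `b`. -/
def wordLists (w : List (I × I)) (b : I) : List I := (w.filter fun z => z.2 = b).map Prod.fst

/-- The second components of the letters are weakly increasing. -/
abbrev SortedWord (w : List (I × I)) : Prop := w.Pairwise fun z z' => z.2 ≤ z'.2

theorem mem_wordLists {w : List (I × I)} {a b : I} : a ∈ wordLists w b ↔ (a, b) ∈ w := by
  simp only [wordLists, List.mem_map, List.mem_filter, decide_eq_true_eq]
  constructor
  · rintro ⟨⟨a', b'⟩, ⟨h1, h2⟩, h3⟩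
    simp only at h2 h3
    rwa [← h2, ← h3]
  · exact fun h => ⟨(a, b), ⟨h, rfl⟩, rfl⟩

theorem wordLists_cons_self (z : I × I) (w : List (I × I)) :
    wordLists (z :: w) z.2 = z.1 :: wordLists w z.2 := by
  simp [wordLists]

theorem wordLists_cons_of_ne {z : I × I} {b : I} (h : z.2 ≠ b) (w : List (I × I)) :
    wordLists (z :: w) b = wordLists w b := by
  simp [wordLists, h]

/-- Sortedness forces the first letters of both words to have the same second component. The
corresponding lists then give the same head, and the tails are compared by induction. -/
theorem SortedWord.ext {w w' : List (I × I)} (hw : SortedWord w) (hw' : SortedWord w')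
    (h : wordLists w = wordLists w') : w = w' := by
  have hmem : ∀ {w w' : List (I × I)}, wordLists w = wordLists w' → ∀ z ∈ w, z ∈ w' := by
    intro w w' h z hz
    have : z.1 ∈ wordLists w z.2 := mem_wordLists.2 hz
    rw [h] at this
    exact mem_wordLists.1 this
  have hle : ∀ {z z' : I × I} {t t' : List (I × I)}, SortedWord (z' :: t') →
      wordLists (z :: t) = wordLists (z' :: t') → z'.2 ≤ z.2 := by
    intro z z' t t' hs h
    rcases List.mem_cons.1 (hmem h z (by simp)) with e | e
    · rw [e]
    · exact (List.pairwise_cons.1 hs).1 z e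
  induction w generalizing w' with
  | nil =>
    cases w' with
    | nil => rfl
    | cons z' t' => exact absurd (hmem h.symm z' (by simp)) (by simp)
  | cons z t ih =>
    cases w' with
    | nil => exact absurd (hmem h z (by simp)) (by simp)
    | cons z' t' =>
      have h2 : z.2 = z'.2 := le_antisymm (hle hw h.symm) (hle hw' h)
      have h3 := congrFun h z.2
      rw [wordLists_cons_self] at h3
      rw [h2, wordLists_cons_self, List.cons.injEq, ← h2] at h3
      have hz : z = z' := Prod.ext h3.1 h2
      subst hz
      rw [ih (List.pairwise_cons.1 hw).2 (List.pairwise_cons.1 hw').2]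
      funext b
      by_cases hb : z.2 = b
      · subst hb; exact h3.2
      · have := congrFun h b
        rwa [wordLists_cons_of_ne hb, wordLists_cons_of_ne hb] at this

variable [Fintype I]

theorem wordLists_walkWord (L : I → List I) : wordLists (walkWord L) = L := by
  funext b
  have hb : b ∈ (Finset.univ : Finset I).sort (· ≤ ·) := by simp
  have hs := (Finset.sortedLT_sort (Finset.univ : Finset I)).pairwise
  obtain ⟨l₁, l₂, hl⟩ := List.append_of_mem hb
  rw [hl, List.pairwise_append, List.pairwise_cons] at hs
  obtain ⟨-, ⟨h2, -⟩, h3⟩ := hs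
  have e1 : ∀ l : List I, (∀ x ∈ l, x ≠ b) →
      (l.flatMap fun x => (L x).map fun a => (a, x)).filter (fun z => z.2 = b) = [] := by
    intro l hx
    rw [List.filter_eq_nil_iff]
    intro z hz
    obtain ⟨x, hxl, hz⟩ := List.mem_flatMap.1 hz
    obtain ⟨a, -, rfl⟩ := List.mem_map.1 hz
    simpa using hx x hxl
  rw [wordLists, walkWord, hl, List.flatMap_append, List.flatMap_cons, List.filter_append,
    List.filter_append, e1 l₁ fun x hx => ne_of_lt (h3 x hx b (by simp)),
    e1 l₂ fun x hx => ne_of_gt (h2 x hx)]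
  rw [List.nil_append, List.append_nil, List.filter_eq_self.2]
  · simp [List.map_map, Function.comp_def]
  · intro z hz
    obtain ⟨a, -, rfl⟩ := List.mem_map.1 hz
    simp

theorem sortedWord_walkWord (L : I → List I) : SortedWord (walkWord L) := by
  rw [SortedWord, walkWord, List.pairwise_flatMap]
  constructor
  · intro b _
    rw [List.pairwise_map]
    exact List.pairwise_of_forall fun _ _ => le_rfl
  · refine (Finset.sortedLT_sort (Finset.univ : Finset I)).pairwise.imp ?_
    intro b b' hbb x hx y hy
    obtain ⟨a, -, rfl⟩ := List.mem_map.1 hx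
    obtain ⟨a', -, rfl⟩ := List.mem_map.1 hy
    exact hbb.le

theorem walkWord_wordLists {w : List (I × I)} (hw : SortedWord w) :
    walkWord (wordLists w) = w :=
  (sortedWord_walkWord _).ext hw (wordLists_walkWord _)

end Words

/-! ### Maps of unitary type and walks -/

namespace UnitaryMap

section Walk

variable {I : Type*} [LinearOrder I] {r : ℕ} {H : Type*} [Finite H] (C : UnitaryMap I r H)

/-- The walk of a map of unitary type. -/
noncomputable def walk : Perm I × (I → List I) :=
  (swapProd C.pairWord * C.endPairing * (swapProd C.pairWord)⁻¹, wordLists C.pairWord)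

theorem mem_pairWord {z : I × I} : z ∈ C.pairWord ↔ ∃ k, C.pair k = z := List.mem_ofFn' C.pair z

theorem eps_swapProd_pairWord (i : I) : C.eps (swapProd C.pairWord i) = C.eps i := by
  refine (swapProd_invariant _ (fun x => C.eps x = C.eps i) (fun z hz => ?_) i).2 rfl
  obtain ⟨k, rfl⟩ := C.mem_pairWord.1 hz
  rw [(C.eps_pair k).1, (C.eps_pair k).2]

/-- With `τ` the product of the word and `β` the pairing of the ends of the chains, `φ = ρ⁻¹ τ β`.
The pairing of the walk is `τ β τ⁻¹`, so that `τ` comes on the right, as in the expansion of the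
moments. -/
theorem phi_eq : C.phi = C.rho⁻¹ * (C.walk.1 * swapProd C.pairWord) := by
  simp only [walk, endPairing]
  group

theorem nondecreasing_iff : C.Nondecreasing ↔ SortedWord C.pairWord := by
  rw [SortedWord, pairWord, List.pairwise_ofFn]
  simp only [← C.val_eq_pair]
  refine ⟨fun h i j hij => h i j hij.le, fun h i j hij => ?_⟩
  rcases hij.eq_or_lt with rfl | hij
  · rfl
  · exact h hij

variable [Fintype I]

/-- Conjugation by the word preserves the signs, since the word only permutes outgoing labels. -/
theorem isWalk_walk : IsWalk C.eps Finset.univ C.walk where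
  invol k := by
    simp [walk, Perm.mul_apply, C.endPairing_endPairing]
  fix k hk := absurd (Finset.mem_univ k) hk
  sign k _ := by
    obtain ⟨k, rfl⟩ := (swapProd C.pairWord).surjective k
    simp [walk, Perm.mul_apply, C.eps_swapProd_pairWord, C.endPairing_sign]
  mem b a hab := by
    obtain ⟨k, hk⟩ := C.mem_pairWord.1 (mem_wordLists.1 hab)
    have h1 := C.pair_lt k
    have h2 := C.eps_pair k
    rw [hk] at h1 h2
    exact ⟨h1, Finset.mem_univ _, Finset.mem_univ _, h2.1, h2.2⟩

end Walk

section Iso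

variable {I : Type*} [LinearOrder I] {r : ℕ} {H H' : Type*} [Finite H] [Finite H']
  {C : UnitaryMap I r H} {D : UnitaryMap I r H'}

theorem pair_iso (e : H ≃ H') (h1 : ∀ h, e (C.σ h) = D.σ (e h)) (h2 : ∀ h, e (C.α h) = D.α (e h))
    (h3 : ∀ h, D.orient (e h) = C.orient h) (h4 : ∀ h, D.vertex (e h) = C.vertex h)
    (h5 : ∀ i, e (C.label i) = D.label i) (k : Fin r) : C.pair k = D.pair k := by
  refine C.pair_eq (D.pair_lt k) fun o => ?_
  rw [← D.mem_pair]
  constructor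
  · rintro ⟨h, a, b, c⟩
    exact ⟨e h, by rw [h4, a], by rw [h3, b], by rw [← labelOf_iso e h1 h2 h4 h5, c]⟩
  · rintro ⟨h, a, b, c⟩
    obtain ⟨h, rfl⟩ := e.surjective h
    exact ⟨h, by rw [← h4, a], by rw [← h3, b], by rw [labelOf_iso e h1 h2 h4 h5, c]⟩

end Iso

end UnitaryMap

/-! ### Nondecreasing maps up to isomorphism correspond to walks -/

namespace UMap

variable {I : Type} [LinearOrder I]

/-- The walk of a map of unitary type. -/
noncomputable def walk (C : UMap I) : Perm I × (I → List I) :=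
  Quotient.lift (fun D : MapRep I C.1 => haveI := D.finite; D.map.walk)
    (by
      rintro D E ⟨e, h1, h2, h3, h4, h5⟩
      have := D.finite
      have := E.finite
      have hp : D.map.pair = E.map.pair := funext (UnitaryMap.pair_iso e h1 h2 h3 h4 h5)
      simp only [UnitaryMap.walk, UnitaryMap.endPairing, UnitaryMap.pairWord, hp,
        rho_iso e h1 h5, phi_iso e h1 h2 h4 h5]) C.2

variable [Fintype I]

theorem isWalk_walk (C : UMap I) : IsWalk C.eps Finset.univ C.walk := by
  obtain ⟨r, q⟩ := C
  induction q using Quotient.inductionOn with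
  | _ D =>
  have := D.finite
  exact D.map.isWalk_walk

theorem phi_eq (C : UMap I) (hC : C.Nondecreasing) :
    C.phi = C.rho⁻¹ * (C.walk.1 * walkPerm C.walk.2) := by
  obtain ⟨r, q⟩ := C
  induction q using Quotient.inductionOn with
  | _ D =>
  have := D.finite
  have h1 := D.map.nondecreasing_iff.1 hC
  have h2 := D.map.phi_eq
  rw [← walkWord_wordLists h1] at h2
  exact h2

theorem walkLength_walk (C : UMap I) (hC : C.Nondecreasing) : walkLength C.walk.2 = C.1 := by
  obtain ⟨r, q⟩ := C
  induction q using Quotient.inductionOn with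
  | _ D =>
  have := D.finite
  have h1 := D.map.nondecreasing_iff.1 hC
  rw [← length_walkWord]
  change (walkWord (wordLists D.map.pairWord)).length = r
  rw [walkWord_wordLists h1, UnitaryMap.pairWord, List.length_ofFn]

/-- For nondecreasing maps the word is sorted, hence recovered from its lists, and its length is the
number of black vertices. Undoing the conjugation gives the pairing of the ends, and the data
determine the map. -/
theorem walk_injective {C C' : UMap I} (hC : C.Nondecreasing) (hC' : C'.Nondecreasing)
    (hε : C.eps = C'.eps) (hρ : C.rho = C'.rho) (hw : C.walk = C'.walk) : C = C' := by
  have hr : C.1 = C'.1 := by rw [← C.walkLength_walk hC, hw, C'.walkLength_walk hC']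
  obtain ⟨r, q⟩ := C
  obtain ⟨r', q'⟩ := C'
  obtain rfl : r = r' := hr
  congr 1
  induction q using Quotient.inductionOn with
  | _ D =>
  induction q' using Quotient.inductionOn with
  | _ E =>
  have := D.finite
  have := E.finite
  have h1 := D.map.nondecreasing_iff.1 hC
  have h2 := E.map.nondecreasing_iff.1 hC'
  replace hw : D.map.walk = E.map.walk := hw
  replace hε : D.map.eps = E.map.eps := hε
  replace hρ : D.map.rho = E.map.rho := hρ
  have hp : D.map.pairWord = E.map.pairWord := h1.ext h2 (congrArg Prod.snd hw)
  have he : D.map.endPairing = E.map.endPairing := by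
    have := congrArg Prod.fst hw
    simp only [UnitaryMap.walk, hp] at this
    exact mul_left_cancel (mul_right_cancel this)
  refine Quotient.sound (MapRep.iso_of_sameData ⟨congrFun hε, hρ,
    congrFun (List.ofFn_injective hp), fun n hn => ?_⟩)
  rw [← D.map.endPairing_of_in hn, ← E.map.endPairing_of_in (hε ▸ hn), he]

theorem exists_walk {ε : I → ℤˣ} (ρ : Perm I) {D : Perm I × (I → List I)}
    (hD : IsWalk ε Finset.univ D) :
    ∃ C : UMap I, C.Nondecreasing ∧ C.eps = ε ∧ C.rho = ρ ∧ C.walk = D := by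
  set τ := walkPerm D.2 with hτ
  have hτε : ∀ k, ε (τ k) = ε k := hD.perm_sign
  -- The pairing of the ends of the chains is the pairing of the walk conjugated back by `τ`.
  obtain ⟨H, hH, C, h1, h2, h3, h4⟩ := UnitaryMap.exists_unitaryMap (ε := ε) ρ
    (τ⁻¹ * D.1 * τ) (fun k => by simp [Perm.mul_apply, hD.invol])
    (fun k => by
      rw [← hτε]
      simp [Perm.mul_apply, hD.sign, hτε])
    (walkWord D.2).length (walkWord D.2).get
    (fun k => (hD.word_mem (List.get_mem _ k)).1)
    (fun k => (hD.word_mem (List.get_mem _ k)).2.2.2)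
  have hw : C.pairWord = walkWord D.2 := by
    rw [UnitaryMap.pairWord, funext h3, List.ofFn_get]
  have he : C.endPairing = τ⁻¹ * D.1 * τ := by
    ext k
    rcases Int.units_eq_one_or (C.eps k) with h | h
    · obtain ⟨n, hn, rfl⟩ := C.exists_endLabel h
      rw [C.endPairing_endLabel hn, h4 n ((h1 n).symm.trans hn)]
      simp [Perm.mul_apply, hD.invol]
    · rw [C.endPairing_of_in h, h4 k ((h1 k).symm.trans h)]
  refine ⟨⟨_, Quotient.mk _ ⟨H, hH, C⟩⟩, ?_, funext h1, h2, ?_⟩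
  · refine C.nondecreasing_iff.2 ?_
    rw [hw]
    exact sortedWord_walkWord _
  · change C.walk = D
    rw [UnitaryMap.walk, he, hw, wordLists_walkWord]
    change (τ * (τ⁻¹ * D.1 * τ) * τ⁻¹, D.2) = D
    refine Prod.ext ?_ rfl
    simp only
    group

end UMap

namespace UnitaryMap

variable {I : Type*} {r : ℕ} {H : Type*} [Finite H] (C : UnitaryMap I r H)

/-! ### The Euler characteristic of a map of unitary type -/

theorem label_rho_pow (n : ℤ) (i : I) : (C.label ((C.rho ^ n) i) : H) = (C.σ ^ n) (C.label i) := by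
  induction n using Int.induction_on generalizing i with
  | zero => simp
  | succ n ih => rw [zpow_add_one, zpow_add_one, Perm.mul_apply, Perm.mul_apply, ih, C.label_rho]
  | pred n ih =>
    rw [zpow_sub_one, zpow_sub_one, Perm.mul_apply, Perm.mul_apply, ih, C.label_rho_inv]

theorem sameCycle_rho_iff {i i' : I} :
    C.rho.SameCycle i i' ↔ C.σ.SameCycle (C.label i : H) (C.label i') := by
  refine exists_congr fun n => ?_
  rw [← C.label_rho_pow, ← Subtype.ext_iff, C.label.injective.eq_iff]

theorem vertex_eq_of_sameCycle {h h' : H} (hh : C.σ.SameCycle h h') :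
    C.vertex h = C.vertex h' := by
  obtain ⟨n, rfl⟩ := hh.exists_nat_pow_eq
  induction n with
  | zero => rfl
  | succ n ih =>
    rw [pow_succ', Perm.mul_apply, C.vertex_σ]
    exact ih ⟨n, by simp⟩

/-- The white vertices are the cycles of `ρ`, and each of the `r` black numbers is a single vertex.
-/
theorem numCycles_σ : numCycles C.σ = numCycles C.rho + r := by
  have : Finite I := Finite.of_equiv _ C.label.symm
  choose b hb using fun k : Fin r => C.blackOut_nonempty k
  have hv : ∀ k, C.vertex (b k) = some k := fun k => (hb k).1
  let F : Cyc C.rho ⊕ Fin r → Cyc C.σ := Sum.elim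
    (Quotient.lift (fun i => (Quotient.mk _ (C.label i : H) : Cyc C.σ))
      fun i i' h => Quotient.sound (C.sameCycle_rho_iff.1 h))
    fun k => Quotient.mk _ (b k)
  have hF : Function.Bijective F := by
    constructor
    · rintro (c | k) (c' | k') h
      · induction c using Quotient.inductionOn with | _ i =>
        induction c' using Quotient.inductionOn with | _ i' =>
        congr 1
        exact Quotient.sound (C.sameCycle_rho_iff.2 (Quotient.exact h))
      · induction c using Quotient.inductionOn with | _ i =>
        have := C.vertex_eq_of_sameCycle (Quotient.exact h)
        rw [(C.label i).2, hv] at this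
        exact absurd this (by simp)
      · induction c' using Quotient.inductionOn with | _ i =>
        have := C.vertex_eq_of_sameCycle (Quotient.exact h)
        rw [(C.label i).2, hv] at this
        exact absurd this (by simp)
      · have := C.vertex_eq_of_sameCycle (Quotient.exact h)
        rw [hv, hv] at this
        rw [Option.some.inj this]
    · intro c
      induction c using Quotient.inductionOn with | _ h =>
      by_cases hw : C.White h
      · refine ⟨Sum.inl (Quotient.mk _ (C.labelOf h)), ?_⟩
        change Quotient.mk _ (C.label (C.labelOf h) : H) = _
        rw [C.label_labelOf hw]
      · obtain ⟨k, hk⟩ := C.exists_vertex hw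
        refine ⟨Sum.inr k, Quotient.sound ?_⟩
        exact C.black_cycle _ _ (by simp [hv]) ((hv k).trans hk.symm)
  rw [numCycles, ← Nat.card_eq_of_bijective F hF, Nat.card_sum, Nat.card_fin, numCycles]

theorem card_halfEdge (C : UnitaryMap I r H) : Nat.card H = Nat.card I + 4 * r := by
  have : Finite I := Finite.of_equiv _ C.label.symm
  rw [Nat.card_congr (Equiv.sigmaFiberEquiv C.vertex).symm, Nat.card_sigma, Fintype.sum_option,
    Nat.card_congr C.label]
  simp only [C.black_degree]
  simp [mul_comm]

theorem sameCycle_α_iff {h h' : H} : C.α.SameCycle h h' ↔ h' = h ∨ h' = C.α h := by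
  constructor
  · intro hh
    obtain ⟨n, rfl⟩ := hh.exists_nat_pow_eq
    clear hh
    induction n with
    | zero => left; rfl
    | succ n ih =>
      rw [pow_succ', Perm.mul_apply]
      rcases ih with ih | ih
      · rw [ih]; right; rfl
      · rw [ih, C.α_α]; left; rfl
  · rintro (rfl | rfl)
    · exact SameCycle.refl _ _
    · exact ⟨1, by simp⟩

/-- Each edge has exactly one outgoing half, and half of the half-edges are outgoing. -/
theorem numCycles_α : 2 * numCycles C.α = Nat.card I + 4 * r := by
  have h1 : numCycles C.α = Nat.card {h // C.orient h = 1} := by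
    refine (Nat.card_eq_of_bijective
      (fun h : {h // C.orient h = 1} => (Quotient.mk _ h.1 : Cyc C.α)) ⟨?_, ?_⟩).symm
    · rintro ⟨h, hh⟩ ⟨h', hh'⟩ e
      rcases C.sameCycle_α_iff.1 (Quotient.exact e) with e | e
      · exact Subtype.ext e.symm
      · replace e : h' = C.α h := e
        rw [e, C.orient_α, hh] at hh'
        exact absurd hh' (by decide)
    · intro c
      induction c using Quotient.inductionOn with | _ h =>
      by_cases hh : C.orient h = 1
      · exact ⟨⟨h, hh⟩, rfl⟩
      · refine ⟨⟨C.α h, by rw [C.orient_α, sign_ne_one_iff.1 hh, neg_neg]⟩, Quotient.sound ?_⟩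
        exact C.sameCycle_α_iff.2 (Or.inr (C.α_α h).symm)
  have h2 : Nat.card {h // C.orient h = 1} = Nat.card {h // ¬ C.orient h = 1} := by
    refine Nat.card_congr (C.α.subtypeEquiv fun h => ?_)
    rw [C.orient_α]
    rcases Int.units_eq_one_or (C.orient h) with e | e <;> rw [e] <;> decide
  have h3 : Nat.card {h // C.orient h = 1} + Nat.card {h // ¬ C.orient h = 1} = Nat.card H := by
    classical
    rw [← Nat.card_sum]
    exact Nat.card_congr (Equiv.sumCompl fun h => C.orient h = 1)
  rw [← C.card_halfEdge]
  omega

open Classical in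
theorem label_phi (i : I) : (C.label (C.phi i) : H) =
    C.φ^[Nat.find (C.exists_return i) + 1] (C.label i) :=
  C.label_nextWhite i

/-- A journey along a face between two white half-edges is cut at the first white half-edge it
meets, which is one step of `phi`; the rest is shorter. -/
theorem sameCycle_phi_of_iterate (n : ℕ) {i i' : I}
    (h : C.φ^[n] (C.label i) = C.label i') : C.phi.SameCycle i i' := by
  classical
  induction n using Nat.strong_induction_on generalizing i with
  | _ n ih =>
  rcases Nat.eq_zero_or_pos n with rfl | hn
  · rw [C.label.injective (Subtype.ext h)]
  · have hle : Nat.find (C.exists_return i) ≤ n - 1 := by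
      refine Nat.find_min' _ ?_
      rw [Nat.sub_add_cancel hn, h]
      exact (C.label i').2
    have h2 : C.φ^[n - (Nat.find (C.exists_return i) + 1)] (C.label (C.phi i)) = C.label i' := by
      rw [C.label_phi, ← Function.iterate_add_apply, ← h]
      congr 2
      omega
    have h3 := ih _ (by omega) h2
    exact SameCycle.trans ⟨1, by simp⟩ h3

/-- Every face contains a white half-edge, and `phi` is the first-return map of `φ` to the white
half-edges. -/
theorem numCycles_φ : numCycles C.φ = numCycles C.phi := by
  classical
  have hwd : ∀ {i i' : I}, C.phi.SameCycle i i' →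
      C.φ.SameCycle (C.label i : H) (C.label i') := by
    have : Finite I := Finite.of_equiv _ C.label.symm
    intro i i' h
    obtain ⟨n, rfl⟩ := h.exists_nat_pow_eq
    clear h
    induction n with
    | zero => exact SameCycle.refl _ _
    | succ n ih =>
      refine ih.trans ?_
      rw [pow_succ', Perm.mul_apply, C.label_phi, Perm.iterate_eq_pow]
      exact ⟨((_ : ℕ) : ℤ), by rw [zpow_natCast]⟩
  symm
  refine Nat.card_eq_of_bijective (Quotient.lift
    (fun i => (Quotient.mk _ (C.label i : H) : Cyc C.φ)) fun i i' h => Quotient.sound (hwd h))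
    ⟨?_, ?_⟩
  · intro c c' h
    induction c using Quotient.inductionOn with | _ i =>
    induction c' using Quotient.inductionOn with | _ i' =>
    refine Quotient.sound ?_
    have h' : C.φ.SameCycle (C.label i : H) (C.label i') := Quotient.exact h
    obtain ⟨n, hn⟩ := h'.exists_nat_pow_eq
    exact C.sameCycle_phi_of_iterate n (by rw [Perm.iterate_eq_pow, hn])
  · intro c
    induction c using Quotient.inductionOn with | _ h =>
    obtain ⟨j, hj⟩ := C.exists_white h
    refine ⟨Quotient.mk _ (C.labelOf ((C.φ⁻¹ : Perm H)^[j] h)), Quotient.sound ?_⟩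
    change C.φ.SameCycle (C.label _ : H) h
    rw [C.label_labelOf hj, Perm.iterate_eq_pow]
    exact ⟨j, by simp⟩

theorem two_mul_eulerChar : 2 * C.eulerChar =
    2 * numCycles C.rho + 2 * numCycles C.phi - Nat.card I - 2 * r := by
  have h := C.numCycles_α
  rw [OrientedMap.eulerChar, C.numCycles_σ, C.numCycles_φ]
  have h' : (2 * numCycles C.α : ℤ) = Nat.card I + 4 * r := by exact_mod_cast h
  push_cast
  linarith

/-! ### Connectedness of a map of unitary type -/

theorem connected_iff : C.Connected ↔ ∀ T : Set H, (∀ h, C.σ h ∈ T ↔ h ∈ T) →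
    (∀ h, C.α h ∈ T ↔ h ∈ T) → T = ∅ ∨ T = Set.univ := by
  constructor
  · intro hC T hσ hα
    rw [or_iff_not_imp_left, ← Ne, ← Set.nonempty_iff_ne_empty]
    rintro ⟨h, hh⟩
    rw [Set.eq_univ_iff_forall]
    intro h'
    obtain ⟨f, hf, rfl⟩ := hC h h'
    suffices ∀ x, f x ∈ T ↔ x ∈ T from (this h).2 hh
    refine Subgroup.closure_induction (p := fun f _ => ∀ x, f x ∈ T ↔ x ∈ T) ?_ ?_ ?_ ?_ hf
    · rintro f (rfl | rfl)
      · exact hσ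
      · exact hα
    · exact fun x => Iff.rfl
    · intro f g _ _ hf hg x
      rw [Perm.mul_apply, hf, hg]
    · intro f _ hf x
      rw [← hf]; simp
  · intro hC h
    have key : ∀ g ∈ Subgroup.closure ({C.σ, C.α} : Set (Perm H)), ∀ x,
        (∃ f ∈ Subgroup.closure ({C.σ, C.α} : Set (Perm H)), f h = g x) ↔
        ∃ f ∈ Subgroup.closure ({C.σ, C.α} : Set (Perm H)), f h = x := by
      intro g hg x
      constructor
      · rintro ⟨f, hf, e⟩
        exact ⟨g⁻¹ * f, mul_mem (inv_mem hg) hf, by simp [e]⟩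
      · rintro ⟨f, hf, e⟩
        exact ⟨g * f, mul_mem hg hf, by simp [e]⟩
    have h1 := hC {x | ∃ f ∈ Subgroup.closure ({C.σ, C.α} : Set (Perm H)), f h = x}
      (key _ (Subgroup.subset_closure (by simp))) (key _ (Subgroup.subset_closure (by simp)))
    rcases h1 with h1 | h1
    · exact absurd (show h ∈ (∅ : Set H) from h1 ▸ ⟨1, one_mem _, rfl⟩) (by simp)
    · intro h'
      exact (Set.eq_univ_iff_forall.1 h1) h'

/-- A half-edge is joined to the white half-edge carrying its label by steps `α σ`, under which `T`
is stable. -/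
theorem label_labelOf_mem_iff {T : Set H} (hσ : ∀ h, C.σ h ∈ T ↔ h ∈ T)
    (hα : ∀ h, C.α h ∈ T ↔ h ∈ T) (h : H) : (C.label (C.labelOf h) : H) ∈ T ↔ h ∈ T := by
  obtain ⟨j, hj⟩ := C.exists_white h
  induction j generalizing h with
  | zero => rw [C.label_labelOf (show C.White h from hj)]
  | succ j ih =>
    by_cases hw : C.White h
    · rw [C.label_labelOf hw]
    · rw [Function.iterate_succ_apply, C.φ_inv_apply] at hj
      rw [← C.labelOf_prev hw, ih _ hj, hα, hσ]

/-- The label of the outgoing half of the edge of a half-edge. -/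
noncomputable def outLabel (h : H) : I :=
  if C.orient h = 1 then C.labelOf h else C.labelOf (C.α h)

theorem outLabel_of_out {h : H} (ho : C.orient h = 1) : C.outLabel h = C.labelOf h := if_pos ho

theorem outLabel_α (h : H) : C.outLabel (C.α h) = C.outLabel h := by
  unfold outLabel
  rw [C.orient_α, C.α_α]
  rcases Int.units_eq_one_or (C.orient h) with e | e <;> simp [e]

variable [LinearOrder I] [Fintype I] {K : Type*} [Fintype K] [DecidableEq K] {bl : I → K}

theorem endPairing_eq :
    C.endPairing = (swapProd C.pairWord)⁻¹ * C.walk.1 * swapProd C.pairWord := by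
  simp only [walk]; group

/-- Once `B` is closed for the transpositions, their product preserves membership in `B`;
conjugating the pairing by it is then harmless. -/
theorem isClosedFor_walk_iff (B : Finset K) : IsClosedFor bl C.walk B ↔
    (∀ i, bl (C.endPairing i) ∈ B ↔ bl i ∈ B) ∧
    ∀ k, bl (C.pair k).1 ∈ B ↔ bl (C.pair k).2 ∈ B := by
  have hpair : (∀ b, ∀ a ∈ C.walk.2 b, bl a ∈ B ↔ bl b ∈ B) ↔
      ∀ k, bl (C.pair k).1 ∈ B ↔ bl (C.pair k).2 ∈ B := by
    constructor
    · exact fun h k => h _ _ (mem_wordLists.2 (C.mem_pairWord.2 ⟨k, rfl⟩))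
    · intro h b a hab
      obtain ⟨k, hk⟩ := C.mem_pairWord.1 (mem_wordLists.1 hab)
      have := h k
      rwa [hk] at this
  unfold IsClosedFor
  rw [hpair]
  refine and_congr_left fun h => ?_
  have hτ : ∀ i, bl (swapProd C.pairWord i) ∈ B ↔ bl i ∈ B := by
    refine swapProd_invariant _ (fun i => bl i ∈ B) fun z hz => ?_
    obtain ⟨k, rfl⟩ := C.mem_pairWord.1 hz
    exact h k
  constructor
  · intro h1 i
    rw [← hτ, C.endPairing_eq, ← hτ i, ← h1 (swapProd C.pairWord i)]
    simp
  · intro h1 i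
    obtain ⟨i, rfl⟩ := (swapProd C.pairWord).surjective i
    rw [hτ, ← h1 i, ← hτ (C.endPairing i), walk]
    simp

/-- Stable sets of half-edges correspond to closed sets of blocks. From `B` one takes the half-edges
whose edge has its label in `B`: the label is constant on edges and from an outgoing half-edge to
the next at a black vertex, and the other turns exchange the two labels of the vertex. From a stable
set one takes the blocks of its white half-edges. -/
theorem connected_iff_isConnectedFor (hbl : ∀ i i', bl i = bl i' ↔ C.rho.SameCycle i i')
    (hsurj : Function.Surjective bl) :
    C.Connected ↔ IsConnectedFor bl C.walk Finset.univ := by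
  classical
  rw [C.connected_iff]
  constructor
  · intro hC B _ hB
    obtain ⟨hB1, hB2⟩ := (C.isClosedFor_walk_iff B).1 hB
    have hlabel : ∀ i, bl (C.outLabel (C.label i)) ∈ B ↔ bl i ∈ B := by
      intro i
      rcases Int.units_eq_one_or (C.eps i) with e | e
      · rw [C.outLabel_of_out e, C.labelOf_label]
      · have e' : C.orient (C.α (C.label i)) = 1 := C.orient_α_label e
        rw [← C.outLabel_α, C.outLabel_of_out e', ← hB1 i, C.endPairing_of_in e, endLabel]
    have hout : ∀ y, C.orient y = 1 → ¬ C.White y →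
        C.outLabel (C.σ y) = C.outLabel y := by
      intro y ho hb
      rw [← C.outLabel_α (C.σ y), C.outLabel_of_out (C.orient_prev ho hb), C.labelOf_prev hb,
        C.outLabel_of_out ho]
    have h1 := hC {h | bl (C.outLabel h) ∈ B} (fun h => ?_) (fun h => ?_)
    · have hiff : ∀ x, x ∈ B ↔ ∃ i, bl i = x ∧ (C.label i : H) ∈ {h | bl (C.outLabel h) ∈ B} := by
        intro x
        obtain ⟨i, rfl⟩ := hsurj x
        refine ⟨fun h => ⟨i, rfl, (hlabel i).2 h⟩, ?_⟩
        rintro ⟨i', hi, h⟩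
        rw [← hi]
        exact (hlabel i').1 h
      rcases h1 with h1 | h1
      · left
        rw [Finset.eq_empty_iff_forall_notMem]
        intro x hx
        obtain ⟨i, -, hi⟩ := (hiff x).1 hx
        rw [h1] at hi
        exact hi
      · right
        rw [Finset.eq_univ_iff_forall]
        intro x
        obtain ⟨i, rfl⟩ := hsurj x
        refine (hiff _).2 ⟨i, rfl, ?_⟩
        rw [h1]
        exact Set.mem_univ _
    · simp only [Set.mem_ofPred_eq]
      by_cases hw : C.White h
      · rw [← C.label_labelOf hw, ← C.label_rho, hlabel, hlabel,
          (hbl _ _).2 (show C.rho.SameCycle (C.labelOf h) (C.rho (C.labelOf h)) from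
            ⟨1, by simp⟩)]
      · by_cases ho : C.orient h = 1
        · rw [hout h ho hw]
        · obtain ⟨y, rfl⟩ := C.σ.surjective h
          rw [C.white_σ] at hw
          have hoy : C.orient y = 1 := by
            have := C.black_alternated y hw
            rw [sign_ne_one_iff.1 ho] at this
            exact (neg_injective this).symm
          obtain ⟨k, hk⟩ := C.exists_vertex hw
          rw [hout y hoy hw, C.outLabel_of_out hoy,
            C.outLabel_of_out (by rw [C.orient_σ_σ hw, hoy]), ← C.swap_pair hk hoy]
          have := swapProd_invariant [C.pair k] (fun i => bl i ∈ B)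
            (by simpa using hB2 k) (C.labelOf y)
          simpa [swapProd] using this
    · simp only [Set.mem_ofPred_eq, C.outLabel_α]
  · intro hC T hσ hα
    have hmem := C.label_labelOf_mem_iff hσ hα
    have hcyc : ∀ {h h' : H}, C.σ.SameCycle h h' → (h ∈ T ↔ h' ∈ T) := by
      intro h h' hh
      obtain ⟨n, rfl⟩ := hh.exists_nat_pow_eq
      clear hh
      induction n with
      | zero => rfl
      | succ n ih => rw [pow_succ', Perm.mul_apply, hσ, ih]
    have hB : ∀ i, bl i ∈ (Finset.univ.filter fun x => ∃ i, bl i = x ∧ (C.label i : H) ∈ T) ↔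
        (C.label i : H) ∈ T := by
      intro i
      rw [Finset.mem_filter]
      constructor
      · rintro ⟨-, i', hi', h⟩
        exact (hcyc (C.sameCycle_rho_iff.1 ((hbl _ _).1 hi'))).1 h
      · exact fun h => ⟨Finset.mem_univ _, i, rfl, h⟩
    have hend : ∀ n, C.eps n = -1 →
        ((C.label (C.endLabel n) : H) ∈ T ↔ (C.label n : H) ∈ T) := by
      intro n _
      rw [endLabel, hmem, hα]
    have h1 := hC (Finset.univ.filter fun x => ∃ i, bl i = x ∧ (C.label i : H) ∈ T)
      (Finset.subset_univ _) ((C.isClosedFor_walk_iff _).2 ⟨fun i => ?_, fun k => ?_⟩)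
    · rcases h1 with h1 | h1
      · left
        rw [Set.eq_empty_iff_forall_notMem]
        intro h hh
        have := (hB _).2 ((hmem h).2 hh)
        rw [h1] at this
        simp at this
      · right
        rw [Set.eq_univ_iff_forall]
        intro h
        rw [← hmem, ← hB, h1]
        exact Finset.mem_univ _
    · rw [hB, hB]
      rcases Int.units_eq_one_or (C.eps i) with e | e
      · obtain ⟨n, hn, rfl⟩ := C.exists_endLabel e
        rw [C.endPairing_endLabel hn, hend n hn]
      · rw [C.endPairing_of_in e, hend i e]
    · rw [hB, hB]
      obtain ⟨h, hv, -, hl⟩ := (C.mem_pair k (C.pair k).1).2 (Or.inl rfl)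
      obtain ⟨h', hv', -, hl'⟩ := (C.mem_pair k (C.pair k).2).2 (Or.inr rfl)
      rw [← hl, ← hl', hmem, hmem]
      exact hcyc (C.black_cycle h h' (by simp [hv]) (hv.trans hv'.symm))

end UnitaryMap

namespace UMap

variable {I : Type} [LinearOrder I] [Fintype I]

theorem two_mul_eulerChar (C : UMap I) : 2 * C.eulerChar =
    2 * numCycles C.rho + 2 * numCycles C.phi - Nat.card I - 2 * C.1 := by
  obtain ⟨r, q⟩ := C
  induction q using Quotient.inductionOn with
  | _ D =>
  have := D.finite
  exact D.map.two_mul_eulerChar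

theorem connected_iff_isConnectedFor {K : Type*} [Fintype K] [DecidableEq K] {bl : I → K}
    (C : UMap I) (hbl : ∀ i i', bl i = bl i' ↔ C.rho.SameCycle i i')
    (hsurj : Function.Surjective bl) :
    C.Connected ↔ IsConnectedFor bl C.walk Finset.univ := by
  obtain ⟨r, q⟩ := C
  induction q using Quotient.inductionOn with
  | _ D =>
  have := D.finite
  exact D.map.connected_iff_isConnectedFor hbl hsurj

end UMap

/-! ### The genus of a connected walk -/

section Genus

variable {I : Type*} [LinearOrder I] [Fintype I] {K : Type*} [Fintype K] [DecidableEq K]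
  {bl : I → K} {ε : I → ℤˣ} {D : Perm I × (I → List I)}

/-- The transpositions `(o, α o)` have disjoint supports, because `α o` has sign `-1` and is not in
the list. -/
theorem swapProd_pairing {α : Perm I} (hα : ∀ k, α (α k) = k) (hε : ∀ k, ε (α k) = -ε k)
    (l : List I) (hl : l.Nodup) (ho : ∀ o ∈ l, ε o = 1) (x : I) :
    swapProd (l.map fun o => (o, α o)) x = if x ∈ l ∨ α x ∈ l then α x else x := by
  induction l with
  | nil => simp [swapProd]
  | cons o l ih =>
    rw [List.nodup_cons] at hl
    rw [List.map_cons, swapProd_cons, Perm.mul_apply, ih hl.2 fun o h => ho o (by simp [h])]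
    have hoo := ho o (by simp)
    have hαo : α o ∉ l := fun h => by
      have := ho _ (List.mem_cons_of_mem _ h)
      rw [hε, hoo] at this
      exact absurd this (by decide)
    by_cases h1 : x = o
    · subst h1
      simp [hl.1, hαo]
    by_cases h2 : x = α o
    · subst h2
      simp [hα, hl.1, hαo]
    have h3 : α x ≠ o := fun e => h2 (by rw [← e, hα])
    have h4 : α x ≠ α o := fun e => h1 (α.injective e)
    by_cases h5 : x ∈ l ∨ α x ∈ l
    · rw [if_pos h5, if_pos (by simp only [List.mem_cons]; tauto), swap_apply_of_ne_of_ne h3 h4]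
    · rw [if_neg h5, if_neg (by simp only [List.mem_cons]; tauto), swap_apply_of_ne_of_ne h1 h2]

/-- The transpositions of the pairing followed by the transpositions of the walk. -/
noncomputable def fullWord (ε : I → ℤˣ) (D : Perm I × (I → List I)) : List (I × I) :=
  ((outs ε Finset.univ).toList.map fun o => (o, D.1 o)) ++ walkWord D.2

theorem swapProd_fullWord (hD : IsWalk ε Finset.univ D) :
    swapProd (fullWord ε D) = D.1 * walkPerm D.2 := by
  rw [fullWord, swapProd_append, walkPerm]
  congr 1
  ext x
  have hε : ∀ k, ε (D.1 k) = -ε k := fun k => hD.sign k (Finset.mem_univ k)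
  rw [swapProd_pairing hD.invol hε _ (Finset.nodup_toList _) (by simp), if_pos]
  simp only [Finset.mem_toList, Finset.mem_filter, Finset.mem_univ, true_and, hε]
  rcases Int.units_eq_one_or (ε x) with e | e <;> simp [e]

theorem length_fullWord :
    (fullWord ε D).length = (outs ε Finset.univ).card + walkLength D.2 := by
  rw [fullWord, List.length_append, List.length_map, Finset.length_toList, length_walkWord]

theorem mem_fullWord_ne (hD : IsWalk ε Finset.univ D) {z : I × I} (hz : z ∈ fullWord ε D) :
    z.1 ≠ z.2 := by
  rcases List.mem_append.1 hz with hz | hz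
  · obtain ⟨o, -, rfl⟩ := List.mem_map.1 hz
    intro e
    have := hD.sign o (Finset.mem_univ o)
    rw [← show o = D.1 o from e] at this
    exact sign_ne_neg _ this.symm
  · exact (hD.word_mem hz).1.ne

theorem numCycles_eq_card {γ : Perm I} (hbl : ∀ i i', bl i = bl i' ↔ γ.SameCycle i i')
    (hsurj : Function.Surjective bl) : numCycles γ = Fintype.card K := by
  rw [← Nat.card_eq_fintype_card]
  refine Nat.card_eq_of_bijective (Quotient.lift bl fun i i' h => (hbl i i').2 h) ⟨?_, ?_⟩
  · intro c c' h
    induction c using Quotient.inductionOn with | _ i =>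
    induction c' using Quotient.inductionOn with | _ i' =>
    exact Quotient.sound ((hbl i i').1 h)
  · intro x
    obtain ⟨i, rfl⟩ := hsurj x
    exact ⟨Quotient.mk _ i, rfl⟩

/-- The permutation `γ α τ` is obtained from `γ` by as many transpositions as there are elements of
sign `1` plus steps of the walk. Connectedness leaves a single class in
`exists_setoid_numCycles_le`, which gives an inequality; parity makes the difference even. -/
theorem exists_genus [Nonempty K] {γ : Perm I}
    (hbl : ∀ i i', bl i = bl i' ↔ γ.SameCycle i i') (hsurj : Function.Surjective bl)
    (hD : IsWalk ε Finset.univ D) (hc : IsConnectedFor bl D Finset.univ) :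
    ∃ g : ℕ, numCycles (γ * (D.1 * walkPerm D.2)) + Fintype.card K + 2 * g =
      (outs ε Finset.univ).card + walkLength D.2 + 2 := by
  classical
  have heven := even_numCycles_mul_swapProd γ (fullWord ε D) fun z hz => mem_fullWord_ne hD hz
  obtain ⟨s, h1, h2, h3⟩ := exists_setoid_numCycles_le γ (fullWord ε D)
  rw [swapProd_fullWord hD, numCycles_eq_card hbl hsurj, length_fullWord] at heven h3
  obtain ⟨x⟩ := ‹Nonempty K›
  obtain ⟨i₀, -⟩ := hsurj x
  have hcyc : ∀ {i i'}, γ.SameCycle i i' → s i i' := by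
    intro i i' h
    obtain ⟨n, rfl⟩ := h.exists_nat_pow_eq
    clear h
    induction n with
    | zero => exact s.refl' _
    | succ n ih =>
      rw [pow_succ', Perm.mul_apply]
      exact s.trans' ih (h1 _)
  have hB : ∀ i, bl i ∈ (Finset.univ.filter fun x => ∃ i, bl i = x ∧ s i₀ i) ↔ s i₀ i := by
    intro i
    rw [Finset.mem_filter]
    constructor
    · rintro ⟨-, i', hi', h⟩
      exact s.trans' h (hcyc ((hbl _ _).1 hi'))
    · exact fun h => ⟨Finset.mem_univ _, i, rfl, h⟩
  have hrel : ∀ {i i'}, s i i' → (s i₀ i ↔ s i₀ i') := fun h =>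
    ⟨fun h' => s.trans' h' h, fun h' => s.trans' h' (s.symm' h)⟩
  have hpair : ∀ o, ε o = 1 → s o (D.1 o) := by
    intro o ho
    refine h2 (o, D.1 o) (List.mem_append_left _ (List.mem_map.2 ⟨o, ?_, rfl⟩))
    simpa using ho
  -- The blocks meeting the class of `i₀` form a closed set, which by connectedness contains every
  -- block.
  have hclosed : IsClosedFor bl D (Finset.univ.filter fun x => ∃ i, bl i = x ∧ s i₀ i) := by
    constructor
    · intro k
      rw [hB, hB]
      rcases Int.units_eq_one_or (ε k) with e | e
      · exact (hrel (hpair k e)).symm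
      · have := hpair (D.1 k) (by rw [hD.sign k (Finset.mem_univ k), e, neg_neg])
        rw [hD.invol] at this
        exact hrel this
    · intro b a hab
      rw [hB, hB]
      exact hrel (h2 (a, b) (List.mem_append_right _ (mem_walkWord.2 hab)))
  have hall : ∀ i, s i₀ i := by
    intro i
    rcases hc _ (Finset.subset_univ _) hclosed with h | h
    · have := (hB i₀).2 (s.refl' _)
      rw [h] at this
      simp at this
    · rw [← hB, h]
      exact Finset.mem_univ _
  have hcard : Nat.card (Quotient s) ≤ 1 := by
    rw [Finite.card_le_one_iff_subsingleton]
    refine ⟨fun c c' => ?_⟩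
    induction c using Quotient.inductionOn with | _ i =>
    induction c' using Quotient.inductionOn with | _ i' =>
    exact Quotient.sound (s.trans' (s.symm' (hall i)) (hall i'))
  obtain ⟨t, ht⟩ := heven
  -- Here `2t` is the sum of the two numbers of cycles and of the number of transpositions; the
  -- inequality `h3` ensures that the subtraction is a true one.
  exact ⟨(outs ε Finset.univ).card + walkLength D.2 + 1 - t, by omega⟩

theorem two_mul_card_outs (hD : IsWalk ε Finset.univ D) :
    2 * (outs ε Finset.univ).card = Fintype.card I := by
  have h1 := hD.card_outs
  have h2 := Finset.card_filter_add_card_filter_not (s := (Finset.univ : Finset I))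
    (p := fun k => ε k = 1)
  rw [Finset.card_univ] at h2
  rw [← h2]
  change 2 * _ = _ + (ins ε Finset.univ).card
  rw [← h1]
  ring

theorem numCycles_le_card (f : Perm I) : numCycles f ≤ Fintype.card I := by
  rw [← Nat.card_eq_fintype_card]
  exact Nat.card_le_card_of_surjective _ Quotient.mk_surjective

theorem finite_walkLength_le (n : ℕ) : {L : I → List I | walkLength L ≤ n}.Finite := by
  have h1 : (Set.pi Set.univ fun _ : I => {w : List I | w.length ≤ n}).Finite :=
    Set.Finite.pi fun _ => List.finite_length_le I n
  refine h1.subset fun L hL b _ => ?_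
  exact (Finset.single_le_sum (f := fun b => (L b).length) (fun _ _ => Nat.zero_le _)
    (Finset.mem_univ b)).trans hL

end Genus

/-! ### The blocks of a tuple of monomials -/

section Blocks

variable {p l N : ℕ} (P : Fin l → Monomial p)

/-- The index of the monomial to which a position belongs. -/
def blockOf (k : Fin (degTuple P)) : Fin l := (finSigmaFinEquiv.symm k).1

theorem gammaPerm_apply (i : Fin l) (j : Fin (P i).deg) :
    gammaPerm P (finSigmaFinEquiv ⟨i, j⟩) = finSigmaFinEquiv ⟨i, finRotate (P i).deg j⟩ := by
  simp [gammaPerm, Equiv.permCongr_apply]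

theorem gammaPerm_iterate (n : ℕ) (i : Fin l) (j : Fin (P i).deg) :
    (gammaPerm P)^[n] (finSigmaFinEquiv ⟨i, j⟩) =
      finSigmaFinEquiv ⟨i, (finRotate (P i).deg)^[n] j⟩ := by
  induction n with
  | zero => rfl
  | succ n ih =>
    rw [Function.iterate_succ_apply', ih, gammaPerm_apply, Function.iterate_succ_apply']

theorem blockOf_apply (i : Fin l) (j : Fin (P i).deg) :
    blockOf P (finSigmaFinEquiv ⟨i, j⟩) = i := by
  simp [blockOf]

theorem blockOf_gammaPerm (k : Fin (degTuple P)) : blockOf P (gammaPerm P k) = blockOf P k := by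
  obtain ⟨⟨i, j⟩, rfl⟩ := finSigmaFinEquiv.surjective k
  rw [gammaPerm_apply, blockOf_apply, blockOf_apply]

theorem blockOf_surjective : Function.Surjective (blockOf P) := fun i =>
  ⟨finSigmaFinEquiv ⟨i, ⟨0, (P i).deg_pos⟩⟩, blockOf_apply P i _⟩

theorem finRotate_iterate_zero {d : ℕ} (hd : 0 < d) {n : ℕ} (hn : n < d) :
    (finRotate d)^[n] ⟨0, hd⟩ = ⟨n, hn⟩ := by
  induction n with
  | zero => rfl
  | succ n ih =>
    obtain ⟨d, rfl⟩ : ∃ e, d = e + 1 := ⟨d - 1, by omega⟩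
    rw [Function.iterate_succ_apply', ih (by omega)]
    exact finRotate_of_lt (by omega)

theorem finRotate_iterate_self {d : ℕ} (hd : 0 < d) :
    (finRotate d)^[d] ⟨0, hd⟩ = ⟨0, hd⟩ := by
  obtain ⟨d, rfl⟩ : ∃ e, d = e + 1 := ⟨d - 1, by omega⟩
  rw [Function.iterate_succ_apply', finRotate_iterate_zero hd (by omega)]
  exact finRotate_last'

theorem sameCycle_gammaPerm_base (i : Fin l) (j : Fin (P i).deg) :
    (gammaPerm P).SameCycle (finSigmaFinEquiv ⟨i, ⟨0, (P i).deg_pos⟩⟩)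
      (finSigmaFinEquiv ⟨i, j⟩) := by
  refine ⟨(j : ℕ), ?_⟩
  rw [zpow_natCast, ← Perm.iterate_eq_pow, gammaPerm_iterate,
    finRotate_iterate_zero (P i).deg_pos j.2]

theorem blockOf_eq_iff (k k' : Fin (degTuple P)) :
    blockOf P k = blockOf P k' ↔ (gammaPerm P).SameCycle k k' := by
  constructor
  · obtain ⟨⟨i, j⟩, rfl⟩ := finSigmaFinEquiv.surjective k
    obtain ⟨⟨i', j'⟩, rfl⟩ := finSigmaFinEquiv.surjective k'
    rw [blockOf_apply, blockOf_apply]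
    rintro rfl
    exact (sameCycle_gammaPerm_base P i j).symm.trans (sameCycle_gammaPerm_base P i j')
  · intro h
    obtain ⟨n, rfl⟩ := h.exists_nat_pow_eq
    clear h
    induction n with
    | zero => rfl
    | succ n ih => rw [ih, pow_succ', Perm.mul_apply, blockOf_gammaPerm]

theorem minimalPeriod_gammaPerm (i : Fin l) :
    Function.minimalPeriod (gammaPerm P) (finSigmaFinEquiv ⟨i, ⟨0, (P i).deg_pos⟩⟩) =
      (P i).deg := by
  have hper : Function.IsPeriodicPt (gammaPerm P) (P i).deg
      (finSigmaFinEquiv ⟨i, ⟨0, (P i).deg_pos⟩⟩) := by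
    rw [Function.IsPeriodicPt, Function.IsFixedPt, gammaPerm_iterate, finRotate_iterate_self]
  refine le_antisymm (hper.minimalPeriod_le (P i).deg_pos) ?_
  by_contra hlt
  rw [not_le] at hlt
  have h1 := Function.iterate_minimalPeriod (f := gammaPerm P)
    (x := finSigmaFinEquiv ⟨i, ⟨0, (P i).deg_pos⟩⟩)
  have h2 := hper.minimalPeriod_pos (P i).deg_pos
  rw [gammaPerm_iterate, finRotate_iterate_zero _ hlt, finSigmaFinEquiv.apply_eq_iff_eq] at h1
  simp only [Sigma.mk.injEq, heq_eq_eq, true_and, Fin.mk.injEq] at h1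
  omega

theorem evalPoly_word (A : Fin p → Matrix (Fin N) (Fin N) ℂ)
    (U : Matrix.unitaryGroup (Fin N) ℂ) (w : List (Letter p)) :
    evalPoly A U (w.map (FreeAlgebra.ι ℂ)).prod = (w.map (Letter.eval A U)).prod := by
  rw [map_list_prod, List.map_map]
  congr 2
  funext x
  exact FreeAlgebra.lift_ι_apply _ _

theorem evalPoly_toPoly (A : Fin p → Matrix (Fin N) (Fin N) ℂ)
    (U : Matrix.unitaryGroup (Fin N) ℂ) (Q : Monomial p) :
    evalPoly A U Q.toPoly =
      (List.ofFn fun j => evalWord A (Q.word j) * signPow (Q.sign j) U.1).prod := by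
  rw [Monomial.toPoly, evalPoly_word, Monomial.toWord, List.map_flatten, List.prod_flatten,
    List.map_ofFn, List.map_ofFn]
  congr 2
  funext j
  simp only [Function.comp_apply, List.map_append, List.prod_append, List.map_map, List.map_cons,
    List.map_nil, List.prod_cons, List.prod_nil, mul_one]
  congr 1
  · rw [evalWord]
    congr 2
    funext x
    cases x <;> rfl
  · rw [uPow, signPow]
    split_ifs <;> rfl

/-- Read from its first position, the cycle of `γ` on the block of `P_i` lists the factors of the
monomial in order. -/
theorem cycleProd_gammaPerm (A : Fin p → Matrix (Fin N) (Fin N) ℂ)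
    (U : Matrix.unitaryGroup (Fin N) ℂ) (i : Fin l) :
    cycleProd (gammaPerm P) (fun k => matTuple A P k * signPow (signTuple P k) U.1)
      (finSigmaFinEquiv ⟨i, ⟨0, (P i).deg_pos⟩⟩) = evalPoly A U (P i).toPoly := by
  rw [cycleProd, minimalPeriod_gammaPerm, evalPoly_toPoly]
  congr 1
  refine List.ext_getElem (by simp) fun n h1 h2 => ?_
  have hn : n < (P i).deg := by simpa using h1
  simp only [List.getElem_map, List.getElem_range, List.getElem_ofFn, gammaPerm_iterate,
    finRotate_iterate_zero (P i).deg_pos hn]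
  have e : finSigmaFinEquiv.symm (finSigmaFinEquiv ⟨i, ⟨n, hn⟩⟩) =
      (⟨i, ⟨n, hn⟩⟩ : (i : Fin l) × Fin (P i).deg) := by simp
  rw [matTuple, signTuple, e]

/-- The blocks are disjoint and stable under `γ`, and each of them is one cycle. -/
theorem prod_trace_eq_traceOn (hN : N ≠ 0) (A : Fin p → Matrix (Fin N) (Fin N) ℂ)
    (U : Matrix.unitaryGroup (Fin N) ℂ) (s : Finset (Fin l)) :
    ∏ i ∈ s, (evalPoly A U (P i).toPoly).trace =
      traceOn (blockSet (blockOf P) s)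
        (fun k => matTuple A P k * signPow (signTuple P k) U.1) (gammaPerm P) := by
  classical
  have hinv : ∀ s : Finset (Fin l), ∀ k ∈ blockSet (blockOf P) s,
      gammaPerm P k ∈ blockSet (blockOf P) s := by
    intro s k hk
    rwa [mem_blockSet, blockOf_gammaPerm, ← mem_blockSet]
  induction s using Finset.induction_on with
  | empty =>
    have : blockSet (blockOf P) ∅ = ∅ := by simp [blockSet]
    rw [this, traceOn_empty hN, Finset.prod_empty]
  | insert i s hi ih =>
    have hS : blockSet (blockOf P) (insert i s) =
        blockSet (blockOf P) {i} ∪ blockSet (blockOf P) s := by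
      ext k; simp [Finset.mem_insert]
    have hd : Disjoint (blockSet (blockOf P) {i}) (blockSet (blockOf P) s) := by
      rw [Finset.disjoint_left]
      intro k h1 h2
      rw [mem_blockSet, Finset.mem_singleton] at h1
      rw [mem_blockSet, h1] at h2
      exact hi h2
    rw [Finset.prod_insert hi, ih, hS, traceOn_union hN hd _ (hinv _) (hinv _)]
    congr 1
    have hb : blockSet (blockOf P) {i} = Finset.univ.filter
        ((gammaPerm P).SameCycle (finSigmaFinEquiv ⟨i, ⟨0, (P i).deg_pos⟩⟩)) := by
      ext k
      rw [mem_blockSet, Finset.mem_singleton, Finset.mem_filter, ← blockOf_eq_iff, blockOf_apply,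
        eq_comm]
      simp
    rw [hb, traceOn_cycle hN, cycleProd_gammaPerm]

end Blocks

/-! ### Connected walks and connected maps -/

section Expansion

variable {I : Type} [LinearOrder I] [Fintype I] {K : Type*} [Fintype K] [DecidableEq K]
  {bl : I → K} {ε : I → ℤˣ} {γ : Perm I}

theorem blockSet_univ : blockSet bl Finset.univ = Finset.univ := by
  simp [blockSet]

theorem blockOf_inv (hbl : ∀ i i', bl i = bl i' ↔ γ.SameCycle i i') (i i' : I) :
    bl i = bl i' ↔ γ⁻¹.SameCycle i i' := by
  rw [hbl, sameCycle_inv]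

theorem phi_of_mem_connectedMaps {g : ℕ} {C : UMap I} (hC : C ∈ connectedMaps g ε γ⁻¹) :
    C.phi = γ * (C.walk.1 * walkPerm C.walk.2) := by
  rw [C.phi_eq hC.2.1, hC.2.2.2.2, inv_inv]

theorem isWalk_of_mem_connectedMaps {g : ℕ} {C : UMap I} (hC : C ∈ connectedMaps g ε γ⁻¹) :
    IsWalk ε Finset.univ C.walk :=
  hC.2.2.2.1 ▸ C.isWalk_walk

theorem isConnectedFor_of_mem_connectedMaps (hbl : ∀ i i', bl i = bl i' ↔ γ.SameCycle i i')
    (hsurj : Function.Surjective bl) {g : ℕ} {C : UMap I} (hC : C ∈ connectedMaps g ε γ⁻¹) :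
    IsConnectedFor bl C.walk Finset.univ := by
  refine (C.connected_iff_isConnectedFor ?_ hsurj).1 hC.1
  rw [hC.2.2.2.2]
  exact blockOf_inv hbl

/-- There are `l + r` vertices, `m + 2r` edges and `c(φ_C)` faces, where `l` is the number of blocks
and `r` the length of the walk. -/
theorem euler_relation (hbl : ∀ i i', bl i = bl i' ↔ γ.SameCycle i i')
    (hsurj : Function.Surjective bl) {m : ℕ} (hI : Fintype.card I = 2 * m) (g : ℕ) {C : UMap I}
    (hn : C.Nondecreasing) (hρ : C.rho = γ⁻¹) :
    C.eulerChar = 2 - 2 * (g : ℤ) ↔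
      numCycles C.phi + Fintype.card K + 2 * g = m + walkLength C.walk.2 + 2 := by
  have h1 := C.two_mul_eulerChar
  rw [hρ, numCycles_eq_card (blockOf_inv hbl) hsurj, Nat.card_eq_fintype_card, hI] at h1
  rw [C.walkLength_walk hn]
  push_cast at h1
  omega

/-- For a fixed genus, Euler's relation bounds the number of transpositions, since there are at most
`2m` cycles. There are finitely many walks of bounded length, and a map is determined by its walk.
-/
theorem connectedMaps_finite (hbl : ∀ i i', bl i = bl i' ↔ γ.SameCycle i i')
    (hsurj : Function.Surjective bl) {m : ℕ} (hI : Fintype.card I = 2 * m) (g : ℕ) :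
    (connectedMaps g ε γ⁻¹).Finite := by
  have hfin : ((Set.univ : Set (Perm I)) ×ˢ
      {L : I → List I | walkLength L ≤ 2 * m + Fintype.card K + 2 * g}).Finite :=
    Set.finite_univ.prod (finite_walkLength_le _)
  refine Set.Finite.of_finite_image (f := UMap.walk) (hfin.subset ?_) ?_
  · rintro _ ⟨C, hC, rfl⟩
    refine ⟨Set.mem_univ _, ?_⟩
    have h1 := (euler_relation hbl hsurj hI g hC.2.1 hC.2.2.2.2).1 hC.2.2.1
    have h2 := numCycles_le_card C.phi
    change walkLength C.walk.2 ≤ _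
    omega
  · intro C hC C' hC' h
    exact UMap.walk_injective hC.2.1 hC'.2.1 (hC.2.2.2.1.trans hC'.2.2.2.1.symm)
      (hC.2.2.2.2.trans hC'.2.2.2.2.symm) h

/-- The genus is read off the Euler characteristic, so the map determines the index `g`. Conversely
a connected walk comes from a map, whose genus is a natural number by `exists_genus`. -/
theorem connectedMaps_walk_bijective [Nonempty K]
    (hbl : ∀ i i', bl i = bl i' ↔ γ.SameCycle i i') (hsurj : Function.Surjective bl) {m : ℕ}
    (hI : Fintype.card I = 2 * m) :
    Function.Bijective (fun C : Σ g : ℕ, connectedMaps g ε γ⁻¹ =>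
      (⟨⟨C.2.1.walk, blockSet_univ (bl := bl).symm ▸ isWalk_of_mem_connectedMaps C.2.2⟩,
        isConnectedFor_of_mem_connectedMaps hbl hsurj C.2.2⟩ :
        {D : Walk ε (blockSet bl Finset.univ) // IsConnectedFor bl D.1 Finset.univ})) := by
  constructor
  · rintro ⟨g, C, hC⟩ ⟨g', C', hC'⟩ h
    have hw : C.walk = C'.walk := congrArg (fun D => D.1.1) h
    obtain rfl : C = C' := UMap.walk_injective hC.2.1 hC'.2.1
      (hC.2.2.2.1.trans hC'.2.2.2.1.symm) (hC.2.2.2.2.trans hC'.2.2.2.2.symm) hw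
    have hg := hC.2.2.1.symm.trans hC'.2.2.1
    obtain rfl : g = g' := by omega
    rfl
  · rintro ⟨⟨D, hD⟩, hc⟩
    rw [blockSet_univ] at hD
    obtain ⟨C, h1, h2, h3, rfl⟩ := UMap.exists_walk γ⁻¹ hD
    obtain ⟨g, hg⟩ := exists_genus hbl hsurj hD hc
    have hout := two_mul_card_outs hD
    have hphi : C.phi = γ * (C.walk.1 * walkPerm C.walk.2) := by
      rw [C.phi_eq h1, h3, inv_inv]
    refine ⟨⟨g, C, ?_, h1, ?_, h2, h3⟩, rfl⟩
    · exact (C.connected_iff_isConnectedFor (h3 ▸ blockOf_inv hbl) hsurj).2 hc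
    · rw [euler_relation hbl hsurj hI g h1 h3, hphi]
      omega

/-- Euler's relation is used twice: as an equality of exponents of `x`, and modulo two for the sign,
`m + l + c` and `r` having the same parity. -/
theorem weight_identity {x : ℂ} (hx : x ≠ 0) {m r c l g : ℕ} (h : c + l + 2 * g = m + r + 2) :
    (x⁻¹) ^ m * (-x⁻¹) ^ r * x ^ c =
      x ^ (2 - (l : ℤ)) * (-1) ^ (m + l) * (1 / x ^ (2 * g) * (-1) ^ c) := by
  have h1 : (-x⁻¹) ^ r = (-1) ^ r * (x⁻¹) ^ r := by rw [← mul_pow, neg_one_mul]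
  have h2 : (-1 : ℂ) ^ (m + l) * (-1) ^ c = (-1) ^ r := by
    rw [← pow_add]
    have e : m + l + c + 2 * g = r + 2 * (m + 1) := by omega
    have e1 : (-1 : ℂ) ^ (m + l + c + 2 * g) = (-1) ^ (m + l + c) := by
      rw [pow_add, pow_mul]; simp
    have e2 : (-1 : ℂ) ^ (r + 2 * (m + 1)) = (-1) ^ r := by
      rw [pow_add, pow_mul]; simp
    rw [← e1, e, e2]
  have h3 : (x⁻¹) ^ m * (x⁻¹) ^ r * x ^ c = x ^ (2 - (l : ℤ)) * (1 / x ^ (2 * g)) := by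
    rw [zpow_sub₀ hx, zpow_natCast, inv_pow, inv_pow]
    have h4 : x ^ c * x ^ l * x ^ (2 * g) = x ^ m * x ^ r * x ^ 2 := by
      rw [← pow_add, ← pow_add, ← pow_add, ← pow_add, h]
    have hm : x ^ m ≠ 0 := pow_ne_zero _ hx
    have hr : x ^ r ≠ 0 := pow_ne_zero _ hx
    have hl : x ^ l ≠ 0 := pow_ne_zero _ hx
    have hg : x ^ (2 * g) ≠ 0 := pow_ne_zero _ hx
    have e : x ^ (2 : ℤ) = x ^ 2 := by norm_cast
    rw [e]
    rw [div_mul_div_comm, mul_one, ← mul_inv, ← div_eq_inv_mul,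
      div_eq_div_iff (mul_ne_zero hm hr) (mul_ne_zero hl hg)]
    linear_combination h4
  rw [h1]
  linear_combination (-1) ^ r * h3 - x ^ (2 - (l : ℤ)) * (1 / x ^ (2 * g)) * h2

theorem walkWeight_of_mem_connectedMaps {N : ℕ} (hN : N ≠ 0)
    (hbl : ∀ i i', bl i = bl i' ↔ γ.SameCycle i i') (hsurj : Function.Surjective bl) {m : ℕ}
    (hI : Fintype.card I = 2 * m) (M : I → Matrix (Fin N) (Fin N) ℂ) {g : ℕ} {C : UMap I}
    (hC : C ∈ connectedMaps g ε γ⁻¹) :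
    walkWeight bl ε M γ Finset.univ C.walk =
      (N : ℂ) ^ (2 - (Fintype.card K : ℤ)) * (-1) ^ (m + Fintype.card K) *
        (1 / (N : ℂ) ^ (2 * g) * ((-1) ^ numCycles C.phi * trPerm C.phi M)) := by
  have hx : (N : ℂ) ≠ 0 := Nat.cast_ne_zero.2 hN
  have hD := isWalk_of_mem_connectedMaps hC
  have h1 := (euler_relation hbl hsurj hI g hC.2.1 hC.2.2.2.2).1 hC.2.2.1
  have h2 := two_mul_card_outs hD
  have hm : (outs ε Finset.univ).card = m := by omega
  rw [walkWeight, blockSet_univ, ← phi_of_mem_connectedMaps hC, traceOn_univ hN, walkCoeff, hm]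
  linear_combination trPerm C.phi M * weight_identity hx h1

end Expansion

/-! ### Joint moments and cumulants as sums over walks -/

section Moments

variable {p N l : ℕ} (P : Fin l → Monomial p) (A : Fin p → Matrix (Fin N) (Fin N) ℂ)

theorem jointMoment_eq_tsum (hN : N ≠ 0) (hI : Fintype.card (Fin (degTuple P)) ≤ 2 * N)
    (s : Finset (Fin l)) :
    jointMoment (haarU N) (fun i U => (evalPoly A U (P i).toPoly).trace) s =
      ∑' D : Walk (signTuple P) (blockSet (blockOf P) s),
        walkWeight (blockOf P) (signTuple P) (matTuple A P) (gammaPerm P) s D.1 := by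
  rw [jointMoment]
  simp only [prod_trace_eq_traceOn P hN A]
  exact (hasSum_traceOn hN _ _ ((Finset.card_le_univ _).trans hI) _ _).tsum_eq.symm

/-- Cumulants and sums over connected walks satisfy the same recursion with respect to the same
joint moments, hence coincide on nonempty sets of monomials; `1 ≤ l` makes the full set nonempty. -/
theorem haarCumulant_eq_tsum (hN : N ≠ 0) (hl : 1 ≤ l)
    (hI : Fintype.card (Fin (degTuple P)) ≤ 2 * N) :
    haarCumulant A (fun i => (P i).toPoly) =
      ∑' D : {D : Walk (signTuple P) (blockSet (blockOf P) Finset.univ) //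
          IsConnectedFor (blockOf P) D.1 Finset.univ},
        walkWeight (blockOf P) (signTuple P) (matTuple A P) (gammaPerm P) Finset.univ D.1.1 := by
  have : Nonempty (Fin l) := ⟨⟨0, hl⟩⟩
  refine cumulant_unique
    (m := jointMoment (haarU N) fun i U => (evalPoly A U (P i).toPoly).trace)
    (c := jointCumulant (haarU N) fun i U => (evalPoly A U (P i).toPoly).trace)
    (k := fun s => ∑' D : {D : Walk (signTuple P) (blockSet (blockOf P) s) //
          IsConnectedFor (blockOf P) D.1 s},
        walkWeight (blockOf P) (signTuple P) (matTuple A P) (gammaPerm P) s D.1.1)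
    ?_ ?_ ?_ Finset.univ Finset.univ_nonempty
  · simp [jointMoment]
  · intro s x hx
    simp only [jointMoment_eq_partitionSum]
    exact partitionSum_recursion _ hx
  · intro s x hx
    simp only [jointMoment_eq_tsum P A hN hI]
    exact walk_recursion _ hN hI _ (blockOf_gammaPerm P) hx

end Moments

end

end UnitaryMaps

/-! ### The genus expansion of the cumulants -/

theorem proposition3p9 (N p l m : ℕ) (hl : 1 ≤ l)
    (A : Fin p → Matrix (Fin N) (Fin N) ℂ) (P : Fin l → Monomial p)
    (hdeg : degTuple P = 2 * m) (hmN : m ≤ N) :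
    (∀ g : ℕ, (connectedMaps g (signTuple P) (gammaPerm P)⁻¹).Finite) ∧
    (Summable fun g : ℕ => (1 / (N : ℝ) ^ (2 * g)) *
      ∑ᶠ C ∈ connectedMaps g (signTuple P) (gammaPerm P)⁻¹,
        ‖(-1 : ℂ) ^ numCycles C.phi * trPerm C.phi (matTuple A P)‖) ∧
    haarCumulant A (fun i => (P i).toPoly) =
      (N : ℂ) ^ (2 - (l : ℤ)) * (-1 : ℂ) ^ (m + l) *
        ∑' g : ℕ, (1 / (N : ℂ) ^ (2 * g)) *
          ∑ᶠ C ∈ connectedMaps g (signTuple P) (gammaPerm P)⁻¹,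
            (-1 : ℂ) ^ numCycles C.phi * trPerm C.phi (matTuple A P) := by
  have : Nonempty (Fin l) := ⟨⟨0, hl⟩⟩
  have hI : Fintype.card (Fin (degTuple P)) = 2 * m := by rw [Fintype.card_fin, hdeg]
  -- A monomial exists and has positive degree, so `m ≥ 1` and therefore `N ≥ 1`.
  have hpos : 1 ≤ degTuple P :=
    (P ⟨0, hl⟩).deg_pos.trans (Finset.single_le_sum (f := fun i => (P i).deg)
      (fun _ _ => Nat.zero_le _) (Finset.mem_univ (⟨0, hl⟩ : Fin l)))
  have hN : N ≠ 0 := by omega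
  have hx : (N : ℂ) ≠ 0 := Nat.cast_ne_zero.2 hN
  have hI2 : Fintype.card (Fin (degTuple P)) ≤ 2 * N := by omega
  have hfin : ∀ g : ℕ, (connectedMaps g (signTuple P) (gammaPerm P)⁻¹).Finite :=
    connectedMaps_finite (blockOf_eq_iff P) (blockOf_surjective P) hI
  have htsum : ∀ {E : Type} [NormedAddCommGroup E] (g : ℕ) (f : UMap (Fin (degTuple P)) → E),
      ∑' C : connectedMaps g (signTuple P) (gammaPerm P)⁻¹, f C =
        ∑ᶠ C ∈ connectedMaps g (signTuple P) (gammaPerm P)⁻¹, f C := by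
    intro E _ g f
    have := (hfin g).to_subtype
    rw [tsum_eq_finsum (Set.toFinite _), finsum_set_coe_eq_finsum_mem]
  set c : ℂ := (N : ℂ) ^ (2 - (l : ℤ)) * (-1 : ℂ) ^ (m + l) with hc
  have hc0 : c ≠ 0 := mul_ne_zero (zpow_ne_zero _ hx) (pow_ne_zero _ (by norm_num))
  have hw : ∀ C : Σ g : ℕ, connectedMaps g (signTuple P) (gammaPerm P)⁻¹,
      walkWeight (blockOf P) (signTuple P) (matTuple A P) (gammaPerm P) Finset.univ C.2.1.walk =
        c * (1 / (N : ℂ) ^ (2 * C.1) *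
          ((-1) ^ numCycles C.2.1.phi * trPerm C.2.1.phi (matTuple A P))) := by
    intro C
    have := walkWeight_of_mem_connectedMaps hN (blockOf_eq_iff P) (blockOf_surjective P) hI
      (matTuple A P) C.2.2
    rwa [Fintype.card_fin] at this
  set e := Equiv.ofBijective _ (connectedMaps_walk_bijective (ε := signTuple P)
    (blockOf_eq_iff P) (blockOf_surjective P) hI) with he
  have hsummable : Summable fun D : {D : Walk (signTuple P) (blockSet (blockOf P) Finset.univ) //
      IsConnectedFor (blockOf P) D.1 Finset.univ} =>
      ‖walkWeight (blockOf P) (signTuple P) (matTuple A P) (gammaPerm P) Finset.univ D.1.1‖ :=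
    (summable_norm_walk (signTuple P) (blockSet (blockOf P) Finset.univ)
      ((Finset.card_le_univ _).trans hI2)
      (fun φ => traceOn (blockSet (blockOf P) Finset.univ) (matTuple A P) φ)
      (gammaPerm P)).comp_injective Subtype.val_injective
  -- Absolute summability over walks, restricted to connected ones, is transported to maps of all
  -- genera; every regrouping by genus below rests on it.
  have hnorm : Summable fun C : Σ g : ℕ, connectedMaps g (signTuple P) (gammaPerm P)⁻¹ =>
      ‖c * (1 / (N : ℂ) ^ (2 * C.1) *
          ((-1) ^ numCycles C.2.1.phi * trPerm C.2.1.phi (matTuple A P)))‖ := by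
    simp only [← hw]
    exact e.summable_iff.2 hsummable
  refine ⟨hfin, ?_, ?_⟩
  · have h1 := hnorm.sigma
    -- The common factor `c` does not depend on the map and is nonzero, so it may be divided out.
    rw [← summable_mul_left_iff (norm_ne_zero_iff.2 hc0)]
    refine h1.congr fun g => ?_
    simp only [norm_mul c, norm_mul (1 / (N : ℂ) ^ (2 * g)), tsum_mul_left]
    rw [htsum g fun C => ‖(-1 : ℂ) ^ numCycles C.phi * trPerm C.phi (matTuple A P)‖]
    congr 2
    simp
  · rw [haarCumulant_eq_tsum P A hN hl hI2, ← e.tsum_eq]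
    have h2 : ∀ C : Σ g : ℕ, connectedMaps g (signTuple P) (gammaPerm P)⁻¹,
        walkWeight (blockOf P) (signTuple P) (matTuple A P) (gammaPerm P) Finset.univ
          (e C).1.1 = c * (1 / (N : ℂ) ^ (2 * C.1) *
          ((-1) ^ numCycles C.2.1.phi * trPerm C.2.1.phi (matTuple A P))) := hw
    simp only [h2]
    rw [Summable.tsum_sigma hnorm.of_norm]
    simp only [tsum_mul_left]
    simp only [htsum _ fun C => (-1 : ℂ) ^ numCycles C.phi * trPerm C.phi (matTuple A P)]
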